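/- Let $\mathbb{T}^3=\mathbb{R}^3/\mathbb{Z}^3$ with Lebesgue measure $dx$, let $\theta_1,\theta_2,\theta_3>0$ and $\Delta=\theta_1\partial_1^2+\theta_2\partial_2^2+\theta_3\partial_3^2$, let $\alpha\in\{1,2\}$ and $q=\frac{\alpha+1}{\alpha}$, and let $L^q_+=\{V\in L^q(\mathbb{T}^3;\mathbb{R}): V\ge 0\}$. Let $f:\mathbb{R}\to(0,\infty)$ be of Casimir class with no cut-off ($s_0=\infty$), that is: $f$ is continuous and strictly decreasing, $\lim_{s\to-\infty}f(s)=\infty$, and there are $\epsilon,C>0$ with $f(s)\le C(1+s)^{-5/2-\epsilon}$ for all $s\ge0$. Put $F(s)=\int_s^\infty f(t)\,dt$, let $\Lambda>0$, and for $(V,\sigma)\in L^q_+\times\mathbb{R}$ let $$\Phi(V,\sigma)=-\frac{\alpha}{\alpha+1}\int_{\mathbb{T}^3}V^{\frac{\alpha+1}{\alpha}}\,dx-\mathrm{Tr}\,F(-\Delta+V+\sigma)-\sigma\Lambda,$$ where $\mathrm{Tr}\,F(H)$ is the sum of $F$ over the eigenvalues of $H$ in $L^2(\mathbb{T}^3;\mathbb{C})$,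 counted with multiplicity. A stationary state with Casimir function $g$ is a quadruple $(\underline u,\underline\lambda,\underline\mu,\rho)$, where $\underline u=\{u_k\}\subset H^1(\mathbb{T}^3)$ is a complete orthonormal system in $L^2(\mathbb{T}^3;\mathbb{C})$, $\lambda_k\ge0$, $\sum_k\lambda_k<\infty$, $\sum_k\lambda_k\|u_k\|_{H^1}^2<\infty$, $\mu_k\in\mathbb{R}$, $\rho\in L^{\alpha+1}(\mathbb{T}^3)$, $g$ is of Casimir class, and $$(-\Delta+\rho^\alpha)u_k=\mu_ku_k,\qquad \rho=\sum_k\lambda_k|u_k|^2,\qquad \lambda_k=g(\mu_k)\quad\text{for all }k.$$ Then: 1. The trace is finite on $L^q_+\times\mathbb{R}$, and $\Phi: L^q_+\times\mathbb{R}\to\mathbb{R}$ is continuous, strictly concave and bounded from above, and $-\Phi$ is coercive: $-\Phi(V,\sigma)\to\infty$ as $\|V\|_{L^q}+|\sigma|\to\infty$. 2. $\Phi$ has a unique maximizer $(V_0,\sigma_0)$ in $L^q_+\times\mathbb{R}$. 3. The operator $-\Delta+V_0$ has a complete orthonormal system of eigenfunctions $\underline u_0=\{u_{0,k}\}$ with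 eigenvalues $\underline\mu_0=\{\mu_{0,k}\}$; and for every such system, with $\lambda_{0,k}:=f(\mu_{0,k}+\sigma_0)$ and $\rho_0:=\sum_k\lambda_{0,k}|u_{0,k}|^2$, one has $\sum_k\lambda_{0,k}=\Lambda$ and $V_0=\rho_0^\alpha$, and $(\underline u_0,\underline\lambda_0,\underline\mu_0,\rho_0)$ is a stationary state with Casimir function $f(\cdot+\sigma_0)$. 4. This stationary state is unique: if $\sigma\in\mathbb{R}$ and $(\underline u,\underline\lambda,\underline\mu,\rho)$ is a stationary state with Casimir function $f(\cdot+\sigma)$ and $\sum_k\lambda_k=\Lambda$, then $\sigma=\sigma_0$, $\rho=\rho_0$ almost everywhere, $(\underline\mu,\underline\lambda)$ is a renumbering of $(\underline\mu_0,\underline\lambda_0)$, and for every $m\in\mathbb{R}$ the families $\{u_k:\mu_k=m\}$ and $\{u_{0,k}:\mu_{0,k}=m\}$ span the same subspace. -/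

import Mathlib

open MeasureTheory Filter Topology Set
open scoped ENNReal ComplexConjugate

noncomputable section

namespace NLSS

/-! ### The torus, `L²`, `H¹` -/

/-- The standard torus `ℝ³ / ℤ³`. -/
abbrev Torus3 : Type := UnitAddTorus (Fin 3)

/-- Lebesgue measure `dx` on `ℝ³ / ℤ³`, of total mass one. -/
abbrev torusMeasure : Measure Torus3 :=
  Measure.pi fun _ : Fin 3 => (AddCircle.haarAddCircle : Measure UnitAddCircle)

/-- The complex Hilbert space `L²(𝕋³)`. -/
abbrev L2T : Type := Lp ℂ 2 torusMeasure

/-- The symbol `4π² (θ₁ n₁² + θ₂ n₂² + θ₃ n₃²)` of `-Δ`, where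
`Δ = θ₁ ∂₁² + θ₂ ∂₂² + θ₃ ∂₃²`. -/
def laplaceSymbol (θ : Fin 3 → ℝ) (n : Fin 3 → ℤ) : ℝ :=
  4 * Real.pi ^ 2 * ∑ j, θ j * (n j : ℝ) ^ 2

/-- `u ∈ H¹(𝕋³)`. -/
def MemH1 (θ : Fin 3 → ℝ) (u : L2T) : Prop :=
  Summable fun n : Fin 3 → ℤ =>
    (1 + laplaceSymbol θ n) * ‖UnitAddTorus.mFourierCoeff u n‖ ^ 2

/-- `‖u‖²` in `H¹(𝕋³)`, that is `∫ |u|² + ∫ |∇u|²`, for `u ∈ H¹(𝕋³)`. -/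
def h1NormSq (θ : Fin 3 → ℝ) (u : L2T) : ℝ :=
  ∑' n : Fin 3 → ℤ, (1 + laplaceSymbol θ n) * ‖UnitAddTorus.mFourierCoeff u n‖ ^ 2

/-! ### The Schrödinger operator `-Δ + W` -/

/-- The form domain of `-Δ + W`: those `u ∈ H¹` with `∫ |W| |u|² < ∞`.
(For `W` in `L^{3/2}` or `L²` it is all of `H¹`.) -/
def MemFormDomain (θ : Fin 3 → ℝ) (W : Torus3 → ℝ) (u : L2T) : Prop :=
  MemH1 θ u ∧ Integrable (fun x => W x * ‖u x‖ ^ 2) torusMeasure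

/-- The sesquilinear form `∫ (∇φ̄ · ∇u + W φ̄ u) dx` of `-Δ + W`. -/
def schrodingerForm (θ : Fin 3 → ℝ) (W : Torus3 → ℝ) (φ u : L2T) : ℂ :=
  (∑' n : Fin 3 → ℤ, (laplaceSymbol θ n : ℂ) *
      (conj (UnitAddTorus.mFourierCoeff φ n) * UnitAddTorus.mFourierCoeff u n))
    + ∫ x, (W x : ℂ) * (conj (φ x) * u x) ∂torusMeasure

/-- `u` lies in the domain of the self-adjoint operator `-Δ + W` associated with the form,
and `(-Δ + W) u = w`. -/
def SchrodingerMapsTo (θ : Fin 3 → ℝ) (W : Torus3 → ℝ) (u w : L2T) : Prop :=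
  MemFormDomain θ W u ∧
    ∀ φ : L2T, MemFormDomain θ W φ → schrodingerForm θ W φ u = inner ℂ φ w

/-- The eigenspace of `-Δ + W` for the real number `m` (zero if `m` is not an eigenvalue). -/
def schrodingerEigenspace (θ : Fin 3 → ℝ) (W : Torus3 → ℝ) (m : ℝ) : Submodule ℂ L2T :=
  Submodule.span ℂ {u | SchrodingerMapsTo θ W u ((m : ℂ) • u)}

/-- `Tr g(-Δ + W)`, for `g ≥ 0` and `-Δ + W` with discrete spectrum: the sum of `g` over the
eigenvalues, counted with multiplicity. -/
def schrodingerTrace (θ : Fin 3 → ℝ) (W : Torus3 → ℝ) (g : ℝ → ℝ) : ℝ≥0∞ :=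
  ∑' m : ℝ, ((Cardinal.toENat (Module.rank ℂ (schrodingerEigenspace θ W m)) : ℕ∞) : ℝ≥0∞)
    * ENNReal.ofReal (g m)

/-- `u` is a complete orthonormal system in `L²(𝕋³)`. -/
def IsCompleteOrthonormal (u : ℕ → L2T) : Prop :=
  Orthonormal ℂ u ∧ (Submodule.span ℂ (range u)).topologicalClosure = ⊤

/-- `u` is a complete orthonormal system of eigenfunctions of `-Δ + W`, with eigenvalues `μ`. -/
def IsEigensystem (θ : Fin 3 → ℝ) (W : Torus3 → ℝ) (u : ℕ → L2T) (μ : ℕ → ℝ) : Prop :=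
  IsCompleteOrthonormal u ∧ ∀ k, SchrodingerMapsTo θ W (u k) ((μ k : ℂ) • u k)

/-! ### Casimir functions and stationary states -/

/-- The Casimir class, with no cut-off (`s₀ = ∞`). -/
structure CasimirClass (f : ℝ → ℝ) : Prop where
  continuous : Continuous f
  pos : ∀ s, 0 < f s
  strictAnti : StrictAnti f
  tendsto_atBot : Tendsto f atBot atTop
  decay : ∃ ε C : ℝ, 0 < ε ∧ 0 < C ∧ ∀ s, 0 ≤ s → f s ≤ C * (1 + s) ^ (-5 / 2 - ε)

/-- `F(s) = ∫_s^∞ f`. -/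
def casimirPrimitive (f : ℝ → ℝ) (s : ℝ) : ℝ := ∫ t in Ioi s, f t

/-- The state space. -/
structure MemStateSpace (θ : Fin 3 → ℝ) (u : ℕ → L2T) (lam : ℕ → ℝ) : Prop where
  complete : IsCompleteOrthonormal u
  memH1 : ∀ k, MemH1 θ (u k)
  nonneg : ∀ k, 0 ≤ lam k
  summable : Summable lam
  summable_h1 : Summable fun k => lam k * h1NormSq θ (u k)

/-- `(u, lam, μ, ρ)` is a stationary state of the defocusing Schrödinger system with
nonlinearity `ρ^α`, with occupation numbers given by the Casimir function `g`. -/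
structure IsStationaryState (α : ℕ) (θ : Fin 3 → ℝ) (g : ℝ → ℝ)
    (u : ℕ → L2T) (lam μ : ℕ → ℝ) (ρ : Torus3 → ℝ) : Prop where
  casimir : CasimirClass g
  memStateSpace : MemStateSpace θ u lam
  memLp : MemLp ρ ((α : ℝ≥0∞) + 1) torusMeasure
  eigen : ∀ k, SchrodingerMapsTo θ (fun x => ρ x ^ α) (u k) ((μ k : ℂ) • u k)
  density : ∀ᵐ x ∂torusMeasure, HasSum (fun k => lam k * ‖u k x‖ ^ 2) (ρ x)
  occupation : ∀ k, lam k = g (μ k)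

/-! ### The dual functional -/

/-- The exponent `q = (α + 1) / α`. -/
def potentialExponent (α : ℕ) : ℝ≥0∞ := ((α : ℝ≥0∞) + 1) / (α : ℝ≥0∞)

instance (α : ℕ) : Fact (1 ≤ potentialExponent α) := ⟨by
  unfold potentialExponent
  rcases Nat.eq_zero_or_pos α with h | h
  · subst h; simp
  · rw [ENNReal.le_div_iff_mul_le (Or.inl (by simp; omega)) (Or.inl (by simp))]
    simp⟩

/-- The space `L^q(𝕋³)`, `q = (α + 1) / α`, of real potentials. -/
abbrev Potential (α : ℕ) : Type := Lp ℝ (potentialExponent α) torusMeasure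

/-- The domain `L^q_+(𝕋³) × ℝ` of the dual functional. -/
def dualDomain (α : ℕ) : Set (Potential α × ℝ) := {p | 0 ≤ p.1}

/-- `Tr F(-Δ + V + σ)`. -/
def dualTrace (α : ℕ) (θ : Fin 3 → ℝ) (f : ℝ → ℝ) (p : Potential α × ℝ) : ℝ≥0∞ :=
  schrodingerTrace θ (fun x => p.1 x + p.2) (casimirPrimitive f)

/-- The dual functional
`Φ(V, σ) = -(α / (α + 1)) ∫ V ^ ((α + 1) / α) - Tr F(-Δ + V + σ) - σ Λ`. -/
def dualFunctional (α : ℕ) (θ : Fin 3 → ℝ) (f : ℝ → ℝ) (Λ : ℝ) (p : Potential α × ℝ) : ℝ :=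
  -((α : ℝ) / ((α : ℝ) + 1)) * ∫ x, (p.1 x) ^ (((α : ℝ) + 1) / (α : ℝ)) ∂torusMeasure
    - (dualTrace α θ f p).toReal - p.2 * Λ

end NLSS

end

noncomputable section

namespace NLSS

/-! ### Trace inequalities from tangent lines and from matrix elements. -/

section HilbertSums

variable {H : Type*} [NormedAddCommGroup H] [InnerProductSpace ℂ H]

/-! `F` is convex with `F' = -f`, and convexity carries the whole theorem. Averaging tangent lines
of `F` over spectral weights shows that, for an orthonormal family in `H¹`, the sum of `F` over its
energies under `-Δ + V + σ` is at most the trace, with equality for an eigenbasis (Peierls;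
`TangentPair.sum_tangent_le`, `sum_tangent_le_realTrace`). Four facts follow. With the Fourier basis
as reference and the eigenbasis of `-Δ + V` as the family, the spectral sums of `-Δ + V` are bounded
by the corresponding lattice sums, so the trace is finite. With the eigenbasis of a convex
combination as the family, the trace is convex. With tangents at the eigenvalues of `-Δ + V + σ`,
the negative of the density `∑ f(a_k + σ)|u_k|²` is a subgradient (`IsEigensystem.subgradient`),
whence a Lipschitz bound and continuity. With the constant trial function, `-Φ` is coercive.

The analytic input is the embedding `H¹ ⊂ L⁶`, which makes every potential in `L^{3/2}` form
bounded; `q` is `2` or `3/2`, so `L^q ⊂ L^{3/2}` on the torus. The operator is studied through the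
substitution `u = (1 - Δ)^(-1/2) x`, which turns its form into a bounded form on `L²`; its resolvent
at `-1` is compact.

A maximizing sequence needs no weak compactness: the power term is uniformly convex, so the
potentials form a Cauchy sequence in `L^q`, and only the real shifts require a subsequence. Strict
concavity gives uniqueness.

For the Euler–Lagrange equations an upper bound of the trace to first order is needed as well. It is
proved for bounded perturbations only (`tsum_perturbation_le`), by splitting pairs of eigenvalues
into near and far ones, and bounded test directions suffice. Where `V = 0` only increasing `V` is
admissible, which gives `ρ ≤ V^{1/α} = 0`; as `ρ ≥ 0`, equality holds there too, so the constraint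
`V ≥ 0` costs nothing.

Conversely, the subgradient inequality and the tangent inequality for `s^q` make every stationary
state of total mass `Λ` a maximizer (`IsStationaryState.exists_isMaxOn`). So `V` and `σ` are
determined, and with them the density, the eigenspaces and the multiplicities. -/

lemma _root_.HilbertBasis.hasSum_norm_inner_sq {ι : Type*} (b : HilbertBasis ι ℂ H) (x : H) :
    HasSum (fun i => ‖inner ℂ (b i) x‖ ^ 2) (‖x‖ ^ 2) := by
  have h := (Complex.reCLM.hasSum (b.hasSum_inner_mul_inner x x))
  simp only [inner_self_eq_norm_sq_to_K] at h
  convert h using 1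
  · ext i
    have : inner ℂ x (b i) = conj (inner ℂ (b i) x) := (inner_conj_symm _ _).symm
    simp only [this, Complex.reCLM_apply]
    rw [mul_comm, Complex.mul_conj, Complex.normSq_eq_norm_sq, Complex.ofReal_re]
  · simp [← Complex.ofReal_pow]

/-- `F` is convex on `[0, ∞)`, nonnegative, with nonnegative `-f` as a subgradient. -/
structure TangentPair (F f : ℝ → ℝ) : Prop where
  nonneg : ∀ s, 0 ≤ s → 0 ≤ F s
  slope_nonneg : ∀ s, 0 ≤ s → 0 ≤ f s
  tangent : ∀ s m, 0 ≤ s → 0 ≤ m → F m - f m * (s - m) ≤ F s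

lemma TangentPair.le_zero {F f : ℝ → ℝ} (h : TangentPair F f) {s : ℝ} (hs : 0 ≤ s) :
    F s ≤ F 0 := by
  have := h.tangent 0 s le_rfl hs
  nlinarith [h.slope_nonneg s hs]

/-- Jensen's inequality for the probability weights `‖⟨b i, x⟩‖²`, by averaging one tangent line.
The point `m` need not be nonnegative as long as its tangent stays below `F` on `[0, ∞)`; this
allows tangent points to be shifted by `σ` later on. -/
lemma TangentPair.le_tsum {F f : ℝ → ℝ} (h : TangentPair F f) {ι : Type*}
    (b : HilbertBasis ι ℂ H) {a : ι → ℝ} (ha : ∀ i, 0 ≤ a i) {x : H} (hx : ‖x‖ = 1) {q m : ℝ}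
    (hm : 0 ≤ f m) (ht : ∀ s, 0 ≤ s → F m - f m * (s - m) ≤ F s)
    (hs : Summable fun i => a i * ‖inner ℂ (b i) x‖ ^ 2)
    (hq : ∑' i, a i * ‖inner ℂ (b i) x‖ ^ 2 ≤ q) :
    Summable (fun i => F (a i) * ‖inner ℂ (b i) x‖ ^ 2) ∧
    F m - f m * (q - m) ≤ ∑' i, F (a i) * ‖inner ℂ (b i) x‖ ^ 2 := by
  have h1 := b.hasSum_norm_inner_sq x
  rw [hx, one_pow] at h1
  have hS : Summable (fun i => F (a i) * ‖inner ℂ (b i) x‖ ^ 2) := by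
    refine Summable.of_nonneg_of_le (fun i => mul_nonneg (h.nonneg _ (ha i)) (by positivity))
      (fun i => ?_) (h1.summable.mul_left (F 0))
    gcongr
    exact h.le_zero (ha i)
  refine ⟨hS, ?_⟩
  have h2 : HasSum (fun i => (F m + f m * m) * ‖inner ℂ (b i) x‖ ^ 2
      - f m * (a i * ‖inner ℂ (b i) x‖ ^ 2))
      ((F m + f m * m) * 1 - f m * ∑' i, a i * ‖inner ℂ (b i) x‖ ^ 2) :=
    (h1.mul_left _).sub (hs.hasSum.mul_left _)
  have h3 := h2.summable.tsum_le_tsum (fun i => ?_) hS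
  · rw [h2.tsum_eq] at h3
    nlinarith
  · have := ht (a i) (ha i)
    have h4 : 0 ≤ ‖inner ℂ (b i) x‖ ^ 2 := by positivity
    nlinarith

/-- The variational lower bound for `∑ F(aᵢ)`: with `q k` above the mean of `a` in the state
`φ k`, the sum of tangents at any points `m k` stays below. -/
theorem TangentPair.sum_tangent_le {F f : ℝ → ℝ} (h : TangentPair F f) {ι κ : Type*}
    (b : HilbertBasis ι ℂ H) {a : ι → ℝ} (ha : ∀ i, 0 ≤ a i) (hF : Summable fun i => F (a i))
    {φ : κ → H} (hφ : Orthonormal ℂ φ) {q m : κ → ℝ}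
    (hm : ∀ k, 0 ≤ f (m k)) (ht : ∀ k s, 0 ≤ s → F (m k) - f (m k) * (s - m k) ≤ F s)
    (hs : ∀ k, Summable fun i => a i * ‖inner ℂ (b i) (φ k)‖ ^ 2)
    (hq : ∀ k, ∑' i, a i * ‖inner ℂ (b i) (φ k)‖ ^ 2 ≤ q k) (K : Finset κ) :
    ∑ k ∈ K, (F (m k) - f (m k) * (q k - m k)) ≤ ∑' i, F (a i) := by
  have h1 := fun k => h.le_tsum b ha (hφ.1 k) (hm k) (ht k) (hs k) (hq k)
  calc ∑ k ∈ K, (F (m k) - f (m k) * (q k - m k))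
      ≤ ∑ k ∈ K, ∑' i, F (a i) * ‖inner ℂ (b i) (φ k)‖ ^ 2 :=
        Finset.sum_le_sum fun k _ => (h1 k).2
    _ = ∑' i, ∑ k ∈ K, F (a i) * ‖inner ℂ (b i) (φ k)‖ ^ 2 :=
        (Summable.tsum_finsetSum fun k _ => (h1 k).1).symm
    _ ≤ ∑' i, F (a i) := by
        refine Summable.tsum_le_tsum (fun i => ?_) (summable_sum fun k _ => (h1 k).1) hF
        rw [← Finset.mul_sum]
        have hB := hφ.sum_inner_products_le (b i) (s := K)
        rw [b.orthonormal.1 i, one_pow] at hB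
        have : ∑ k ∈ K, ‖inner ℂ (b i) (φ k)‖ ^ 2 ≤ 1 := by
          simpa only [norm_inner_symm (b i)] using hB
        simpa using mul_le_mul_of_nonneg_left this (h.nonneg _ (ha i))

/-- Peierls' inequality. -/
theorem TangentPair.peierls {F f : ℝ → ℝ} (h : TangentPair F f) {ι κ : Type*}
    (b : HilbertBasis ι ℂ H) {a : ι → ℝ} (ha : ∀ i, 0 ≤ a i) (hF : Summable fun i => F (a i))
    {φ : κ → H} (hφ : Orthonormal ℂ φ) {q : κ → ℝ} (hq0 : ∀ k, 0 ≤ q k)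
    (hs : ∀ k, Summable fun i => a i * ‖inner ℂ (b i) (φ k)‖ ^ 2)
    (hq : ∀ k, ∑' i, a i * ‖inner ℂ (b i) (φ k)‖ ^ 2 ≤ q k) :
    Summable (fun k => F (q k)) ∧ ∑' k, F (q k) ≤ ∑' i, F (a i) := by
  have h1 : ∀ K : Finset κ, ∑ k ∈ K, F (q k) ≤ ∑' i, F (a i) := fun K => by
    simpa using h.sum_tangent_le b ha hF hφ (fun k => h.slope_nonneg _ (hq0 k))
      (fun k s hs => h.tangent s _ hs (hq0 k)) hs hq K
  have h2 := summable_of_sum_le (fun k => h.nonneg _ (hq0 k)) h1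
  exact ⟨h2, h2.tsum_le_of_sum_le h1⟩

/-- Parseval for each `x k`, followed by an exchange of two sums of nonnegative terms. -/
lemma hasSum_tsum_mul_norm_inner_sq {ι κ : Type*} (u : HilbertBasis ι ℂ H) {c : κ → ℝ}
    (hc : ∀ k, 0 ≤ c k) (hs : Summable c) {x : κ → H} {M : ℝ} (hx : ∀ k, ‖x k‖ ^ 2 ≤ M) :
    (∀ j, Summable fun k => c k * ‖inner ℂ (u j) (x k)‖ ^ 2) ∧
    HasSum (fun j => ∑' k, c k * ‖inner ℂ (u j) (x k)‖ ^ 2) (∑' k, c k * ‖x k‖ ^ 2) := by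
  have h1 : ∀ k, HasSum (fun j => c k * ‖inner ℂ (u j) (x k)‖ ^ 2) (c k * ‖x k‖ ^ 2) :=
    fun k => (u.hasSum_norm_inner_sq (x k)).mul_left _
  have h2 : Summable fun k => c k * ‖x k‖ ^ 2 :=
    Summable.of_nonneg_of_le (fun k => mul_nonneg (hc k) (by positivity))
      (fun k => mul_le_mul_of_nonneg_left (hx k) (hc k)) (hs.mul_right M)
  have h3 : Summable fun p : κ × ι => c p.1 * ‖inner ℂ (u p.2) (x p.1)‖ ^ 2 := by
    rw [summable_prod_of_nonneg (fun p => mul_nonneg (hc _) (by positivity))]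
    exact ⟨fun k => (h1 k).summable, by simpa only [(h1 _).tsum_eq] using h2⟩
  have h4 := h3.prod_symm
  refine ⟨fun j => h4.prod_factor j, ?_⟩
  have h5 := h4.hasSum.prod_fiberwise (fun j => (h4.prod_factor j).hasSum)
  convert h5 using 1
  · rfl
  rw [h4.tsum_prod]
  refine Eq.trans (tsum_congr fun k => (h1 k).tsum_eq.symm) (Summable.tsum_comm h4)

variable [CompleteSpace H]

/-- The Bregman remainder of `F` is at most `|f a - f b| |b - a|`. For eigenvalues closer than `δ`
the first factor is an oscillation of `f`, and `c X` is split by the weighted arithmetic-geometric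
inequality. For distant ones `|f a - f b| ≤ f a + f b`, while the overlap satisfies `c ≤ X / δ`
because `X` contains the large factor `|b - a|`. -/
lemma bregman_entry_le {F f : ℝ → ℝ} (hF : ∀ s m, F m - f m * (s - m) ≤ F s) (hf : Antitone f)
    (hpos : ∀ s, 0 < f s) {δ τ : ℝ} (hδ : 0 < δ) (hτ : 0 < τ) (a b : ℝ) {c X : ℝ} (hc : 0 ≤ c)
    (hX : X = |b - a| * c) :
    c ^ 2 * (F b - F a + f a * (b - a)) ≤
      (f (a - δ) - f (a + δ)) * ((τ * c ^ 2 + X ^ 2 / τ) / 2) + (f a + f b) * X ^ 2 / δ := by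
  have h1 : F b - F a + f a * (b - a) ≤ |f a - f b| * |b - a| := by
    have := hF a b
    rw [← abs_mul]
    exact le_trans (by nlinarith) (le_abs_self _)
  have hX0 : 0 ≤ X := hX ▸ by positivity
  have hω : 0 ≤ f (a - δ) - f (a + δ) := sub_nonneg.2 (hf (by linarith))
  have hY : c * X ≤ (τ * c ^ 2 + X ^ 2 / τ) / 2 := by
    have : 0 ≤ (τ * c - X) ^ 2 / τ := by positivity
    have h2 : (τ * c - X) ^ 2 / τ = τ * c ^ 2 + X ^ 2 / τ - 2 * (c * X) := by
      field_simp; ring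
    linarith
  have hfa := hpos a
  have hfb := hpos b
  calc c ^ 2 * (F b - F a + f a * (b - a)) ≤ c ^ 2 * (|f a - f b| * |b - a|) := by gcongr
    _ = |f a - f b| * (c * X) := by rw [hX]; ring
    _ ≤ _ := by
      rcases le_or_gt |b - a| δ with hle | hgt
      · have h3 : |f a - f b| ≤ f (a - δ) - f (a + δ) := by
          rw [abs_le] at hle ⊢
          constructor
          · linarith [hf (show a - δ ≤ b by linarith), hf (show a ≤ a + δ by linarith)]
          · linarith [hf (show b ≤ a + δ by linarith), hf (show a - δ ≤ a by linarith)]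
        have h4 : |f a - f b| * (c * X) ≤
            (f (a - δ) - f (a + δ)) * ((τ * c ^ 2 + X ^ 2 / τ) / 2) := by gcongr
        have : 0 ≤ (f a + f b) * X ^ 2 / δ := by positivity
        linarith
      · have h3 : |f a - f b| ≤ f a + f b := by
          rw [abs_le]; constructor <;> linarith
        have h4 : c * X ≤ X ^ 2 / δ := by
          rw [le_div_iff₀ hδ]
          have : δ * c ≤ X := by rw [hX]; gcongr
          nlinarith
        have h5 : |f a - f b| * (c * X) ≤ (f a + f b) * (X ^ 2 / δ) := by gcongr
        have : 0 ≤ (f (a - δ) - f (a + δ)) * ((τ * c ^ 2 + X ^ 2 / τ) / 2) := by positivity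
        rw [mul_div_assoc]
        linarith

/-- First order perturbation: an upper bound for `Tr F(B) - Tr F(A) + Tr (f(A) K)`, where
`K = B - A` is bounded. -/
theorem tsum_perturbation_le {F f : ℝ → ℝ} (hF : ∀ s m, F m - f m * (s - m) ≤ F s)
    (hF0 : ∀ s, 0 ≤ F s) (hf : Antitone f) (hpos : ∀ s, 0 < f s) {ι κ : Type*}
    (u : HilbertBasis ι ℂ H) (v : HilbertBasis κ ℂ H) {a : ι → ℝ} {b : κ → ℝ}
    (K : H →L[ℂ] H) {τ δ : ℝ} (hδ : 0 < δ) (hτ : 0 < τ) (hK : ‖K‖ ≤ τ)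
    (huv : ∀ j k, ((b k - a j : ℝ) : ℂ) * inner ℂ (v k) (u j) = inner ℂ (v k) (K (u j)))
    (hFa : Summable fun j => F (a j)) (hFb : Summable fun k => F (b k))
    (hfa : Summable fun j => f (a j)) (hfb : Summable fun k => f (b k))
    (hfδ : Summable fun j => f (a j - δ)) :
    ∑' k, F (b k) - ∑' j, F (a j) + ∑' j, f (a j) * (inner ℂ (u j) (K (u j))).re ≤
      τ * ∑' j, (f (a j - δ) - f (a j + δ)) +
        τ ^ 2 / δ * (∑' j, f (a j) + ∑' k, f (b k)) := by
  set c : ι → κ → ℝ := fun j k => ‖inner ℂ (u j) (v k)‖ with hc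
  set X : ι → κ → ℝ := fun j k => ‖inner ℂ (v k) (K (u j))‖ with hX
  set ω : ι → ℝ := fun j => f (a j - δ) - f (a j + δ) with hω
  have hω0 : ∀ j, 0 ≤ ω j := fun j => sub_nonneg.2 (hf (by linarith))
  have hωs : Summable ω := by
    refine Summable.of_nonneg_of_le hω0 (fun j => ?_) hfδ
    simp only [hω]; linarith [hpos (a j + δ)]
  have hKx : ∀ j, ‖K (u j)‖ ^ 2 ≤ τ ^ 2 := fun j => by
    have := K.le_of_opNorm_le hK (u j)
    rw [u.orthonormal.1 j, mul_one] at this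
    gcongr
  have hKv : ∀ k, ‖ContinuousLinearMap.adjoint K (v k)‖ ^ 2 ≤ τ ^ 2 := fun k => by
    have := (ContinuousLinearMap.adjoint K).le_of_opNorm_le
      ((LinearIsometryEquiv.norm_map ContinuousLinearMap.adjoint K).trans_le hK) (v k)
    rw [v.orthonormal.1 k, mul_one] at this
    gcongr
  have hXeq : ∀ j k, X j k = |b k - a j| * c j k := fun j k => by
    simp only [hX, hc]
    rw [← huv, norm_mul, Complex.norm_real, Real.norm_eq_abs, norm_inner_symm]
  have hXadj : ∀ j k, X j k = ‖inner ℂ (u j) (ContinuousLinearMap.adjoint K (v k))‖ :=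
    fun j k => by simp only [hX]; rw [ContinuousLinearMap.adjoint_inner_right, norm_inner_symm]
  have hcsum : ∀ j, HasSum (fun k => c j k ^ 2) 1 := fun j => by
    have := v.hasSum_norm_inner_sq (u j)
    rw [u.orthonormal.1 j, one_pow] at this
    simpa only [hc, norm_inner_symm (u j)] using this
  have hXsum : ∀ j, HasSum (fun k => X j k ^ 2) (‖K (u j)‖ ^ 2) := fun j =>
    v.hasSum_norm_inner_sq _
  -- By the intertwining relation `huv`, the mean of `b k - a j` with weights `c j k ^ 2` is the
  -- diagonal element of `K`.
  have hlin : ∀ j, HasSum (fun k => c j k ^ 2 * (b k - a j)) (inner ℂ (u j) (K (u j))).re :=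
    fun j => by
      have := Complex.reCLM.hasSum (v.hasSum_inner_mul_inner (u j) (K (u j)))
      refine HasSum.congr_fun this fun k => ?_
      simp only [Complex.reCLM_apply, hc]
      rw [← huv, ← inner_conj_symm (v k) (u j), ← mul_assoc, mul_comm _ (Complex.ofReal _),
        mul_assoc, Complex.mul_conj, Complex.normSq_eq_norm_sq, ← Complex.ofReal_mul,
        Complex.ofReal_re, mul_comm]
  obtain ⟨hA1, hA2⟩ := hasSum_tsum_mul_norm_inner_sq u (fun k => hF0 (b k)) hFb
    (x := v) (M := 1) (fun k => by simp [v.orthonormal.1 k])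
  obtain ⟨hB1, hB2⟩ := hasSum_tsum_mul_norm_inner_sq u (fun k => (hpos (b k)).le) hfb hKv
  simp only [← hXadj] at hB1 hB2
  -- Sum of the entry bounds over `k`: the squared overlaps add up to one and the `X j k ^ 2` to `‖K
  -- (u j)‖² ≤ τ²`. The term weighted by `f (b k)` has no useful bound row by row; it is kept and
  -- summed over `j` first, by Parseval for the adjoint of `K`.
  have hrow : ∀ j, ∑' k, F (b k) * c j k ^ 2 ≤ F (a j) - f (a j) * (inner ℂ (u j) (K (u j))).re
      + ω j * τ + f (a j) * (τ ^ 2 / δ) + (∑' k, f (b k) * X j k ^ 2) / δ := fun j => by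
    have hs1 : HasSum (fun k => F (a j) * c j k ^ 2 - f (a j) * (c j k ^ 2 * (b k - a j))
        + ω j * ((τ * c j k ^ 2 + X j k ^ 2 / τ) / 2) + f (a j) * (X j k ^ 2 / δ)
        + f (b k) * X j k ^ 2 / δ)
        (F (a j) * 1 - f (a j) * (inner ℂ (u j) (K (u j))).re
        + ω j * ((τ * 1 + ‖K (u j)‖ ^ 2 / τ) / 2) + f (a j) * (‖K (u j)‖ ^ 2 / δ)
        + (∑' k, f (b k) * X j k ^ 2) / δ) :=
      ((((hcsum j).mul_left _).sub ((hlin j).mul_left _)).add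
        (((((hcsum j).mul_left _).add ((hXsum j).div_const _)).div_const _).mul_left _)).add
        (((hXsum j).div_const _).mul_left _) |>.add ((hB1 j).hasSum.div_const _)
    refine ((hA1 j).tsum_le_tsum (fun k => ?_) hs1.summable).trans ?_
    · have := bregman_entry_le hF hf hpos hδ hτ (a j) (b k) (norm_nonneg _) (hXeq j k)
      have h2 : (f (a j) + f (b k)) * X j k ^ 2 / δ =
        f (a j) * (X j k ^ 2 / δ) + f (b k) * X j k ^ 2 / δ := by ring
      rw [h2] at this
      simp only [hω, hc] at this ⊢
      linarith
    · rw [hs1.tsum_eq]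
      have h1 : (τ * 1 + ‖K (u j)‖ ^ 2 / τ) / 2 ≤ τ := by
        have : ‖K (u j)‖ ^ 2 / τ ≤ τ := by
          rw [div_le_iff₀ hτ]; nlinarith [hKx j]
        linarith
      have h2 := mul_le_mul_of_nonneg_left h1 (hω0 j)
      have h3 : f (a j) * (‖K (u j)‖ ^ 2 / δ) ≤ f (a j) * (τ ^ 2 / δ) := by
        have := hpos (a j); have := hKx j
        gcongr
      linarith
  have hKs : Summable fun j => f (a j) * (inner ℂ (u j) (K (u j))).re := by
    refine Summable.of_norm_bounded (hfa.mul_right τ) fun j => ?_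
    rw [norm_mul, Real.norm_of_nonneg (hpos _).le]
    have h1 : ‖(inner ℂ (u j) (K (u j))).re‖ ≤ τ := by
      refine (Complex.abs_re_le_norm _).trans ((norm_inner_le_norm _ _).trans ?_)
      rw [u.orthonormal.1 j, one_mul]
      simpa [u.orthonormal.1 j] using K.le_of_opNorm_le hK (u j)
    have := (hpos (a j)).le
    gcongr
  have hR : HasSum (fun j => F (a j) - f (a j) * (inner ℂ (u j) (K (u j))).re
      + ω j * τ + f (a j) * (τ ^ 2 / δ) + (∑' k, f (b k) * X j k ^ 2) / δ)
      (∑' j, F (a j) - ∑' j, f (a j) * (inner ℂ (u j) (K (u j))).re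
      + (∑' j, ω j) * τ + (∑' j, f (a j)) * (τ ^ 2 / δ)
      + (∑' k, f (b k) * ‖ContinuousLinearMap.adjoint K (v k)‖ ^ 2) / δ) :=
    (((hFa.hasSum.sub hKs.hasSum).add (hωs.hasSum.mul_right _)).add
      (hfa.hasSum.mul_right _)).add (hB2.div_const _)
  have hfin := hA2.summable.tsum_le_tsum hrow hR.summable
  rw [hA2.tsum_eq, hR.tsum_eq] at hfin
  have h5 : ∑' k, f (b k) * ‖ContinuousLinearMap.adjoint K (v k)‖ ^ 2 ≤
      τ ^ 2 * ∑' k, f (b k) := by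
    rw [← tsum_mul_left]
    refine Summable.tsum_le_tsum (fun k => ?_) ?_ (hfb.mul_left _)
    · rw [mul_comm]; have := hpos (b k); have := hKv k; gcongr
    · exact Summable.of_nonneg_of_le (fun k => mul_nonneg (hpos _).le (by positivity))
        (fun k => mul_le_mul_of_nonneg_left (hKv k) (hpos _).le) (hfb.mul_right _)
  have h6 : (∑' k, f (b k) * ‖ContinuousLinearMap.adjoint K (v k)‖ ^ 2) / δ ≤
      τ ^ 2 * (∑' k, f (b k)) / δ := by gcongr
  simp only [v.orthonormal.1, one_pow, mul_one] at hfin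
  have h7 : τ ^ 2 / δ * (∑' j, f (a j) + ∑' k, f (b k)) =
    (∑' j, f (a j)) * (τ ^ 2 / δ) + τ ^ 2 * (∑' k, f (b k)) / δ := by ring
  rw [h7]
  linarith

end HilbertSums

end NLSS

end

noncomputable section

namespace NLSS

/-! ### Operators diagonal in a Hilbert basis. -/

section Diagonal

variable {H : Type*} [NormedAddCommGroup H] [InnerProductSpace ℂ H] {ι : Type*}

lemma ext_hilbertBasis (b : HilbertBasis ι ℂ H) {x y : H}
    (h : ∀ i, inner ℂ (b i) x = inner ℂ (b i) y) : x = y := by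
  apply b.repr.injective
  ext i
  simpa only [HilbertBasis.repr_apply_apply] using h i

lemma exists_of_summable_coeff (b : HilbertBasis ι ℂ H) {c : ι → ℂ}
    (hc : Summable fun i => ‖c i‖ ^ 2) : ∃ x : H, ∀ i, inner ℂ (b i) x = c i := by
  have hm : Memℓp c 2 := memℓp_gen (by simpa using hc)
  refine ⟨b.repr.symm ⟨c, hm⟩, fun i => ?_⟩
  rw [← HilbertBasis.repr_apply_apply, LinearIsometryEquiv.apply_symm_apply]

lemma norm_le_of_coeff_le (b : HilbertBasis ι ℂ H) {x y : H} {M : ℝ} (hM : 0 ≤ M)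
    (h : ∀ i, ‖inner ℂ (b i) y‖ ≤ M * ‖inner ℂ (b i) x‖) : ‖y‖ ≤ M * ‖x‖ := by
  have h1 := b.hasSum_norm_inner_sq y
  have h2 := (b.hasSum_norm_inner_sq x).mul_left (M ^ 2)
  have h3 := hasSum_le (fun i => ?_) h1 h2
  · rw [← mul_pow] at h3
    exact le_of_sq_le_sq h3 (by positivity)
  · rw [← mul_pow]
    exact pow_le_pow_left₀ (norm_nonneg _) (h i) 2

lemma exists_diagonal (b : HilbertBasis ι ℂ H) {c : ι → ℝ} {M : ℝ} (hM : 0 ≤ M)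
    (hc : ∀ i, |c i| ≤ M) :
    ∃ T : H →L[ℂ] H, ∀ x i, inner ℂ (b i) (T x) = c i * inner ℂ (b i) x := by
  have h1 : ∀ x : H, ∃ y : H, ∀ i, inner ℂ (b i) y = c i * inner ℂ (b i) x := fun x => by
    apply exists_of_summable_coeff b
    refine Summable.of_nonneg_of_le (fun _ => by positivity) (fun i => ?_)
      ((b.hasSum_norm_inner_sq x).summable.mul_left (M ^ 2))
    rw [← mul_pow, norm_mul, Complex.norm_real, Real.norm_eq_abs]
    have := hc i
    gcongr
  choose T hT using h1
  refine ⟨LinearMap.mkContinuous ⟨⟨T, fun x y => ?_⟩, fun a x => ?_⟩ M fun x => ?_, hT⟩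
  · exact ext_hilbertBasis b fun i => by simp only [inner_add_right, hT]; ring
  · exact ext_hilbertBasis b fun i => by
      simp only [inner_smul_right, hT, RingHom.id_apply]; ring
  · refine norm_le_of_coeff_le b hM fun i => ?_
    change ‖inner ℂ (b i) (T x)‖ ≤ _
    rw [hT, norm_mul, Complex.norm_real, Real.norm_eq_abs]
    have := hc i
    gcongr

/-- The truncations to finitely many coordinates have finite rank and converge in norm, since all
but finitely many coefficients are small. -/
lemma isCompactOperator_diagonal [CompleteSpace H] (b : HilbertBasis ι ℂ H) {c : ι → ℝ}
    (T : H →L[ℂ] H) (hT : ∀ x i, inner ℂ (b i) (T x) = c i * inner ℂ (b i) x)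
    (hc : Tendsto c cofinite (𝓝 0)) : IsCompactOperator T := by
  classical
  set R : ι → H →L[ℂ] H := fun i => (innerSL ℂ (b i)).smulRight ((c i : ℂ) • b i) with hR
  have hRc : ∀ i, IsCompactOperator (R i) := fun i => by
    have h1 : IsCompactOperator (ContinuousLinearMap.toSpanSingleton ℂ ((c i : ℂ) • b i)) :=
      isCompactOperator_of_locallyCompactSpace_rng _
    exact h1.comp_clm (innerSL ℂ (b i))
  have hS : ∀ s : Finset ι, IsCompactOperator (∑ i ∈ s, R i : H →L[ℂ] H) := fun s => by
    induction s using Finset.induction_on with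
    | empty => simpa using! isCompactOperator_zero
    | insert i s hi ih =>
      rw [Finset.sum_insert hi]
      exact (hRc i).add ih
  have hlim : Tendsto (fun s : Finset ι => ∑ i ∈ s, R i) atTop (𝓝 T) := by
    rw [Metric.tendsto_atTop]
    intro ε hε
    have h1 : {i | ¬ |c i| < ε / 2}.Finite := by
      have := hc.eventually (Metric.ball_mem_nhds (0 : ℝ) (half_pos hε))
      simpa [Filter.eventually_cofinite, Real.dist_eq] using this
    refine ⟨h1.toFinset, fun s hs => ?_⟩
    rw [dist_comm, dist_eq_norm]
    refine lt_of_le_of_lt (ContinuousLinearMap.opNorm_le_bound _ (half_pos hε).le fun x => ?_)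
      (half_lt_self hε)
    refine norm_le_of_coeff_le b (half_pos hε).le fun i => ?_
    have h2 : inner ℂ (b i) ((∑ j ∈ s, R j) x) =
        if i ∈ s then (c i : ℂ) * inner ℂ (b i) x else 0 := by
      simp only [hR, _root_.sum_apply, inner_sum,
        ContinuousLinearMap.smulRight_apply, inner_smul_right, innerSL_apply_apply,
        orthonormal_iff_ite.1 b.orthonormal]
      simp [mul_comm]
    rw [_root_.sub_apply, inner_sub_right, hT, h2]
    split_ifs with h
    · simp; positivity
    · rw [sub_zero, norm_mul, Complex.norm_real, Real.norm_eq_abs]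
      have : |c i| < ε / 2 := by
        by_contra h3
        exact h (hs (h1.mem_toFinset.2 h3))
      gcongr
  exact isCompactOperator_of_tendsto hlim (Eventually.of_forall hS)

end Diagonal

/-! ### The Bessel potential and `H¹` as its range. -/

section Fourier

variable {θ : Fin 3 → ℝ}

/-- The Fourier basis of `L²(𝕋³)`. -/
def fourierBasis : HilbertBasis (Fin 3 → ℤ) ℂ L2T := UnitAddTorus.mFourierBasis

lemma mFourierCoeff_eq_inner (u : L2T) (n : Fin 3 → ℤ) :
    UnitAddTorus.mFourierCoeff u n = inner ℂ (fourierBasis n) u :=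
  (UnitAddTorus.mFourierBasis_repr u n).symm.trans (HilbertBasis.repr_apply_apply _ _ _)

lemma laplaceSymbol_nonneg (hθ : ∀ j, 0 < θ j) (n : Fin 3 → ℤ) : 0 ≤ laplaceSymbol θ n := by
  unfold laplaceSymbol
  have : ∀ j, 0 ≤ θ j * (n j : ℝ) ^ 2 := fun j => mul_nonneg (hθ j).le (sq_nonneg _)
  have := Finset.sum_nonneg fun j (_ : j ∈ Finset.univ) => this j
  positivity

/-- The Fourier multiplier of `(1 - Δ)^(-1/2)`. -/
def rootSymbol (θ : Fin 3 → ℝ) (n : Fin 3 → ℤ) : ℝ := (√(1 + laplaceSymbol θ n))⁻¹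

lemma rootSymbol_pos (hθ : ∀ j, 0 < θ j) (n : Fin 3 → ℤ) : 0 < rootSymbol θ n := by
  have := laplaceSymbol_nonneg hθ n
  unfold rootSymbol
  positivity

lemma rootSymbol_le_one (hθ : ∀ j, 0 < θ j) (n : Fin 3 → ℤ) : rootSymbol θ n ≤ 1 := by
  have := laplaceSymbol_nonneg hθ n
  unfold rootSymbol
  exact inv_le_one_of_one_le₀ (Real.one_le_sqrt.2 (by linarith))

lemma weight_mul_rootSymbol_sq (hθ : ∀ j, 0 < θ j) (n : Fin 3 → ℤ) :
    (1 + laplaceSymbol θ n) * rootSymbol θ n ^ 2 = 1 := by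
  have := laplaceSymbol_nonneg hθ n
  unfold rootSymbol
  rw [inv_pow, Real.sq_sqrt (by linarith), mul_inv_cancel₀ (by linarith)]

lemma exists_besselPotential (hθ : ∀ j, 0 < θ j) :
    ∃ T : L2T →L[ℂ] L2T, ∀ x n, inner ℂ (fourierBasis n) (T x) =
      rootSymbol θ n * inner ℂ (fourierBasis n) x :=
  exists_diagonal fourierBasis zero_le_one fun n => by
    rw [abs_of_pos (rootSymbol_pos hθ n)]; exact rootSymbol_le_one hθ n

/-- The operator `(1 - Δ)^(-1/2)`. -/
def besselPotential (θ : Fin 3 → ℝ) (hθ : ∀ j, 0 < θ j) : L2T →L[ℂ] L2T :=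
  (exists_besselPotential hθ).choose

lemma inner_besselPotential (hθ : ∀ j, 0 < θ j) (x : L2T) (n : Fin 3 → ℤ) :
    inner ℂ (fourierBasis n) (besselPotential θ hθ x) =
      rootSymbol θ n * inner ℂ (fourierBasis n) x :=
  (exists_besselPotential hθ).choose_spec x n

lemma besselPotential_injective (hθ : ∀ j, 0 < θ j) :
    Function.Injective (besselPotential θ hθ) := fun x y h => by
  refine ext_hilbertBasis fourierBasis fun n => ?_
  have h1 := inner_besselPotential hθ x n
  rw [h, inner_besselPotential hθ y n] at h1
  have : (rootSymbol θ n : ℂ) ≠ 0 := by exact_mod_cast (rootSymbol_pos hθ n).ne'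
  exact (mul_left_cancel₀ this h1).symm

lemma norm_besselPotential_le (hθ : ∀ j, 0 < θ j) (x : L2T) : ‖besselPotential θ hθ x‖ ≤ ‖x‖ := by
  rw [← one_mul ‖x‖]
  refine norm_le_of_coeff_le fourierBasis zero_le_one fun n => ?_
  rw [inner_besselPotential, norm_mul, Complex.norm_real, Real.norm_eq_abs,
    abs_of_pos (rootSymbol_pos hθ n)]
  have := rootSymbol_le_one hθ n
  gcongr

lemma hasSum_inner_fourier (x y : L2T) :
    HasSum (fun n => conj (inner ℂ (fourierBasis n) x) * inner ℂ (fourierBasis n) y)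
      (inner ℂ x y) := by
  simpa only [inner_conj_symm] using fourierBasis.hasSum_inner_mul_inner x y

lemma inner_besselPotential_left (hθ : ∀ j, 0 < θ j) (x y : L2T) :
    inner ℂ (besselPotential θ hθ x) y = inner ℂ x (besselPotential θ hθ y) := by
  refine (hasSum_inner_fourier _ _).unique ?_
  convert hasSum_inner_fourier x (besselPotential θ hθ y) using 2 with n
  rw [inner_besselPotential, inner_besselPotential, map_mul, Complex.conj_ofReal]
  ring

/-- Together with `MemH1.exists_eq`, this makes `(1 - Δ)^(-1/2)` an isometry of `L²` onto `H¹`.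
Forms on `H¹` can thus be treated as bounded forms on `L²`, and `H¹` never has to be given a Hilbert
space structure. -/
lemma memH1_besselPotential (hθ : ∀ j, 0 < θ j) (x : L2T) :
    MemH1 θ (besselPotential θ hθ x) ∧ h1NormSq θ (besselPotential θ hθ x) = ‖x‖ ^ 2 := by
  have h : HasSum (fun n : Fin 3 → ℤ => (1 + laplaceSymbol θ n) *
      ‖UnitAddTorus.mFourierCoeff (besselPotential θ hθ x) n‖ ^ 2) (‖x‖ ^ 2) := by
    convert fourierBasis.hasSum_norm_inner_sq x using 2 with n
    rw [mFourierCoeff_eq_inner, inner_besselPotential, norm_mul, mul_pow, Complex.norm_real,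
      Real.norm_eq_abs, sq_abs, ← mul_assoc, weight_mul_rootSymbol_sq hθ, one_mul]
  exact ⟨h.summable, h.tsum_eq⟩

lemma MemH1.exists_eq (hθ : ∀ j, 0 < θ j) {u : L2T} (hu : MemH1 θ u) :
    ∃ x, besselPotential θ hθ x = u := by
  have hr := fun n => (rootSymbol_pos hθ n).ne'
  obtain ⟨x, hx⟩ := exists_of_summable_coeff fourierBasis
    (c := fun n => ((rootSymbol θ n)⁻¹ : ℝ) * inner ℂ (fourierBasis n) u) (by
      refine hu.congr fun n => ?_
      rw [mFourierCoeff_eq_inner, norm_mul, mul_pow, Complex.norm_real, Real.norm_eq_abs, sq_abs,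
        inv_pow, ← eq_inv_of_mul_eq_one_left (weight_mul_rootSymbol_sq hθ n)])
  refine ⟨x, ext_hilbertBasis fourierBasis fun n => ?_⟩
  rw [inner_besselPotential, hx, ← mul_assoc, ← Complex.ofReal_mul, mul_inv_cancel₀ (hr n)]
  simp

/-- The form of `-Δ` pulled back to `L²` is that of the multiplier `ℓ r² = 1 - r²`, with `ℓ` the
symbol of `-Δ` and `r` that of the Bessel potential. -/
lemma tsum_laplaceSymbol_mul (hθ : ∀ j, 0 < θ j) (x y : L2T) :
    ∑' n : Fin 3 → ℤ, (laplaceSymbol θ n : ℂ) *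
      (conj (UnitAddTorus.mFourierCoeff (besselPotential θ hθ x) n) *
        UnitAddTorus.mFourierCoeff (besselPotential θ hθ y) n) =
    inner ℂ x y - inner ℂ (besselPotential θ hθ x) (besselPotential θ hθ y) := by
  refine HasSum.tsum_eq ?_
  refine HasSum.congr_fun ((hasSum_inner_fourier x y).sub
    (hasSum_inner_fourier (besselPotential θ hθ x) (besselPotential θ hθ y))) fun n => ?_
  rw [mFourierCoeff_eq_inner, mFourierCoeff_eq_inner, inner_besselPotential,
    inner_besselPotential, map_mul, Complex.conj_ofReal]
  have h : ((1 + laplaceSymbol θ n : ℝ) : ℂ) * (rootSymbol θ n : ℂ) ^ 2 = 1 := by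
    exact_mod_cast congrArg Complex.ofReal (weight_mul_rootSymbol_sq hθ n)
  have h' : (laplaceSymbol θ n : ℂ) * (rootSymbol θ n : ℂ) ^ 2 =
      1 - (rootSymbol θ n : ℂ) ^ 2 := by
    rw [← h]; push_cast; ring
  linear_combination (conj (inner ℂ (fourierBasis n) x) * inner ℂ (fourierBasis n) y) * h'

end Fourier

end NLSS

end

noncomputable section

namespace NLSS

/-! ### Sums over the frequency lattice. -/

section Lattice

variable {θ : Fin 3 → ℝ}

lemma exists_le_laplaceSymbol (hθ : ∀ j, 0 < θ j) :
    ∃ c : ℝ, 0 < c ∧ ∀ (n : Fin 3 → ℤ) (j : Fin 3), c * (n j : ℝ) ^ 2 ≤ laplaceSymbol θ n := by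
  obtain ⟨i, -, hi⟩ := Finset.exists_min_image Finset.univ θ ⟨0, Finset.mem_univ 0⟩
  have hπ := Real.pi_pos
  have h0 := hθ i
  refine ⟨4 * Real.pi ^ 2 * θ i, by positivity, fun n j => ?_⟩
  have h1 : ∀ k, 0 ≤ θ k * (n k : ℝ) ^ 2 := fun k => mul_nonneg (hθ k).le (sq_nonneg _)
  have h2 := Finset.single_le_sum (fun k _ => h1 k) (Finset.mem_univ j)
  have h3 : θ i * (n j : ℝ) ^ 2 ≤ θ j * (n j : ℝ) ^ 2 :=
    mul_le_mul_of_nonneg_right (hi j (Finset.mem_univ j)) (sq_nonneg _)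
  unfold laplaceSymbol
  rw [mul_assoc]
  have := h3.trans h2
  gcongr

/-- Splitting the exponent evenly over the coordinates reduces lattice sums to cubes of
one-dimensional sums, with no counting of lattice points. -/
lemma weight_rpow_le_prod {c : ℝ} (hc : 0 < c) (n : Fin 3 → ℤ) {w : ℝ}
    (h : ∀ j, c * (n j : ℝ) ^ 2 ≤ w) {r : ℝ} (hr : 0 ≤ r) :
    (1 + w) ^ (-r) ≤ ∏ j, (1 + c * (n j : ℝ) ^ 2) ^ (-(r / 3)) := by
  have hw : 0 ≤ w := le_trans (by positivity) (h 0)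
  have h1 : (1 + w) ^ (-r) = ∏ _j : Fin 3, (1 + w) ^ (-(r / 3)) := by
    rw [Finset.prod_const, Finset.card_univ, Fintype.card_fin, ← Real.rpow_natCast,
      ← Real.rpow_mul (by linarith)]
    congr 1
    push_cast
    ring
  rw [h1]
  refine Finset.prod_le_prod (fun j _ => by positivity) fun j _ => ?_
  have := h j
  exact Real.rpow_le_rpow_of_nonpos (by positivity) (by linarith) (by linarith)

lemma sum_prod_le_pow (s : Finset (Fin 3 → ℤ)) (t : Finset ℤ) (h : ∀ n ∈ s, ∀ j, n j ∈ t)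
    {g : ℤ → ℝ} (hg : ∀ m, 0 ≤ g m) : ∑ n ∈ s, ∏ j, g (n j) ≤ (∑ m ∈ t, g m) ^ 3 := by
  classical
  have h1 : s ⊆ Fintype.piFinset fun _ : Fin 3 => t := fun n hn => by
    rw [Fintype.mem_piFinset]; exact h n hn
  refine (Finset.sum_le_sum_of_subset_of_nonneg h1 fun n _ _ =>
    Finset.prod_nonneg fun j _ => hg _).trans ?_
  rw [Finset.sum_prod_piFinset t fun _ => g]
  simp

/-- After the product bound each one-dimensional factor decays like `|m|^(-2r/3)`, which is summable
for `r > 3/2`. -/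
lemma summable_weight_rpow (hθ : ∀ j, 0 < θ j) {r : ℝ} (hr : 3 / 2 < r) :
    Summable fun n : Fin 3 → ℤ => (1 + laplaceSymbol θ n) ^ (-r) := by
  classical
  obtain ⟨c, hc, hcn⟩ := exists_le_laplaceSymbol hθ
  set g : ℤ → ℝ := fun m => (1 + c * (m : ℝ) ^ 2) ^ (-(r / 3)) with hg
  have hg0 : ∀ m, 0 ≤ g m := fun m => by positivity
  have hgs : Summable g := by
    have h1 : Summable fun m : ℤ => (c ^ (-(r / 3))) * |(m : ℝ)| ^ (-(2 * (r / 3))) :=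
      (Real.summable_abs_int_rpow (by linarith)).mul_left _
    refine Summable.of_norm_bounded_eventually h1 ?_
    filter_upwards [eventually_cofinite_ne (0 : ℤ)] with m hm
    rw [Real.norm_of_nonneg (hg0 m)]
    have hm' : 0 < |(m : ℝ)| := abs_pos.2 (by exact_mod_cast hm)
    calc g m ≤ (c * (m : ℝ) ^ 2) ^ (-(r / 3)) := by
          refine Real.rpow_le_rpow_of_nonpos ?_ (by linarith) (by linarith)
          rw [← sq_abs]; positivity
      _ = _ := by
          rw [Real.mul_rpow hc.le (sq_nonneg _), ← sq_abs, ← Real.rpow_natCast |(m : ℝ)| 2,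
            ← Real.rpow_mul hm'.le]
          congr 2
          push_cast
          ring
  refine summable_of_sum_le (c := (∑' m, g m) ^ 3) (fun n => ?_) fun s => ?_
  · have := laplaceSymbol_nonneg hθ n
    positivity
  · set t : Finset ℤ := s.biUnion fun n => Finset.univ.image n
    have ht : ∀ n ∈ s, ∀ j, n j ∈ t := fun n hn j =>
      Finset.mem_biUnion.2 ⟨n, hn, Finset.mem_image_of_mem _ (Finset.mem_univ j)⟩
    calc _ ≤ ∑ n ∈ s, ∏ j, g (n j) := Finset.sum_le_sum fun n _ =>
            weight_rpow_le_prod hc n (hcn n) (by linarith)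
      _ ≤ (∑ m ∈ t, g m) ^ 3 := sum_prod_le_pow s t ht hg0
      _ ≤ _ := pow_le_pow_left₀ (Finset.sum_nonneg fun m _ => hg0 m)
            (hgs.sum_le_tsum t fun m _ => hg0 m) 3

/-- The sum of `|m|^(-2/3)` grows like `N^(1/3)`, whose cube is linear. In the induction, `x³ - y³ =
1` for the consecutive cube roots gives `x^(-2) ≤ 3 (x - y)`; the two new terms `±(N + 1)` turn the
`3` into `6`. -/
lemma sum_Icc_rpow_neg_third_le {c : ℝ} (hc : 0 < c) (N : ℕ) :
    ∑ m ∈ Finset.Icc (-(N : ℤ)) N, (1 + c * (m : ℝ) ^ 2) ^ (-(1 / 3 : ℝ)) ≤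
      1 + 6 * c ^ (-(1 / 3 : ℝ)) * (N : ℝ) ^ (1 / 3 : ℝ) := by
  induction N with
  | zero => simp
  | succ N ih =>
    have h1 : Finset.Icc (-((N + 1 : ℕ) : ℤ)) ((N + 1 : ℕ) : ℤ) =
        insert (-(N : ℤ) - 1) (insert ((N : ℤ) + 1) (Finset.Icc (-N : ℤ) N)) := by
      ext m; simp only [Finset.mem_Icc, Finset.mem_insert]; omega
    rw [h1, Finset.sum_insert (by simp; omega), Finset.sum_insert (by simp)]
    set x : ℝ := ((N + 1 : ℕ) : ℝ) ^ (1 / 3 : ℝ) with hx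
    set y : ℝ := (N : ℝ) ^ (1 / 3 : ℝ) with hy
    have hx0 : 0 < x := by positivity
    have hy0 : 0 ≤ y := by positivity
    have hx3 : x ^ 3 = N + 1 := by
      rw [hx, ← Real.rpow_natCast, ← Real.rpow_mul (by positivity)]; norm_num
    have hy3 : y ^ 3 = N := by
      rw [hy, ← Real.rpow_natCast, ← Real.rpow_mul (by positivity)]; norm_num
    have hyx : y ≤ x := Real.rpow_le_rpow (by positivity) (by push_cast; linarith) (by norm_num)
    have hstep : (x ^ 2)⁻¹ ≤ 3 * (x - y) := by
      rw [inv_le_iff_one_le_mul₀ (by positivity)]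
      have : (x - y) * (x ^ 2 + x * y + y ^ 2) = 1 := by ring_nf; linarith
      have h2 : (x - y) * (x ^ 2 + x * y + y ^ 2) ≤ (x - y) * (3 * x ^ 2) :=
        mul_le_mul_of_nonneg_left (by nlinarith) (by linarith)
      linarith
    have hterm : (1 + c * ((N : ℝ) + 1) ^ 2) ^ (-(1 / 3 : ℝ)) ≤
        c ^ (-(1 / 3 : ℝ)) * (x ^ 2)⁻¹ := by
      calc _ ≤ (c * ((N : ℝ) + 1) ^ 2) ^ (-(1 / 3 : ℝ)) :=
            Real.rpow_le_rpow_of_nonpos (by positivity) (by linarith) (by norm_num)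
        _ = _ := by
            rw [Real.mul_rpow hc.le (by positivity), hx]
            congr 1
            rw [← Real.rpow_natCast, ← Real.rpow_natCast, ← Real.rpow_mul (by positivity),
              ← Real.rpow_mul (by positivity), ← Real.rpow_neg (by positivity)]
            push_cast
            congr 1
            norm_num
    have e1 : (((-(N : ℤ) - 1 : ℤ) : ℝ)) ^ 2 = ((N : ℝ) + 1) ^ 2 := by push_cast; ring
    have e2 : ((((N : ℤ) + 1 : ℤ) : ℝ)) ^ 2 = ((N : ℝ) + 1) ^ 2 := by push_cast; ring
    rw [e1, e2]
    have hcc : 0 < c ^ (-(1 / 3 : ℝ)) := by positivity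
    have := mul_le_mul_of_nonneg_left hstep hcc.le
    nlinarith

/-- `∑ 1 / (1 - Δ)` over the Fourier modes of frequency at most `R` is `O(R)`. -/
lemma exists_sum_rootSymbol_sq_le (hθ : ∀ j, 0 < θ j) :
    ∃ C : ℝ, 0 < C ∧ ∀ R : ℝ, 0 < R → ∃ S : Finset (Fin 3 → ℤ),
      (∀ n, n ∈ S ↔ 1 + laplaceSymbol θ n ≤ R ^ 2) ∧ ∑ n ∈ S, rootSymbol θ n ^ 2 ≤ C * R := by
  classical
  obtain ⟨c, hc, hcn⟩ := exists_le_laplaceSymbol hθ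
  refine ⟨(1 + 6 * c ^ (-(1 / 3 : ℝ)) * (1 / √c) ^ (1 / 3 : ℝ)) ^ 3, by positivity,
    fun R hR => ?_⟩
  set N : ℕ := ⌊R / √c⌋₊ with hN
  have hmem : ∀ n : Fin 3 → ℤ, 1 + laplaceSymbol θ n ≤ R ^ 2 → ∀ j,
      n j ∈ Finset.Icc (-(N : ℤ)) N := fun n hn j => by
    have h1 : c * (n j : ℝ) ^ 2 ≤ R ^ 2 := by linarith [hcn n j]
    have h2 : |(n j : ℝ)| ≤ R / √c := by
      rw [le_div_iff₀ (by positivity)]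
      refine le_of_sq_le_sq ?_ hR.le
      rw [mul_pow, sq_abs, Real.sq_sqrt hc.le]; linarith
    have h3 : (n j).natAbs ≤ N := by
      rw [hN]
      apply Nat.le_floor
      rw [Nat.cast_natAbs, Int.cast_abs]
      exact h2
    rw [Finset.mem_Icc]; omega
  refine ⟨(Fintype.piFinset fun _ => Finset.Icc (-(N : ℤ)) N).filter
    fun n => 1 + laplaceSymbol θ n ≤ R ^ 2, fun n => ?_, ?_⟩
  · rw [Finset.mem_filter, Fintype.mem_piFinset]
    exact ⟨fun h => h.2, fun h => ⟨hmem n h, h⟩⟩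
  -- For `R < 1` no mode qualifies; for `R ≥ 1` the additive `1` of the one-dimensional bound is
  -- absorbed by `R^(1/3)`.
  · rcases lt_or_ge R 1 with hR1 | hR1
    · rw [Finset.sum_eq_zero]
      · positivity
      · intro n hn
        have := (Finset.mem_filter.1 hn).2
        nlinarith [laplaceSymbol_nonneg hθ n]
    · calc _ ≤ ∑ n ∈ (Fintype.piFinset fun _ => Finset.Icc (-(N : ℤ)) N).filter
            (fun n => 1 + laplaceSymbol θ n ≤ R ^ 2),
            ∏ j : Fin 3, (1 + c * (n j : ℝ) ^ 2) ^ (-(1 / 3 : ℝ)) := by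
            refine Finset.sum_le_sum fun n _ => ?_
            have h1 := weight_rpow_le_prod hc n (hcn n) zero_le_one
            have h2 := laplaceSymbol_nonneg hθ n
            rwa [Real.rpow_neg_one, inv_eq_one_div,
              ← eq_one_div_of_mul_eq_one_right (weight_mul_rootSymbol_sq hθ n)] at h1
        _ ≤ (∑ m ∈ Finset.Icc (-(N : ℤ)) N, (1 + c * (m : ℝ) ^ 2) ^ (-(1 / 3 : ℝ))) ^ 3 :=
            sum_prod_le_pow _ _ (fun n hn => hmem n (Finset.mem_filter.1 hn).2)
              (g := fun m => (1 + c * (m : ℝ) ^ 2) ^ (-(1 / 3 : ℝ))) fun m => by positivity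
        _ ≤ ((1 + 6 * c ^ (-(1 / 3 : ℝ)) * (1 / √c) ^ (1 / 3 : ℝ)) * R ^ (1 / 3 : ℝ)) ^ 3 := by
            refine pow_le_pow_left₀ (Finset.sum_nonneg fun m _ => by positivity) ?_ 3
            refine (sum_Icc_rpow_neg_third_le hc N).trans ?_
            have h1 : (N : ℝ) ^ (1 / 3 : ℝ) ≤ (1 / √c) ^ (1 / 3 : ℝ) * R ^ (1 / 3 : ℝ) := by
              rw [← Real.mul_rpow (by positivity) hR.le]
              refine Real.rpow_le_rpow (by positivity) ?_ (by norm_num)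
              rw [one_div_mul_eq_div]
              exact Nat.floor_le (by positivity)
            have h2 : 1 ≤ R ^ (1 / 3 : ℝ) := Real.one_le_rpow hR1 (by norm_num)
            have h3 := mul_le_mul_of_nonneg_left h1
              (show 0 ≤ 6 * c ^ (-(1 / 3 : ℝ)) by positivity)
            nlinarith
        _ = _ := by
            rw [mul_pow, ← Real.rpow_natCast (R ^ (1 / 3 : ℝ)), ← Real.rpow_mul hR.le]
            norm_num

end Lattice

end NLSS

end

noncomputable section

namespace NLSS

/-! ### The Sobolev embedding and form boundedness. -/

section Sobolev

variable {θ : Fin 3 → ℝ}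

lemma lintegral_enorm_sq (v : L2T) :
    ∫⁻ x, ‖v x‖ₑ ^ (2 : ℝ) ∂torusMeasure = ENNReal.ofReal (‖v‖ ^ 2) := by
  have h := Lp.enorm_def v
  rw [eLpNorm_eq_lintegral_rpow_enorm_toReal (by simp) (by simp), ENNReal.toReal_ofNat] at h
  have h1 : ‖v‖ₑ ^ (2 : ℝ) = ∫⁻ x, ‖v x‖ₑ ^ (2 : ℝ) ∂torusMeasure := by
    rw [h, ← ENNReal.rpow_mul]; norm_num
  rw [← h1, ← ofReal_norm, ENNReal.ofReal_rpow_of_nonneg (norm_nonneg _) (by norm_num)]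
  norm_num

lemma ae_norm_fourierBasis (n : Fin 3 → ℤ) : ∀ᵐ x ∂torusMeasure, ‖fourierBasis n x‖ = 1 := by
  have h1 : fourierBasis n = UnitAddTorus.mFourierLp 2 n :=
    congrFun UnitAddTorus.coe_mFourierBasis n
  have h2 : ⇑(fourierBasis n) =ᵐ[torusMeasure] UnitAddTorus.mFourier n := by
    rw [h1]; exact UnitAddTorus.coeFn_mFourierLp 2 n
  filter_upwards [h2] with x hx
  rw [hx]
  simp only [UnitAddTorus.mFourier, ContinuousMap.coe_mk, norm_prod]
  exact Finset.prod_eq_one fun b _ => Circle.norm_coe _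

lemma ae_norm_sum_fourier_le (S : Finset (Fin 3 → ℤ)) (c : (Fin 3 → ℤ) → ℂ) :
    ∀ᵐ x ∂torusMeasure, ‖(∑ n ∈ S, c n • fourierBasis n : L2T) x‖ ≤ ∑ n ∈ S, ‖c n‖ := by
  classical
  induction S using Finset.induction_on with
  | empty =>
    filter_upwards [Lp.coeFn_zero ℂ 2 torusMeasure] with x hx
    simp
  | insert n S hn ih =>
    rw [Finset.sum_insert hn, Finset.sum_insert hn]
    filter_upwards [ih, ae_norm_fourierBasis n, Lp.coeFn_smul (c n) (fourierBasis n),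
      Lp.coeFn_add (c n • fourierBasis n) (∑ n ∈ S, c n • fourierBasis n)] with x h1 h2 h3 h4
    rw [h4, Pi.add_apply, h3, Pi.smul_apply]
    refine (norm_add_le _ _).trans (add_le_add ?_ h1)
    rw [norm_smul, h2, mul_one]

/-- A Chebyshev bound for the distribution function in terms of the high frequencies. -/
lemma exists_measure_lt_norm_le (hθ : ∀ j, 0 < θ j) :
    ∃ C : ℝ, 0 < C ∧ ∀ (u : L2T) (h : ℝ), MemH1 θ u → h1NormSq θ u ≤ h → 0 < h → ∀ t : ℝ, 0 < t →
      torusMeasure {x | t < ‖u x‖} ≤ ∑' n : Fin 3 → ℤ,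
        if t < √(C * h * √(1 + laplaceSymbol θ n)) then
          ENNReal.ofReal (4 / t ^ 2 * ‖inner ℂ (fourierBasis n) u‖ ^ 2) else 0 := by
  classical
  obtain ⟨C, hC, hCS⟩ := exists_sum_rootSymbol_sq_le hθ
  refine ⟨4 * C, by positivity, fun u h hu huh hh t ht => ?_⟩
  -- The cut-off `R = t²/(4Ch)` depends on the level `t`: by Cauchy–Schwarz the low frequencies
  -- contribute at most `√(C R h) = t/2` pointwise. Where `‖u‖ > t`, the high-frequency part
  -- therefore exceeds `t/2`, and Chebyshev's inequality applies to it.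
  obtain ⟨S, hS, hSC⟩ := hCS (t ^ 2 / (4 * C * h)) (by positivity)
  set c : (Fin 3 → ℤ) → ℂ := fun n => inner ℂ (fourierBasis n) u with hc
  set low : L2T := ∑ n ∈ S, c n • fourierBasis n with hlow
  have hw := fun n => laplaceSymbol_nonneg hθ n
  have hsumH : ∑ n ∈ S, (1 + laplaceSymbol θ n) * ‖c n‖ ^ 2 ≤ h := by
    refine le_trans ?_ huh
    have := hu.sum_le_tsum S fun n _ => mul_nonneg (by linarith [hw n]) (by positivity)
    simpa only [h1NormSq, mFourierCoeff_eq_inner] using! this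
  have hlow_le : ∑ n ∈ S, ‖c n‖ ≤ t / 2 := by
    have h1 := Finset.sum_mul_sq_le_sq_mul_sq S (rootSymbol θ)
      fun n => √(1 + laplaceSymbol θ n) * ‖c n‖
    have h2 : ∀ n, rootSymbol θ n * (√(1 + laplaceSymbol θ n) * ‖c n‖) = ‖c n‖ := fun n => by
      have : √(1 + laplaceSymbol θ n) ≠ 0 := (Real.sqrt_pos.2 (by linarith [hw n])).ne'
      unfold rootSymbol
      field_simp
    have h3 : ∀ n, (√(1 + laplaceSymbol θ n) * ‖c n‖) ^ 2 =
        (1 + laplaceSymbol θ n) * ‖c n‖ ^ 2 := fun n => by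
      rw [mul_pow, Real.sq_sqrt (by linarith [hw n])]
    simp only [h2, h3] at h1
    have h4 : (∑ n ∈ S, ‖c n‖) ^ 2 ≤ (C * (t ^ 2 / (4 * C * h))) * h :=
      h1.trans (mul_le_mul hSC hsumH
        (Finset.sum_nonneg fun n _ => mul_nonneg (by linarith [hw n]) (by positivity))
        (by positivity))
    have h5 : (C * (t ^ 2 / (4 * C * h))) * h = (t / 2) ^ 2 := by field_simp; norm_num
    exact le_of_sq_le_sq (h4.trans_eq h5) (by positivity)
  have hcoef : ∀ n, inner ℂ (fourierBasis n) (u - low) = if n ∈ S then 0 else c n := fun n => by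
    rw [inner_sub_right, hlow, inner_sum]
    simp only [inner_smul_right, orthonormal_iff_ite.1 fourierBasis.orthonormal]
    simp only [mul_ite, mul_one, mul_zero, Finset.sum_ite_eq, hc]
    split_ifs <;> simp
  have hsub : torusMeasure {x | t < ‖u x‖} ≤
      torusMeasure {x | ENNReal.ofReal ((t / 2) ^ 2) ≤ ‖(u - low : L2T) x‖ₑ ^ (2 : ℝ)} := by
    refine measure_mono_ae ?_
    filter_upwards [ae_norm_sum_fourier_le S c, Lp.coeFn_sub u low] with x h1 h2 hx
    change ENNReal.ofReal ((t / 2) ^ 2) ≤ ‖(u - low : L2T) x‖ₑ ^ (2 : ℝ)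
    rw [h2, Pi.sub_apply, ← ofReal_norm,
      ENNReal.ofReal_rpow_of_nonneg (norm_nonneg _) (by norm_num)]
    apply ENNReal.ofReal_le_ofReal
    have hx' : t < ‖u x‖ := hx
    have h3 := norm_sub_norm_le (u x) (low x)
    have : t / 2 ≤ ‖u x - low x‖ := by linarith
    rw [Real.rpow_two]
    gcongr
  refine hsub.trans ((meas_ge_le_lintegral_div ?_ ?_ ENNReal.ofReal_ne_top).trans ?_)
  · exact (Lp.aestronglyMeasurable _).enorm.pow_const _
  · simpa using ht.ne'
  rw [lintegral_enorm_sq, ← (fourierBasis.hasSum_norm_inner_sq (u - low)).tsum_eq,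
    ENNReal.ofReal_tsum_of_nonneg (fun _ => by positivity)
      (fourierBasis.hasSum_norm_inner_sq (u - low)).summable,
    div_eq_mul_inv, ← ENNReal.tsum_mul_right]
  refine ENNReal.tsum_le_tsum fun n => ?_
  rw [hcoef]
  by_cases hn : n ∈ S
  · simp [hn]
  · have h1 : t < √(4 * C * h * √(1 + laplaceSymbol θ n)) := by
      rw [hS, not_le] at hn
      rw [Real.lt_sqrt ht.le]
      have h2 := Real.lt_sqrt_of_sq_lt hn
      rwa [div_lt_iff₀' (by positivity)] at h2
    rw [if_neg hn, if_pos h1, ← div_eq_mul_inv, ← ENNReal.ofReal_div_of_pos (by positivity)]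
    apply ENNReal.ofReal_le_ofReal
    apply le_of_eq
    simp only [hc]
    field_simp
    norm_num

/-- The Sobolev embedding `H¹(𝕋³) ⊂ L⁶(𝕋³)`. -/
theorem exists_lintegral_pow_six_le (hθ : ∀ j, 0 < θ j) :
    ∃ C : ℝ, 0 < C ∧ ∀ (u : L2T) (h : ℝ), MemH1 θ u → h1NormSq θ u ≤ h → 0 < h →
      ∫⁻ x, ‖u x‖ₑ ^ (6 : ℝ) ∂torusMeasure ≤ ENNReal.ofReal (C * h ^ 3) := by
  obtain ⟨C, hC, hCu⟩ := exists_measure_lt_norm_le hθ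
  refine ⟨24 * C ^ 2, by positivity, fun u h hu huh hh => ?_⟩
  have hw := fun n => laplaceSymbol_nonneg hθ n
  set c : (Fin 3 → ℤ) → ℂ := fun n => inner ℂ (fourierBasis n) u with hc
  set L : (Fin 3 → ℤ) → ℝ := fun n => √(C * h * √(1 + laplaceSymbol θ n)) with hL
  have hL4 : ∀ n, L n ^ 4 = (C * h) ^ 2 * (1 + laplaceSymbol θ n) := fun n => by
    have h1 : L n ^ 4 = (L n ^ 2) ^ 2 := by ring
    rw [h1, hL, Real.sq_sqrt (by positivity), mul_pow, Real.sq_sqrt (by linarith [hw n])]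
  -- Layer cake, with the sum over modes taken outside the integral over levels. Mode `n` is a high
  -- frequency only for `t < L n`, so it contributes at most `4 (L n)⁴ ‖c n‖²`, and `(L n)⁴` is `(C
  -- h)²` times its `H¹` weight. Summing produces the third power of `h`.
  have hlayer := lintegral_rpow_eq_lintegral_meas_lt_mul torusMeasure
    (f := fun x => ‖u x‖) (Eventually.of_forall fun x => norm_nonneg _)
    (Lp.aestronglyMeasurable u).norm.aemeasurable (p := 6) (by norm_num)
  have h0 : ∫⁻ x, ‖u x‖ₑ ^ (6 : ℝ) ∂torusMeasure =
      ∫⁻ x, ENNReal.ofReal (‖u x‖ ^ (6 : ℝ)) ∂torusMeasure := by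
    refine lintegral_congr fun x => ?_
    rw [← ofReal_norm, ENNReal.ofReal_rpow_of_nonneg (norm_nonneg _) (by norm_num)]
  rw [h0, hlayer]
  have h1 : ∫⁻ t in Ioi (0 : ℝ), torusMeasure {a | t < ‖u a‖} * ENNReal.ofReal (t ^ ((6 : ℝ) - 1))
      ≤ ∫⁻ t in Ioi (0 : ℝ), ∑' n, (Ioo 0 (L n)).indicator
        (fun _ => ENNReal.ofReal (4 * L n ^ 3 * ‖c n‖ ^ 2)) t := by
    refine setLIntegral_mono' measurableSet_Ioi fun t ht => ?_
    have ht' : 0 < t := ht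
    refine (mul_le_mul_left (hCu u h hu huh hh t ht) _).trans ?_
    rw [← ENNReal.tsum_mul_right]
    refine ENNReal.tsum_le_tsum fun n => ?_
    split_ifs with hn
    · rw [Set.indicator_of_mem (show t ∈ Ioo 0 (L n) from ⟨ht, hn⟩),
        ← ENNReal.ofReal_mul (by positivity)]
      apply ENNReal.ofReal_le_ofReal
      have e1 : t ^ ((6 : ℝ) - 1) = t ^ 5 := by rw [← Real.rpow_natCast]; norm_num
      have e2 : 4 / t ^ 2 * ‖inner ℂ (fourierBasis n) u‖ ^ 2 * t ^ 5 = 4 * t ^ 3 * ‖c n‖ ^ 2 := by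
        simp only [hc]
        field_simp
      rw [e1, e2]
      have : t ^ 3 ≤ L n ^ 3 := pow_le_pow_left₀ ht'.le hn.le 3
      gcongr
    · simp
  have h2 : ∫⁻ t in Ioi (0 : ℝ), ∑' n, (Ioo 0 (L n)).indicator
        (fun _ => ENNReal.ofReal (4 * L n ^ 3 * ‖c n‖ ^ 2)) t ≤
      ENNReal.ofReal (4 * C ^ 2 * h ^ 3) := by
    rw [lintegral_tsum fun n => (measurable_const.indicator measurableSet_Ioo).aemeasurable]
    have h3 : ∀ n, ∫⁻ t in Ioi (0 : ℝ), (Ioo 0 (L n)).indicator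
        (fun _ => ENNReal.ofReal (4 * L n ^ 3 * ‖c n‖ ^ 2)) t ≤
        ENNReal.ofReal (4 * (C * h) ^ 2 * ((1 + laplaceSymbol θ n) * ‖c n‖ ^ 2)) := fun n => by
      refine (setLIntegral_le_lintegral _ _).trans ?_
      rw [lintegral_indicator measurableSet_Ioo, lintegral_const, Measure.restrict_apply_univ,
        Real.volume_Ioo, ← ENNReal.ofReal_mul (by positivity)]
      apply ENNReal.ofReal_le_ofReal
      apply le_of_eq
      linear_combination (4 * ‖c n‖ ^ 2) * hL4 n
    refine (ENNReal.tsum_le_tsum h3).trans ?_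
    have hu' : Summable fun n => (1 + laplaceSymbol θ n) * ‖c n‖ ^ 2 := by
      simpa only [MemH1, mFourierCoeff_eq_inner] using! hu
    rw [← ENNReal.ofReal_tsum_of_nonneg
      (fun n => mul_nonneg (by positivity) (mul_nonneg (by linarith [hw n]) (by positivity)))
      (hu'.mul_left _), tsum_mul_left]
    apply ENNReal.ofReal_le_ofReal
    have h4 : ∑' n, (1 + laplaceSymbol θ n) * ‖c n‖ ^ 2 ≤ h := by
      simpa only [h1NormSq, mFourierCoeff_eq_inner] using! huh
    calc _ ≤ 4 * (C * h) ^ 2 * h := by gcongr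
      _ = _ := by ring
  refine (mul_le_mul_right (h1.trans h2) _).trans ?_
  rw [← ENNReal.ofReal_mul (by norm_num)]
  apply ENNReal.ofReal_le_ofReal
  apply le_of_eq
  ring

/-- Form boundedness of an `L^{3/2}` potential. -/
theorem exists_integral_mul_norm_sq_le (hθ : ∀ j, 0 < θ j) :
    ∃ C : ℝ, 0 < C ∧ ∀ W : Torus3 → ℝ, MemLp W (3 / 2) torusMeasure → ∀ u : L2T, MemH1 θ u →
      Integrable (fun x => W x * ‖u x‖ ^ 2) torusMeasure ∧
      ∫ x, |W x| * ‖u x‖ ^ 2 ∂torusMeasure ≤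
        C * (eLpNorm W (3 / 2) torusMeasure).toReal * h1NormSq θ u := by
  obtain ⟨C, hC, hCu⟩ := exists_lintegral_pow_six_le hθ
  refine ⟨C ^ (1 / 3 : ℝ), by positivity, fun W hW u hu => ?_⟩
  have hmeas : AEStronglyMeasurable (fun x => W x * ‖u x‖ ^ 2) torusMeasure :=
    hW.1.mul ((Lp.aestronglyMeasurable u).norm.pow 2)
  have hexp : (3 / 2 : ℝ≥0∞).toReal = 3 / 2 := by simp
  have key : ∀ h, h1NormSq θ u ≤ h → 0 < h → ∫⁻ x, ‖W x * ‖u x‖ ^ 2‖ₑ ∂torusMeasure ≤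
      ENNReal.ofReal (C ^ (1 / 3 : ℝ) * (eLpNorm W (3 / 2) torusMeasure).toReal * h) :=
    fun h hh hpos => by
      have h1 := ENNReal.lintegral_mul_le_Lp_mul_Lq torusMeasure (p := 3 / 2) (q := 3)
        (by constructor <;> norm_num) (f := fun x => ‖W x‖ₑ) (g := fun x => ‖u x‖ₑ ^ (2 : ℝ))
        hW.1.enorm ((Lp.aestronglyMeasurable u).enorm.pow_const _)
      have h2 : ∀ x, ‖W x * ‖u x‖ ^ 2‖ₑ = ((fun x => ‖W x‖ₑ) * fun x => ‖u x‖ₑ ^ (2 : ℝ)) x :=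
        fun x => by
          simp [enorm_mul, enorm_pow]
      have h3 : eLpNorm W (3 / 2) torusMeasure =
          (∫⁻ x, ‖W x‖ₑ ^ (3 / 2 : ℝ) ∂torusMeasure) ^ (1 / (3 / 2) : ℝ) := by
        rw [eLpNorm_eq_lintegral_rpow_enorm_toReal (by simp) (by finiteness), hexp]
      simp only [h2]
      refine h1.trans ?_
      rw [← h3]
      simp only [← ENNReal.rpow_mul]
      norm_num only
      have h4 : (∫⁻ x, ‖u x‖ₑ ^ (6 : ℝ) ∂torusMeasure) ^ (1 / 3 : ℝ) ≤
          ENNReal.ofReal (C ^ (1 / 3 : ℝ) * h) := by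
        refine (ENNReal.rpow_le_rpow (hCu u h hu hh hpos) (by norm_num)).trans ?_
        rw [ENNReal.ofReal_rpow_of_nonneg (by positivity) (by norm_num),
          Real.mul_rpow hC.le (by positivity), ← Real.rpow_natCast h, ← Real.rpow_mul hpos.le]
        norm_num
      calc _ ≤ ENNReal.ofReal (eLpNorm W (3 / 2) torusMeasure).toReal *
            ENNReal.ofReal (C ^ (1 / 3 : ℝ) * h) := by
            rw [ENNReal.ofReal_toReal hW.2.ne]
            exact mul_le_mul_right h4 _
        _ = _ := by
            rw [← ENNReal.ofReal_mul ENNReal.toReal_nonneg]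
            congr 1
            ring
  have hN0 : 0 ≤ h1NormSq θ u := tsum_nonneg fun n =>
    mul_nonneg (by linarith [laplaceSymbol_nonneg hθ n]) (by positivity)
  have hint : Integrable (fun x => W x * ‖u x‖ ^ 2) torusMeasure :=
    ⟨hmeas, lt_of_le_of_lt (key (h1NormSq θ u + 1) (by linarith) (by linarith))
      ENNReal.ofReal_lt_top⟩
  refine ⟨hint, ?_⟩
  have hnorm : ∫ x, |W x| * ‖u x‖ ^ 2 ∂torusMeasure =
      (∫⁻ x, ‖W x * ‖u x‖ ^ 2‖ₑ ∂torusMeasure).toReal := by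
    rw [← integral_norm_eq_lintegral_enorm hmeas]
    simp
  rw [hnorm]
  -- The embedding is stated for a positive level `h`; the limit `ε → 0` also covers a vanishing
  -- `H¹` norm.
  have h5 : ∀ ε : ℝ, 0 < ε → (∫⁻ x, ‖W x * ‖u x‖ ^ 2‖ₑ ∂torusMeasure).toReal ≤
      C ^ (1 / 3 : ℝ) * (eLpNorm W (3 / 2) torusMeasure).toReal * (h1NormSq θ u + ε) :=
    fun ε hε => ENNReal.toReal_le_of_le_ofReal (by positivity)
      (key _ (by linarith) (by linarith))
  have h6 : Tendsto (fun ε : ℝ => C ^ (1 / 3 : ℝ) * (eLpNorm W (3 / 2) torusMeasure).toReal *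
      (h1NormSq θ u + ε)) (𝓝[>] 0) (𝓝 (C ^ (1 / 3 : ℝ) *
        (eLpNorm W (3 / 2) torusMeasure).toReal * (h1NormSq θ u + 0))) :=
    ((continuous_const.mul (continuous_const.add continuous_id)).tendsto 0).mono_left
      nhdsWithin_le_nhds
  rw [add_zero] at h6
  exact ge_of_tendsto h6 (eventually_nhdsWithin_of_forall h5)

end Sobolev

end NLSS

end

noncomputable section

namespace NLSS

/-! ### Eigenvectors of compact self-adjoint operators, numbered by `ℕ`. -/

section CompactOperator

variable {H : Type*} [NormedAddCommGroup H] [InnerProductSpace ℂ H]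

/-- By Bessel's inequality each basis vector is non-orthogonal to countably many `v i` only, and
every `v i` is non-orthogonal to some basis vector. -/
lemma countable_of_hilbertBasis {ι κ : Type*} [Countable κ] (e : HilbertBasis κ ℂ H) {v : ι → H}
    (hv : Orthonormal ℂ v) : Countable ι := by
  have h1 : (⋃ n : κ, Function.support fun i => ‖inner ℂ (v i) (e n)‖ ^ 2).Countable :=
    countable_iUnion fun n => (hv.inner_products_summable (e n)).countable_support
  have h2 : (⋃ n : κ, Function.support fun i => ‖inner ℂ (v i) (e n)‖ ^ 2) = univ := by
    refine eq_univ_of_forall fun i => ?_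
    by_contra hi
    simp only [mem_iUnion, Function.mem_support, not_exists, not_not] at hi
    have : v i = 0 := ext_hilbertBasis e fun n => by
      have h3 : ‖inner ℂ (v i) (e n)‖ = 0 := by simpa using hi n
      rw [inner_zero_right, ← norm_eq_zero, norm_inner_symm, h3]
    exact hv.ne_zero i this
  rw [h2] at h1
  exact countable_univ_iff.1 h1

lemma infinite_of_hilbertBasis {ι κ : Type*} [Infinite κ] (e : HilbertBasis κ ℂ H)
    (b : HilbertBasis ι ℂ H) : Infinite ι := by
  by_contra hfin
  rw [not_infinite_iff_finite] at hfin
  have := Fintype.ofFinite ι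
  have : FiniteDimensional ℂ H := b.toOrthonormalBasis.toBasis.finiteDimensional_of_finite
  have := e.orthonormal.linearIndependent.finite
  exact not_finite κ

/-- Spectral theorem for an injective compact self-adjoint operator. -/
theorem exists_orthonormal_eigenvectors [CompleteSpace H] {κ : Type*} [Countable κ] [Infinite κ]
    (e : HilbertBasis κ ℂ H) (R : H →L[ℂ] H) (hc : IsCompactOperator R)
    (hs : (R : H →ₗ[ℂ] H).IsSymmetric) (hinj : Function.Injective R) :
    ∃ u : ℕ → H, Orthonormal ℂ u ∧ (Submodule.span ℂ (range u)).topologicalClosure = ⊤ ∧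
      ∀ k, ∃ c : ℂ, R (u k) = c • u k := by
  have hfd : ∀ c : ℂ, FiniteDimensional ℂ (Module.End.eigenspace (R : H →ₗ[ℂ] H) c) := fun c => by
    by_cases h0 : c = 0
    · have : Module.End.eigenspace (R : H →ₗ[ℂ] H) c = ⊥ := by
        rw [h0, Module.End.eigenspace_zero]
        exact LinearMap.ker_eq_bot.2 hinj
      rw [this]
      infer_instance
    · exact ContinuousLinearMap.finite_dimensional_eigenspace hc c h0
  -- Orthonormal bases of all eigenspaces are put together. Injectivity has made the eigenspace at
  -- `0` trivial, so every eigenspace is finite-dimensional.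
  set v : (Σ c : ℂ, Fin (Module.finrank ℂ (Module.End.eigenspace (R : H →ₗ[ℂ] H) c))) → H :=
    fun a => (stdOrthonormalBasis ℂ (Module.End.eigenspace (R : H →ₗ[ℂ] H) a.1) a.2 : H) with hv
  have hvo : Orthonormal ℂ v :=
    hs.orthogonalFamily_eigenspaces.orthonormal_sigma_orthonormal
      (v_family := fun c => stdOrthonormalBasis ℂ (Module.End.eigenspace (R : H →ₗ[ℂ] H) c))
      fun c => (stdOrthonormalBasis ℂ _).orthonormal
  have hbot : (Submodule.span ℂ (range v))ᗮ = ⊥ := by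
    rw [eq_bot_iff, ← ContinuousLinearMap.orthogonalComplement_iSup_eigenspaces_eq_bot hc hs]
    refine Submodule.orthogonal_le (iSup_le fun c x hx => ?_)
    have h1 := (stdOrthonormalBasis ℂ (Module.End.eigenspace (R : H →ₗ[ℂ] H) c)).sum_repr ⟨x, hx⟩
    have h2 := congrArg Subtype.val h1
    rw [Submodule.coe_sum] at h2
    change _ = x at h2
    rw [← h2]
    refine Submodule.sum_mem _ fun i _ => ?_
    exact Submodule.smul_mem _ _ (Submodule.subset_span ⟨⟨c, i⟩, rfl⟩)
  have hcount := countable_of_hilbertBasis e hvo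
  have hinf := infinite_of_hilbertBasis e (HilbertBasis.mkOfOrthogonalEqBot hvo hbot)
  obtain ⟨E⟩ : Nonempty (ℕ ≃ Σ c : ℂ,
      Fin (Module.finrank ℂ (Module.End.eigenspace (R : H →ₗ[ℂ] H) c))) :=
    nonempty_equiv_of_countable
  refine ⟨v ∘ E, hvo.comp E E.injective, ?_, fun k => ⟨(E k).1, ?_⟩⟩
  · rw [range_comp, E.range_eq_univ, image_univ, Submodule.topologicalClosure_eq_top_iff, hbot]
  · exact Module.End.mem_eigenspace_iff.1
      (stdOrthonormalBasis ℂ (Module.End.eigenspace (R : H →ₗ[ℂ] H) (E k).1) (E k).2).2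

end CompactOperator

/-! ### Multiplication operators on `L²`. -/

section Multiplication

lemma norm_sq_eq_integral (v : L2T) : ‖v‖ ^ 2 = ∫ x, ‖v x‖ ^ 2 ∂torusMeasure := by
  have h := L2.inner_def (𝕜 := ℂ) v v
  simp only [inner_self_eq_norm_sq_to_K] at h
  have h2 := integral_ofReal (𝕜 := ℂ) (μ := torusMeasure) (f := fun x => ‖v x‖ ^ 2)
  simp only [Complex.coe_algebraMap] at h
  have h3 : ((‖v‖ ^ 2 : ℝ) : ℂ) = ((∫ x, ‖v x‖ ^ 2 ∂torusMeasure : ℝ) : ℂ) := by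
    rw [Complex.ofReal_pow, h]
    refine Eq.trans ?_ h2
    simp
  exact_mod_cast h3

lemma integrable_norm_sq (v : L2T) : Integrable (fun x => ‖v x‖ ^ 2) torusMeasure :=
  (memLp_two_iff_integrable_sq_norm (Lp.aestronglyMeasurable v)).1 (Lp.memLp v)

/-- Multiplication by `g` after `T`, when relatively bounded, as an operator. -/
lemma exists_mul_operator {g : Torus3 → ℝ} (hg : AEStronglyMeasurable g torusMeasure)
    (T : L2T →L[ℂ] L2T) {C : ℝ} (hC : 0 ≤ C)
    (h : ∀ x, Integrable (fun t => g t ^ 2 * ‖T x t‖ ^ 2) torusMeasure ∧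
      ∫ t, g t ^ 2 * ‖T x t‖ ^ 2 ∂torusMeasure ≤ C ^ 2 * ‖x‖ ^ 2) :
    ∃ B : L2T →L[ℂ] L2T, ‖B‖ ≤ C ∧ ∀ x, ∀ᵐ t ∂torusMeasure, B x t = (g t : ℂ) * T x t := by
  have hmeas : ∀ x, AEStronglyMeasurable (fun t => (g t : ℂ) * T x t) torusMeasure := fun x =>
    (Complex.continuous_ofReal.comp_aestronglyMeasurable hg).mul (Lp.aestronglyMeasurable _)
  have hsq : ∀ x t, ‖(g t : ℂ) * T x t‖ ^ 2 = g t ^ 2 * ‖T x t‖ ^ 2 := fun x t => by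
    rw [norm_mul, mul_pow, Complex.norm_real, Real.norm_eq_abs, sq_abs]
  have hmem : ∀ x, MemLp (fun t => (g t : ℂ) * T x t) 2 torusMeasure := fun x => by
    rw [memLp_two_iff_integrable_sq_norm (hmeas x)]
    simpa only [hsq] using (h x).1
  have hae := fun x => (hmem x).coeFn_toLp
  set L : L2T →ₗ[ℂ] L2T := ⟨⟨fun x => (hmem x).toLp _, fun x y => by
      refine Lp.ext ?_
      filter_upwards [hae x, hae y, hae (x + y),
        Lp.coeFn_add ((hmem x).toLp _) ((hmem y).toLp _), Lp.coeFn_add (T x) (T y)]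
        with t h1 h2 h3 h4 h5
      rw [h4, Pi.add_apply, h1, h2, h3, map_add, h5, Pi.add_apply, mul_add]⟩, fun c x => by
      refine Lp.ext ?_
      filter_upwards [hae x, hae (c • x), Lp.coeFn_smul c ((hmem x).toLp _),
        Lp.coeFn_smul c (T x)] with t h1 h2 h3 h4
      rw [h2, map_smul, h4, RingHom.id_apply, h3, Pi.smul_apply, Pi.smul_apply, h1, smul_eq_mul,
        smul_eq_mul, mul_left_comm]⟩ with hL
  have hb : ∀ x, ‖L x‖ ≤ C * ‖x‖ := fun x => by
    refine le_of_sq_le_sq ?_ (by positivity)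
    rw [mul_pow, norm_sq_eq_integral]
    refine le_of_eq_of_le (integral_congr_ae ?_) (h x).2
    filter_upwards [hae x] with t ht
    rw [← hsq, ← ht]
    rfl
  exact ⟨L.mkContinuous C hb, L.mkContinuous_norm_le hC hb, hae⟩

end Multiplication

/-! ### The form of `-Δ + V` pulled back to `L²`. -/

section Form

variable {θ : Fin 3 → ℝ}

/-- Nonnegative potentials in `L^{3/2}`. -/
structure IsPotential (V : Torus3 → ℝ) : Prop where
  memLp : MemLp V (3 / 2) torusMeasure
  nonneg : 0 ≤ᵐ[torusMeasure] V

lemma memFormDomain_iff (hθ : ∀ j, 0 < θ j) {V : Torus3 → ℝ}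
    (hV : MemLp V (3 / 2) torusMeasure) {u : L2T} : MemFormDomain θ V u ↔ MemH1 θ u := by
  obtain ⟨C, -, hCu⟩ := exists_integral_mul_norm_sq_le hθ
  exact ⟨fun h => h.1, fun h => ⟨h, (hCu V hV u h).1⟩⟩

/-- The quadratic form of `-Δ + V` on `H¹`. -/
def energy (θ : Fin 3 → ℝ) (V : Torus3 → ℝ) (u : L2T) : ℝ :=
  h1NormSq θ u - ‖u‖ ^ 2 + ∫ x, V x * ‖u x‖ ^ 2 ∂torusMeasure

/-- Form boundedness says exactly that `√V`, applied after the Bessel potential, is bounded on `L²`.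
The potential part of the form then becomes an inner product. -/
lemma exists_sqrt_operator (hθ : ∀ j, 0 < θ j) {V : Torus3 → ℝ} (hV : IsPotential V) :
    ∃ B : L2T →L[ℂ] L2T, ∀ x, ∀ᵐ t ∂torusMeasure,
      B x t = (√(V t) : ℂ) * besselPotential θ hθ x t := by
  obtain ⟨C, hC, hCu⟩ := exists_integral_mul_norm_sq_le hθ
  set M := C * (eLpNorm V (3 / 2) torusMeasure).toReal with hM
  have hM0 : 0 ≤ M := by positivity
  have hmeas : AEStronglyMeasurable (fun t => √(V t)) torusMeasure :=
    Real.continuous_sqrt.comp_aestronglyMeasurable hV.memLp.1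
  obtain ⟨B, -, hB⟩ := exists_mul_operator hmeas (besselPotential θ hθ) (Real.sqrt_nonneg M)
    fun x => by
      obtain ⟨h1, h2⟩ := memH1_besselPotential hθ x
      obtain ⟨h3, h4⟩ := hCu V hV.memLp _ h1
      have h5 : (fun t => √(V t) ^ 2 * ‖besselPotential θ hθ x t‖ ^ 2) =ᵐ[torusMeasure]
          fun t => V t * ‖besselPotential θ hθ x t‖ ^ 2 := by
        filter_upwards [hV.nonneg] with t ht
        rw [Real.sq_sqrt ht]
      refine ⟨h3.congr h5.symm, ?_⟩
      rw [integral_congr_ae h5, Real.sq_sqrt hM0]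
      rw [h2] at h4
      refine le_trans (integral_mono_ae h3 ?_ ?_) h4
      · simpa [abs_mul] using! h3.abs
      · exact Eventually.of_forall fun t => by
          change V t * _ ≤ |V t| * _
          gcongr
          exact le_abs_self _
  exact ⟨B, hB⟩

/-- The operator `√V (1 - Δ)^(-1/2)`. -/
def sqrtOperator (hθ : ∀ j, 0 < θ j) {V : Torus3 → ℝ} (hV : IsPotential V) : L2T →L[ℂ] L2T :=
  (exists_sqrt_operator hθ hV).choose

lemma coeFn_sqrtOperator (hθ : ∀ j, 0 < θ j) {V : Torus3 → ℝ} (hV : IsPotential V) (x : L2T) :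
    ∀ᵐ t ∂torusMeasure, sqrtOperator hθ hV x t = (√(V t) : ℂ) * besselPotential θ hθ x t :=
  (exists_sqrt_operator hθ hV).choose_spec x

lemma norm_sqrtOperator_sq (hθ : ∀ j, 0 < θ j) {V : Torus3 → ℝ} (hV : IsPotential V) (x : L2T) :
    ‖sqrtOperator hθ hV x‖ ^ 2 = ∫ t, V t * ‖besselPotential θ hθ x t‖ ^ 2 ∂torusMeasure := by
  rw [norm_sq_eq_integral]
  refine integral_congr_ae ?_
  filter_upwards [coeFn_sqrtOperator hθ hV x, hV.nonneg] with t h1 h2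
  rw [h1, norm_mul, mul_pow, Complex.norm_real, Real.norm_eq_abs, sq_abs, Real.sq_sqrt h2]

/-- In the new variable the form is that of the bounded operator `1 - J² + B*B`, with `J` the Bessel
potential and `B = √V J`. Everything about `-Δ + V` below is read off from it. -/
lemma schrodingerForm_besselPotential (hθ : ∀ j, 0 < θ j) {V : Torus3 → ℝ} (hV : IsPotential V)
    (x y : L2T) :
    schrodingerForm θ V (besselPotential θ hθ x) (besselPotential θ hθ y) =
      inner ℂ x y - inner ℂ (besselPotential θ hθ x) (besselPotential θ hθ y) +
        inner ℂ (sqrtOperator hθ hV x) (sqrtOperator hθ hV y) := by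
  unfold schrodingerForm
  rw [tsum_laplaceSymbol_mul hθ, L2.inner_def (sqrtOperator hθ hV x)]
  congr 1
  refine integral_congr_ae ?_
  filter_upwards [coeFn_sqrtOperator hθ hV x, coeFn_sqrtOperator hθ hV y, hV.nonneg]
    with t h1 h2 h3
  rw [h1, h2, RCLike.inner_apply, map_mul, Complex.conj_ofReal]
  have : ((V t : ℝ) : ℂ) = (√(V t) : ℂ) * (√(V t) : ℂ) := by
    rw [← Complex.ofReal_mul, Real.mul_self_sqrt h3]
  rw [this]
  ring

lemma energy_besselPotential (hθ : ∀ j, 0 < θ j) {V : Torus3 → ℝ} (hV : IsPotential V)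
    (x : L2T) : energy θ V (besselPotential θ hθ x) =
      ‖x‖ ^ 2 - ‖besselPotential θ hθ x‖ ^ 2 + ‖sqrtOperator hθ hV x‖ ^ 2 := by
  rw [energy, (memH1_besselPotential hθ x).2, norm_sqrtOperator_sq]

lemma mapsTo_besselPotential_iff (hθ : ∀ j, 0 < θ j) {V : Torus3 → ℝ} (hV : IsPotential V)
    (y w : L2T) : SchrodingerMapsTo θ V (besselPotential θ hθ y) w ↔
      ∀ x, inner ℂ x y - inner ℂ (besselPotential θ hθ x) (besselPotential θ hθ y) +
        inner ℂ (sqrtOperator hθ hV x) (sqrtOperator hθ hV y) =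
        inner ℂ (besselPotential θ hθ x) w := by
  constructor
  · intro h x
    rw [← schrodingerForm_besselPotential]
    exact h.2 _ ((memFormDomain_iff hθ hV.memLp).2 (memH1_besselPotential hθ x).1)
  · intro h
    refine ⟨(memFormDomain_iff hθ hV.memLp).2 (memH1_besselPotential hθ y).1, fun φ hφ => ?_⟩
    obtain ⟨x, rfl⟩ := MemH1.exists_eq hθ hφ.1
    rw [schrodingerForm_besselPotential hθ hV]
    exact h x

end Form

end NLSS

end

noncomputable section

namespace NLSS

/-! ### Energies and eigensystems of `-Δ + V`. -/

variable {θ : Fin 3 → ℝ}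

/-- The Hilbert basis given by a complete orthonormal system. -/
def IsCompleteOrthonormal.basis {u : ℕ → L2T} (hu : IsCompleteOrthonormal u) :
    HilbertBasis ℕ ℂ L2T := HilbertBasis.mk hu.1 hu.2.ge

@[simp]
lemma IsCompleteOrthonormal.basis_apply {u : ℕ → L2T} (hu : IsCompleteOrthonormal u) (k : ℕ) :
    hu.basis k = u k := by
  rw [basis, HilbertBasis.coe_mk]

lemma norm_sq_le_h1NormSq (hθ : ∀ j, 0 < θ j) {u : L2T} (hu : MemH1 θ u) :
    ‖u‖ ^ 2 ≤ h1NormSq θ u := by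
  obtain ⟨x, rfl⟩ := hu.exists_eq hθ
  rw [(memH1_besselPotential hθ x).2]
  have := norm_besselPotential_le hθ x
  gcongr

lemma integral_potential_nonneg {V : Torus3 → ℝ} (hV : 0 ≤ᵐ[torusMeasure] V) (u : L2T) :
    0 ≤ ∫ x, V x * ‖u x‖ ^ 2 ∂torusMeasure := by
  refine integral_nonneg_of_ae ?_
  filter_upwards [hV] with x hx
  exact mul_nonneg hx (by positivity)

lemma energy_nonneg (hθ : ∀ j, 0 < θ j) {V : Torus3 → ℝ} (hV : IsPotential V) {u : L2T}
    (hu : MemH1 θ u) : 0 ≤ energy θ V u := by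
  have h1 := norm_sq_le_h1NormSq hθ hu
  have h2 := integral_potential_nonneg hV.nonneg u
  unfold energy
  linarith

lemma h1NormSq_le_energy {V : Torus3 → ℝ} (hV : IsPotential V) (u : L2T) :
    h1NormSq θ u ≤ energy θ V u + ‖u‖ ^ 2 := by
  have h2 := integral_potential_nonneg hV.nonneg u
  unfold energy
  linarith

lemma energy_eq_of_mapsTo (hθ : ∀ j, 0 < θ j) {V : Torus3 → ℝ} (hV : IsPotential V) {u : L2T}
    {a : ℝ} (hu : SchrodingerMapsTo θ V u ((a : ℂ) • u)) : energy θ V u = a * ‖u‖ ^ 2 := by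
  obtain ⟨x, rfl⟩ := hu.1.1.exists_eq hθ
  have h := (mapsTo_besselPotential_iff hθ hV _ _).1 hu x
  simp only [inner_smul_right, inner_self_eq_norm_sq_to_K] at h
  rw [energy_besselPotential hθ hV]
  simp only [Complex.coe_algebraMap] at h
  exact_mod_cast h

lemma eigenvalue_nonneg (hθ : ∀ j, 0 < θ j) {V : Torus3 → ℝ} (hV : IsPotential V) {u : L2T}
    {a : ℝ} (hu : SchrodingerMapsTo θ V u ((a : ℂ) • u)) (h1 : ‖u‖ = 1) : 0 ≤ a := by
  have h := energy_eq_of_mapsTo hθ hV hu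
  rw [h1, one_pow, mul_one] at h
  rw [← h]
  exact energy_nonneg hθ hV hu.1.1

lemma hasSum_laplaceSymbol_mul {u : L2T} (hu : MemH1 θ u) :
    HasSum (fun n => laplaceSymbol θ n * ‖inner ℂ (fourierBasis n) u‖ ^ 2)
      (h1NormSq θ u - ‖u‖ ^ 2) := by
  have h1 : HasSum _ (h1NormSq θ u) := Summable.hasSum hu
  refine HasSum.congr_fun (h1.sub (fourierBasis.hasSum_norm_inner_sq u)) fun n => ?_
  rw [mFourierCoeff_eq_inner]
  ring

/-- Bessel's inequality for the form of `-Δ + V`. -/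
theorem IsEigensystem.tsum_eigenvalue_mul_le (hθ : ∀ j, 0 < θ j) {V : Torus3 → ℝ}
    (hV : IsPotential V) {u : ℕ → L2T} {a : ℕ → ℝ} (hu : IsEigensystem θ V u a) {φ : L2T}
    (hφ : MemH1 θ φ) :
    Summable (fun j => a j * ‖inner ℂ (u j) φ‖ ^ 2) ∧
      ∑' j, a j * ‖inner ℂ (u j) φ‖ ^ 2 ≤ energy θ V φ := by
  set J := besselPotential θ hθ with hJ
  set B := sqrtOperator hθ hV with hB
  have ha : ∀ j, 0 ≤ a j := fun j => eigenvalue_nonneg hθ hV (hu.2 j) (hu.1.1.1 j)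
  choose y hy using fun j => (hu.2 j).1.1.exists_eq hθ
  have hE : ∀ j x, inner ℂ x (y j) + inner ℂ (B x) (B (y j)) =
      ((a j + 1 : ℝ) : ℂ) * inner ℂ (J x) (u j) := fun j x => by
    have h := hu.2 j
    rw [← hy j, mapsTo_besselPotential_iff hθ hV] at h
    have h1 := h x
    rw [hy j, inner_smul_right] at h1
    push_cast
    linear_combination h1
  set s : ℕ → ℝ := fun j => √(a j + 1) with hs
  have hs0 : ∀ j, 0 < s j := fun j => Real.sqrt_pos.2 (by linarith [ha j])
  have hss : ∀ j, s j ^ 2 = a j + 1 := fun j => Real.sq_sqrt (by linarith [ha j])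
  -- The graph of `B` carries the form of `-Δ + V + 1`: `‖G x‖²` is the energy of `J x` plus `‖J
  -- x‖²`. Eigenvectors give orthogonal vectors in the graph, of squared length `a j + 1`. Bessel's
  -- inequality for them, minus Parseval in `L²`, removes the shift by one.
  set G : L2T → WithLp 2 (L2T × L2T) := fun x => WithLp.toLp 2 (x, B x) with hG
  have hGi : ∀ x z, inner ℂ (G x) (G z) = inner ℂ x z + inner ℂ (B x) (B z) := fun x z =>
    WithLp.prod_inner_apply _ _
  have hEG : ∀ j x, inner ℂ (G (y j)) (G x) = ((a j + 1 : ℝ) : ℂ) * inner ℂ (u j) (J x) :=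
    fun j x => by
      have h1 := congrArg conj (hE j x)
      rw [map_add, inner_conj_symm, inner_conj_symm, map_mul, Complex.conj_ofReal,
        inner_conj_symm] at h1
      rw [hGi, h1]
  set E : ℕ → WithLp 2 (L2T × L2T) := fun j => (((s j)⁻¹ : ℝ) : ℂ) • G (y j) with hEdef
  have hEo : Orthonormal ℂ E := by
    rw [orthonormal_iff_ite]
    intro i j
    simp only [hEdef, inner_smul_left, inner_smul_right, Complex.conj_ofReal]
    rw [hEG, hy j, orthonormal_iff_ite.1 hu.1.1 i j]
    split_ifs with hij
    · subst hij
      have h1 := hs0 i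
      rw [← hss i, mul_one, ← Complex.ofReal_mul, ← Complex.ofReal_mul]
      norm_cast
      field_simp
    · simp
  obtain ⟨x, rfl⟩ := hφ.exists_eq hθ
  have hEx : ∀ j, ‖inner ℂ (E j) (G x)‖ ^ 2 = (a j + 1) * ‖inner ℂ (u j) (J x)‖ ^ 2 :=
    fun j => by
      have h1 := hs0 j
      simp only [hEdef, inner_smul_left, Complex.conj_ofReal]
      rw [hEG, norm_mul, norm_mul, Complex.norm_real, Complex.norm_real, Real.norm_of_nonneg
        (by positivity), Real.norm_of_nonneg (by linarith [ha j]), ← hss j]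
      field_simp
  have hS1 := hEo.inner_products_summable (G x)
  have hS2 := hEo.tsum_inner_products_le (G x)
  simp only [hEx] at hS1 hS2
  have hP := hu.1.basis.hasSum_norm_inner_sq (J x)
  simp only [IsCompleteOrthonormal.basis_apply] at hP
  have hS3 : HasSum (fun j => a j * ‖inner ℂ (u j) (J x)‖ ^ 2)
      (∑' j, (a j + 1) * ‖inner ℂ (u j) (J x)‖ ^ 2 - ‖J x‖ ^ 2) :=
    HasSum.congr_fun (hS1.hasSum.sub hP) fun j => by ring
  have hnG : ‖G x‖ ^ 2 = ‖x‖ ^ 2 + ‖B x‖ ^ 2 := by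
    have h1 := hGi x x
    simp only [inner_self_eq_norm_sq_to_K, Complex.coe_algebraMap] at h1
    exact_mod_cast h1
  refine ⟨hS3.summable, ?_⟩
  rw [hS3.tsum_eq, energy_besselPotential hθ hV]
  rw [hnG] at hS2
  linarith

/-- `-Δ + V` has a complete orthonormal system of eigenfunctions. -/
theorem exists_eigensystem (hθ : ∀ j, 0 < θ j) {V : Torus3 → ℝ} (hV : IsPotential V) :
    ∃ (u : ℕ → L2T) (a : ℕ → ℝ), IsEigensystem θ V u a := by
  set J := besselPotential θ hθ with hJ
  set B := sqrtOperator hθ hV with hB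
  -- `A = 1 + B*B` represents the form of `-Δ + V + 1` in the variable `x`. It is bounded below by
  -- one, hence invertible, and `J A⁻¹ J` is the resolvent `(-Δ + V + 1)⁻¹`.
  set A : L2T →L[ℂ] L2T := ContinuousLinearMap.id ℂ L2T + ContinuousLinearMap.adjoint B ∘L B
    with hA
  have hAi : ∀ x z, inner ℂ x (A z) = inner ℂ x z + inner ℂ (B x) (B z) := fun x z => by
    simp [hA, inner_add_right, ContinuousLinearMap.adjoint_inner_right]
  have hAi' : ∀ x z, inner ℂ (A x) z = inner ℂ x z + inner ℂ (B x) (B z) := fun x z => by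
    simp [hA, inner_add_left, ContinuousLinearMap.adjoint_inner_left]
  have hAx : ∀ x, inner ℂ (A x) x = ((‖x‖ ^ 2 + ‖B x‖ ^ 2 : ℝ) : ℂ) := fun x => by
    rw [hAi', inner_self_eq_norm_sq_to_K, inner_self_eq_norm_sq_to_K]
    push_cast
    rfl
  obtain ⟨⟨A', G, hAG, hGA⟩, hA'⟩ : IsUnit A :=
    A.isUnit_of_forall_le_norm_inner_map (c := 1) one_pos fun x => by
      rw [hAx, Complex.norm_real, Real.norm_of_nonneg (by positivity)]
      simp
  change A' = A at hA'
  subst hA'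
  have hAG' : ∀ x, A (G x) = x := fun x => by
    have := congrArg (fun T : L2T →L[ℂ] L2T => T x) hAG
    simpa using this
  have hGinj : Function.Injective G := fun x z h => by rw [← hAG' x, h, hAG']
  set R : L2T →L[ℂ] L2T := J ∘L G ∘L J with hR
  have hJc : IsCompactOperator J := by
    refine isCompactOperator_diagonal fourierBasis J (inner_besselPotential hθ) ?_
    -- The fourth powers of the multipliers of `J` are summable, so the multipliers tend to zero.
    have h1 := (summable_weight_rpow hθ (r := 2) (by norm_num)).tendsto_cofinite_zero
    have h2 : ∀ n, rootSymbol θ n = ((1 + laplaceSymbol θ n) ^ (-2 : ℝ)) ^ (1 / 4 : ℝ) :=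
      fun n => by
        have := laplaceSymbol_nonneg hθ n
        rw [← Real.rpow_mul (by linarith), rootSymbol, Real.sqrt_eq_rpow,
          ← Real.rpow_neg (by linarith)]
        norm_num
    have h3 := h1.rpow_const (p := (1 / 4 : ℝ)) (Or.inr (by norm_num))
    rw [Real.zero_rpow (by norm_num)] at h3
    exact h3.congr fun n => (h2 n).symm
  have hRc : IsCompactOperator R := (hJc.comp_clm (G ∘L J) :)
  have hRs : (R : L2T →ₗ[ℂ] L2T).IsSymmetric := fun x z => by
    change inner ℂ (J (G (J x))) z = inner ℂ x (J (G (J z)))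
    rw [inner_besselPotential_left, ← inner_besselPotential_left hθ x]
    have h1 := hAi (G (J x)) (G (J z))
    have h2 := hAi' (G (J x)) (G (J z))
    rw [hAG'] at h1 h2
    rw [h1, h2]
  have hRi : Function.Injective R :=
    (besselPotential_injective hθ).comp (hGinj.comp (besselPotential_injective hθ))
  obtain ⟨u, huo, hut, hue⟩ := exists_orthonormal_eigenvectors fourierBasis R hRc hRs hRi
  have key : ∀ k, ∃ a : ℝ, SchrodingerMapsTo θ V (u k) ((a : ℂ) • u k) := fun k => by
    obtain ⟨c, hc⟩ := hue k
    have hne : u k ≠ 0 := huo.ne_zero k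
    have h1 : (c : ℂ) = ((‖G (J (u k))‖ ^ 2 + ‖B (G (J (u k)))‖ ^ 2 : ℝ) : ℂ) := by
      rw [← hAx, hAG', inner_besselPotential_left]
      change c = inner ℂ (u k) (R (u k))
      rw [hc, inner_smul_right, inner_self_eq_norm_sq_to_K, huo.1 k]
      simp
    set r : ℝ := ‖G (J (u k))‖ ^ 2 + ‖B (G (J (u k)))‖ ^ 2 with hr
    have hr0 : (r : ℂ) ≠ 0 := by
      rw [← h1]
      rintro rfl
      rw [zero_smul] at hc
      exact hne (hRi (hc.trans (map_zero R).symm))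
    -- The resolvent has eigenvalue `r = 1 / (a + 1)`.
    refine ⟨r⁻¹ - 1, ?_⟩
    have h2 : J (((r⁻¹ : ℝ) : ℂ) • G (J (u k))) = u k := by
      rw [map_smul]
      change ((r⁻¹ : ℝ) : ℂ) • R (u k) = u k
      rw [hc, h1, smul_smul, Complex.ofReal_inv, inv_mul_cancel₀ hr0, one_smul]
    rw [← h2, mapsTo_besselPotential_iff hθ hV, h2]
    intro x
    have h3 := hAi x (((r⁻¹ : ℝ) : ℂ) • G (J (u k)))
    rw [map_smul, hAG', inner_smul_right, ← inner_besselPotential_left] at h3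
    rw [inner_smul_right _ (u k)]
    push_cast at h3 ⊢
    linear_combination -h3
  choose a ha using key
  exact ⟨u, a, ⟨huo, hut⟩, ha⟩

end NLSS

end

noncomputable section

namespace NLSS

/-! ### The Casimir function and its primitive: decay and convexity. -/

section Casimir

/-- For `s ≥ 2|σ|` the shifted argument is at least `s/2`, which costs the factor `2^p`. For smaller
`s`, monotonicity bounds the left side by `f σ`, and `(1 + s)^(-p)` is bounded below. -/
lemma exists_shift_decay {f : ℝ → ℝ} (hf : Antitone f) (h0 : ∀ s, 0 < f s) {C p : ℝ} (hp : 0 < p)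
    (hC : 0 < C) (h : ∀ s, 0 ≤ s → f s ≤ C * (1 + s) ^ (-p)) (σ : ℝ) :
    ∃ C' : ℝ, 0 < C' ∧ ∀ s, 0 ≤ s → f (s + σ) ≤ C' * (1 + s) ^ (-p) := by
  have h1 := h0 σ
  refine ⟨C * 2 ^ p + f σ * (1 + 2 * |σ|) ^ p, by positivity, fun s hs => ?_⟩
  have hsp : 0 < (1 + s) ^ (-p) := by positivity
  rw [add_mul]
  rcases le_or_gt (2 * |σ|) s with hle | hgt
  · have h2 : s / 2 ≤ s + σ := by linarith [neg_abs_le σ]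
    have h3 : f (s + σ) ≤ C * (1 + s / 2) ^ (-p) := (hf h2).trans (h _ (by linarith))
    have h4 : (1 + s / 2) ^ (-p) ≤ 2 ^ p * (1 + s) ^ (-p) := by
      calc (1 + s / 2) ^ (-p) ≤ ((1 + s) / 2) ^ (-p) :=
            Real.rpow_le_rpow_of_nonpos (by linarith) (by linarith) (by linarith)
        _ = _ := by
            rw [Real.div_rpow (by linarith) (by norm_num), Real.rpow_neg (by norm_num : (0:ℝ) ≤ 2)]
            field_simp
    have h5 : 0 < f σ * (1 + 2 * |σ|) ^ p * (1 + s) ^ (-p) := by positivity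
    nlinarith
  · have h3 : f (s + σ) ≤ f σ := hf (by linarith)
    have h4 : 1 ≤ (1 + 2 * |σ|) ^ p * (1 + s) ^ (-p) := by
      rw [Real.rpow_neg (by linarith), ← div_eq_mul_inv, one_le_div (by positivity)]
      exact Real.rpow_le_rpow (by linarith) (by linarith) hp.le
    have h5 : 0 < C * 2 ^ p * (1 + s) ^ (-p) := by positivity
    nlinarith

variable {f : ℝ → ℝ}

lemma CasimirClass.shift (hf : CasimirClass f) (σ : ℝ) : CasimirClass fun s => f (s + σ) where
  continuous := hf.continuous.comp (continuous_add_const σ)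
  pos := fun s => hf.pos _
  strictAnti := fun s t h => hf.strictAnti (by linarith)
  tendsto_atBot := hf.tendsto_atBot.comp (tendsto_atBot_add_const_right _ _ tendsto_id)
  decay := by
    obtain ⟨ε, C, hε, hC, h⟩ := hf.decay
    have e : (-5 / 2 - ε : ℝ) = -(5 / 2 + ε) := by ring
    rw [e] at h
    obtain ⟨C', hC', h'⟩ := exists_shift_decay hf.strictAnti.antitone hf.pos (by linarith) hC h σ
    exact ⟨ε, C', hε, hC', by rw [e]; exact h'⟩

lemma CasimirClass.integrableOn (hf : CasimirClass f) (s : ℝ) : IntegrableOn f (Ioi s) := by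
  obtain ⟨ε, C, hε, hC, h⟩ := (hf.shift s).decay
  have h1 : IntegrableOn (fun t => C * (t + (1 - s)) ^ (-5 / 2 - ε)) (Ioi s) :=
    (integrableOn_add_rpow_Ioi_of_lt (by linarith) (by linarith)).const_mul C
  refine Integrable.mono' h1 hf.continuous.aestronglyMeasurable.restrict ?_
  filter_upwards [ae_restrict_mem measurableSet_Ioi] with t ht
  have ht' : s < t := ht
  rw [Real.norm_of_nonneg (hf.pos t).le]
  have h2 := h (t - s) (by linarith)
  simp only [sub_add_cancel] at h2
  convert h2 using 3
  ring

lemma CasimirClass.primitive_tangent (hf : CasimirClass f) (s m : ℝ) :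
    casimirPrimitive f m - f m * (s - m) ≤ casimirPrimitive f s := by
  have h := intervalIntegral.integral_interval_add_Ioi (hf.integrableOn s) (hf.integrableOn m)
  unfold casimirPrimitive
  rw [← h]
  have hi : ∀ a b : ℝ, IntervalIntegrable f volume a b := fun a b =>
    hf.continuous.intervalIntegrable a b
  rcases le_total s m with hsm | hms
  · have h1 : ∫ _x in s..m, f m ≤ ∫ x in s..m, f x :=
      intervalIntegral.integral_mono_on hsm intervalIntegrable_const (hi _ _)
        fun x hx => hf.strictAnti.antitone hx.2
    rw [intervalIntegral.integral_const, smul_eq_mul] at h1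
    nlinarith
  · have h1 : ∫ x in m..s, f x ≤ ∫ _x in m..s, f m :=
      intervalIntegral.integral_mono_on hms (hi _ _) intervalIntegrable_const
        fun x hx => hf.strictAnti.antitone hx.1
    rw [intervalIntegral.integral_const, smul_eq_mul] at h1
    rw [intervalIntegral.integral_symm]
    nlinarith

/-- The tangent inequality is used twice, through the midpoint `c`; strict monotonicity of `f` makes
the gain `(f m - f c)(s - c)` positive. -/
lemma CasimirClass.primitive_tangent_lt (hf : CasimirClass f) {s m : ℝ} (h : s ≠ m) :
    casimirPrimitive f m - f m * (s - m) < casimirPrimitive f s := by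
  set c := (s + m) / 2 with hc
  have h1 := hf.primitive_tangent c m
  have h2 := hf.primitive_tangent s c
  have h3 : 0 < (f m - f c) * (s - c) := by
    rcases lt_or_gt_of_ne h with hlt | hgt
    · have := hf.strictAnti (show c < m by linarith)
      exact mul_pos_of_neg_of_neg (by linarith) (by linarith)
    · have := hf.strictAnti (show m < c by linarith)
      exact mul_pos (by linarith) (by linarith)
  have h4 : s - m = (s - c) + (c - m) := by ring
  rw [h4, mul_add]
  nlinarith

lemma CasimirClass.primitive_pos (hf : CasimirClass f) (s : ℝ) : 0 < casimirPrimitive f s := by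
  refine (setIntegral_pos_iff_support_of_nonneg_ae
    (Eventually.of_forall fun t => (hf.pos t).le) (hf.integrableOn s)).2 ?_
  have : Function.support f = univ := eq_univ_of_forall fun t => (hf.pos t).ne'
  rw [this, univ_inter]
  simp

lemma CasimirClass.tangentPair (hf : CasimirClass f) (σ : ℝ) :
    TangentPair (fun s => casimirPrimitive f (s + σ)) fun s => f (s + σ) where
  nonneg := fun s _ => (hf.primitive_pos _).le
  slope_nonneg := fun s _ => (hf.pos _).le
  tangent := fun s m _ _ => by
    have := hf.primitive_tangent (s + σ) (m + σ)
    rwa [add_sub_add_right_eq_sub] at this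

lemma integral_Ioi_add_rpow {p c m : ℝ} (hp : 1 < p) (hc : 0 < c + m) :
    ∫ t in Ioi c, (t + m) ^ (-p) = (c + m) ^ (1 - p) / (p - 1) := by
  have h := (measurePreserving_add_right volume m).setIntegral_preimage_emb
    (measurableEmbedding_addRight m) (fun t : ℝ => t ^ (-p)) (Ioi (c + m))
  have h1 : (fun x => x + m) ⁻¹' Ioi (c + m) = Ioi c := by ext x; simp
  rw [h1, integral_Ioi_rpow_of_lt (by linarith) hc] at h
  rw [h]
  have : p - 1 ≠ 0 := by linarith
  have h3 : -p + 1 = -(p - 1) := by ring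
  rw [show (1 - p) = -(p - 1) by ring, h3, neg_div_neg_eq]

/-- Decay of the Casimir function and its primitive, uniformly for shifts bounded below. -/
lemma CasimirClass.exists_decay (hf : CasimirClass f) : ∃ r : ℝ, 3 / 2 < r ∧ ∀ S : ℝ,
    ∃ C : ℝ, 0 < C ∧ ∀ σ, S ≤ σ → ∀ s, 0 ≤ s →
      f (s + σ) * (1 + s) ≤ C * (1 + s) ^ (-r) ∧
      casimirPrimitive f (s + σ) ≤ C * (1 + s) ^ (-r) := by
  obtain ⟨ε, C, hε, hC, h⟩ := hf.decay
  have e : (-5 / 2 - ε : ℝ) = -(5 / 2 + ε) := by ring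
  rw [e] at h
  -- Both the weight `1 + s` and the integration cost one power of the decay `5/2 + ε`; what remains
  -- is just above the exponent `3/2` of the lattice sums. The constant for the shift `S` serves all
  -- larger shifts by monotonicity.
  refine ⟨3 / 2 + ε, by linarith, fun S => ?_⟩
  obtain ⟨D, hD, hDs⟩ := exists_shift_decay hf.strictAnti.antitone hf.pos (by linarith) hC h S
  refine ⟨D + D / (3 / 2 + ε), by positivity, fun σ hσ s hs => ⟨?_, ?_⟩⟩
  · have h1 : f (s + σ) ≤ D * (1 + s) ^ (-(5 / 2 + ε)) :=
      (hf.strictAnti.antitone (by linarith)).trans (hDs s hs)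
    have h2 : (1 + s) ^ (-(5 / 2 + ε)) * (1 + s) = (1 + s) ^ (-(3 / 2 + ε)) := by
      rw [← Real.rpow_add_one (by linarith)]
      congr 1
      ring
    have h3 : 0 < D / (3 / 2 + ε) * (1 + s) ^ (-(3 / 2 + ε)) := by positivity
    calc f (s + σ) * (1 + s) ≤ D * (1 + s) ^ (-(5 / 2 + ε)) * (1 + s) := by gcongr
      _ = D * (1 + s) ^ (-(3 / 2 + ε)) := by rw [mul_assoc, h2]
      _ ≤ _ := by rw [add_mul]; linarith
  · have h1 : casimirPrimitive f (s + σ) ≤ casimirPrimitive f (s + S) :=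
      setIntegral_mono_set (hf.integrableOn _) (Eventually.of_forall fun t => (hf.pos t).le)
        (Ioi_subset_Ioi (by linarith)).eventuallyLE
    have h2 : casimirPrimitive f (s + S) ≤
        ∫ t in Ioi (s + S), D * (t + (1 - S)) ^ (-(5 / 2 + ε)) := by
      refine setIntegral_mono_on (hf.integrableOn _)
        ((integrableOn_add_rpow_Ioi_of_lt (by linarith) (by linarith)).const_mul D)
        measurableSet_Ioi fun t ht => ?_
      have ht' : s + S < t := ht
      have h3 := hDs (t - S) (by linarith)
      rw [sub_add_cancel] at h3
      rwa [show t + (1 - S) = 1 + (t - S) by ring]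
    rw [integral_const_mul, integral_Ioi_add_rpow (by linarith) (by linarith)] at h2
    have h4 : s + S + (1 - S) = 1 + s := by ring
    have h5 : 1 - (5 / 2 + ε) = -(3 / 2 + ε) := by ring
    have h6 : 5 / 2 + ε - 1 = 3 / 2 + ε := by ring
    rw [h4, h5, h6] at h2
    have h3 : 0 < D * (1 + s) ^ (-(3 / 2 + ε)) := by positivity
    calc _ ≤ _ := h1
      _ ≤ _ := h2
      _ ≤ _ := by rw [add_mul, mul_div_assoc', div_mul_eq_mul_div]; linarith

/-- With `z = (1 + s)/(1 + m)` this is the inequality `z^(-r) ≥ 1 - r (z - 1)`, a consequence of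
`log z ≤ z - 1` and `exp x ≥ 1 + x`. It makes Peierls' inequality available for spectral power sums.
-/
lemma tangentPair_rpow {r : ℝ} (hr : 0 < r) :
    TangentPair (fun s => (1 + s) ^ (-r)) fun s => r * (1 + s) ^ (-r - 1) where
  nonneg := fun s hs => by positivity
  slope_nonneg := fun s hs => by positivity
  tangent := fun s m hs hm => by
    have hz : 0 < (1 + s) / (1 + m) := by positivity
    have h1 : 1 - r * ((1 + s) / (1 + m) - 1) ≤ ((1 + s) / (1 + m)) ^ (-r) := by
      rw [Real.rpow_def_of_pos hz]
      have h2 := Real.log_le_sub_one_of_pos hz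
      have h3 := Real.add_one_le_exp (Real.log ((1 + s) / (1 + m)) * -r)
      nlinarith
    have hp : 0 < (1 + m) ^ (-r) := by positivity
    have h4 := mul_le_mul_of_nonneg_left h1 hp.le
    rw [Real.div_rpow (by linarith) (by linarith)] at h4
    have h5 : (1 + m) ^ (-r) * ((1 + s) ^ (-r) / (1 + m) ^ (-r)) = (1 + s) ^ (-r) := by
      field_simp
    rw [h5] at h4
    refine le_trans (le_of_eq ?_) h4
    rw [Real.rpow_sub_one (by positivity)]
    field_simp
    ring

end Casimir

/-! ### Spectral sums, eigenspaces and the trace. -/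

section Spectral

variable {θ : Fin 3 → ℝ}

/-- Every eigensystem of `-Δ + V` with `V ≥ 0` obeys the spectral sum bound of `-Δ`. -/
theorem IsEigensystem.tsum_rpow_le (hθ : ∀ j, 0 < θ j) {V : Torus3 → ℝ} (hV : IsPotential V)
    {u : ℕ → L2T} {a : ℕ → ℝ} (hu : IsEigensystem θ V u a) {r : ℝ} (hr : 3 / 2 < r) :
    Summable (fun k => (1 + a k) ^ (-r)) ∧
      ∑' k, (1 + a k) ^ (-r) ≤ ∑' n : Fin 3 → ℤ, (1 + laplaceSymbol θ n) ^ (-r) := by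
  have hs := fun k => hasSum_laplaceSymbol_mul (hu.2 k).1.1
  -- The reference operator is `-Δ` in its Fourier basis and the trial family consists of the
  -- eigenfunctions of `-Δ + V`. Their energies under `-Δ` alone are at most `a k`, because `V ≥ 0`.
  refine (tangentPair_rpow (by linarith)).peierls fourierBasis (laplaceSymbol_nonneg hθ)
    (summable_weight_rpow hθ hr) hu.1.1
    (fun k => eigenvalue_nonneg hθ hV (hu.2 k) (hu.1.1.1 k)) (fun k => (hs k).summable) fun k => ?_
  rw [(hs k).tsum_eq]
  have h1 := energy_eq_of_mapsTo hθ hV (hu.2 k)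
  rw [hu.1.1.1 k, one_pow, mul_one] at h1
  have h2 := integral_potential_nonneg hV.nonneg (u k)
  rw [← h1, energy, hu.1.1.1 k]
  linarith

/-- All these indices contribute the same positive term to a convergent series. -/
lemma IsEigensystem.finite_multiplicity (hθ : ∀ j, 0 < θ j) {V : Torus3 → ℝ}
    (hV : IsPotential V) {u : ℕ → L2T} {a : ℕ → ℝ} (hu : IsEigensystem θ V u a) (m : ℝ) :
    {k | a k = m}.Finite := by
  have ha := fun k => eigenvalue_nonneg hθ hV (hu.2 k) (hu.1.1.1 k)
  have h1 := (hu.tsum_rpow_le hθ hV (r := 2) (by norm_num)).1.tendsto_cofinite_zero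
  by_cases hm : 0 ≤ m
  · have h2 := h1.eventually (gt_mem_nhds (show 0 < (1 + m) ^ (-2 : ℝ) by positivity))
    refine (Filter.eventually_cofinite.1 h2).subset fun k hk => ?_
    have hk' : a k = m := hk
    simp [hk']
  · convert finite_empty
    ext k
    simp only [mem_ofPred_eq, mem_empty_iff_false, iff_false]
    intro h
    exact hm (h ▸ ha k)

lemma integrable_potential_mul (hθ : ∀ j, 0 < θ j) {V : Torus3 → ℝ} (hV : IsPotential V)
    {φ u : L2T} (hφ : MemH1 θ φ) (hu : MemH1 θ u) :
    Integrable (fun x => (V x : ℂ) * (conj (φ x) * u x)) torusMeasure := by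
  obtain ⟨x, rfl⟩ := hφ.exists_eq hθ
  obtain ⟨y, rfl⟩ := hu.exists_eq hθ
  refine (L2.integrable_inner (𝕜 := ℂ) (sqrtOperator hθ hV x) (sqrtOperator hθ hV y)).congr ?_
  filter_upwards [coeFn_sqrtOperator hθ hV x, coeFn_sqrtOperator hθ hV y, hV.nonneg]
    with t h1 h2 h3
  rw [h1, h2, RCLike.inner_apply, map_mul, Complex.conj_ofReal]
  have : ((V t : ℝ) : ℂ) = (√(V t) : ℂ) * (√(V t) : ℂ) := by
    rw [← Complex.ofReal_mul, Real.mul_self_sqrt h3]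
  rw [this]
  ring

lemma conj_schrodingerForm (hθ : ∀ j, 0 < θ j) {V : Torus3 → ℝ} (hV : IsPotential V)
    {φ u : L2T} (hφ : MemH1 θ φ) (hu : MemH1 θ u) :
    conj (schrodingerForm θ V φ u) = schrodingerForm θ V u φ := by
  obtain ⟨x, rfl⟩ := hφ.exists_eq hθ
  obtain ⟨y, rfl⟩ := hu.exists_eq hθ
  rw [schrodingerForm_besselPotential hθ hV, schrodingerForm_besselPotential hθ hV]
  simp only [map_add, map_sub, inner_conj_symm]

/-- The difference of two potentials acts as a bounded operator intertwining the eigenvectors. -/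
theorem exists_perturbation_operator (hθ : ∀ j, 0 < θ j) {V V' : Torus3 → ℝ}
    (hV : IsPotential V) (hV' : IsPotential V') {τ : ℝ} (hτ : 0 ≤ τ)
    (h : ∀ᵐ x ∂torusMeasure, |V' x - V x| ≤ τ) :
    ∃ K : L2T →L[ℂ] L2T, ‖K‖ ≤ τ ∧
      (∀ x, ∀ᵐ t ∂torusMeasure, K x t = ((V' t - V t : ℝ) : ℂ) * x t) ∧
      ∀ (u v : L2T) (a b : ℝ), SchrodingerMapsTo θ V u ((a : ℂ) • u) →
        SchrodingerMapsTo θ V' v ((b : ℂ) • v) →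
        ((b - a : ℝ) : ℂ) * inner ℂ v u = inner ℂ v (K u) := by
  have hmeas : AEStronglyMeasurable (fun x => V' x - V x) torusMeasure :=
    hV'.memLp.1.sub hV.memLp.1
  have hbd : ∀ x : L2T, ∀ᵐ t ∂torusMeasure,
      (V' t - V t) ^ 2 * ‖x t‖ ^ 2 ≤ τ ^ 2 * ‖x t‖ ^ 2 := fun x => by
    filter_upwards [h] with t ht
    have := sq_le_sq' (by linarith [neg_abs_le (V' t - V t)]) ((le_abs_self _).trans ht)
    gcongr
  obtain ⟨K, hK, hKx⟩ := exists_mul_operator hmeas (ContinuousLinearMap.id ℂ L2T) hτ fun x => by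
    have h1 := (integrable_norm_sq x).const_mul (τ ^ 2)
    have h2 : Integrable (fun t => (V' t - V t) ^ 2 * ‖x t‖ ^ 2) torusMeasure := by
      refine Integrable.mono' h1 ((hmeas.pow 2).mul ((Lp.aestronglyMeasurable x).norm.pow 2)) ?_
      filter_upwards [hbd x] with t ht
      rwa [Real.norm_of_nonneg (by positivity)]
    refine ⟨h2, ?_⟩
    rw [norm_sq_eq_integral x, ← integral_const_mul]
    exact integral_mono_ae h2 h1 (hbd x)
  refine ⟨K, hK, hKx, fun u v a b hu hv => ?_⟩
  -- Each eigenvalue equation is tested with the other eigenvector; in the difference of the two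
  -- forms the Laplacian cancels and the bounded multiplication by `V' - V` is left.
  have e1 : schrodingerForm θ V v u = a * inner ℂ v u := by
    rw [hu.2 v ((memFormDomain_iff hθ hV.memLp).2 hv.1.1), inner_smul_right]
  have e2 : schrodingerForm θ V' v u = b * inner ℂ v u := by
    rw [← conj_schrodingerForm hθ hV' hu.1.1 hv.1.1,
      hv.2 u ((memFormDomain_iff hθ hV'.memLp).2 hu.1.1), inner_smul_right, map_mul,
      Complex.conj_ofReal, inner_conj_symm]
  have e3 : schrodingerForm θ V' v u - schrodingerForm θ V v u = inner ℂ v (K u) := by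
    unfold schrodingerForm
    rw [add_sub_add_left_eq_sub, ← integral_sub (integrable_potential_mul hθ hV' hv.1.1 hu.1.1)
      (integrable_potential_mul hθ hV hv.1.1 hu.1.1), L2.inner_def]
    refine integral_congr_ae ?_
    filter_upwards [hKx u] with t ht
    rw [ht, RCLike.inner_apply]
    push_cast
    simp
    ring
  rw [← e3, e1, e2]
  push_cast
  ring

lemma IsEigensystem.eigenspace_eq (hθ : ∀ j, 0 < θ j) {V : Torus3 → ℝ} (hV : IsPotential V)
    {u : ℕ → L2T} {a : ℕ → ℝ} (hu : IsEigensystem θ V u a) (m : ℝ) :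
    schrodingerEigenspace θ V m = Submodule.span ℂ (u '' {k | a k = m}) := by
  classical
  refine le_antisymm (Submodule.span_le.2 fun φ hφ => ?_) (Submodule.span_mono ?_)
  -- With equal potentials and `τ = 0` the operator `K` vanishes, and the intertwining relation
  -- becomes orthogonality of eigenvectors to different eigenvalues.
  · obtain ⟨K, hK, -, hKu⟩ := exists_perturbation_operator hθ hV hV le_rfl
      (Eventually.of_forall fun x => by simp)
    have hK0 : K = 0 := norm_le_zero_iff.1 hK
    have h0 : ∀ k, a k ≠ m → inner ℂ (u k) φ = 0 := fun k hk => by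
      have h1 := hKu φ (u k) m (a k) hφ (hu.2 k)
      rw [hK0, _root_.zero_apply, inner_zero_right] at h1
      exact (mul_eq_zero.1 h1).resolve_left (by exact_mod_cast sub_ne_zero.2 hk)
    set S := (hu.finite_multiplicity hθ hV m).toFinset with hS
    have h2 : φ = ∑ k ∈ S, inner ℂ (u k) φ • u k := by
      refine ext_hilbertBasis hu.1.basis fun k => ?_
      rw [IsCompleteOrthonormal.basis_apply, inner_sum]
      simp only [inner_smul_right, orthonormal_iff_ite.1 hu.1.1]
      simp only [mul_ite, mul_one, mul_zero, Finset.sum_ite_eq]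
      split_ifs with hk
      · rfl
      · exact h0 k (by simpa [hS] using hk)
    change φ ∈ Submodule.span ℂ (u '' {k | a k = m})
    rw [h2]
    refine Submodule.sum_mem _ fun k hk => Submodule.smul_mem _ _ (Submodule.subset_span ?_)
    exact ⟨k, by simpa [hS] using hk, rfl⟩
  · rintro _ ⟨k, hk, rfl⟩
    have hk' : a k = m := hk
    have := hu.2 k
    rwa [hk'] at this

/-- `V + σ` may be negative, so results on nonnegative potentials do not apply to it directly. The
constant is therefore moved to the right-hand side, and ends up in the eigenvalue. -/
lemma mapsTo_add_const_iff (hθ : ∀ j, 0 < θ j) {V : Torus3 → ℝ} (hV : IsPotential V) (σ : ℝ)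
    (u w : L2T) : SchrodingerMapsTo θ (fun x => V x + σ) u w ↔
      SchrodingerMapsTo θ V u (w - (σ : ℂ) • u) := by
  have hm : MemLp (fun x => V x + σ) (3 / 2) torusMeasure := hV.memLp.add (memLp_const σ)
  have hform : ∀ φ : L2T, MemH1 θ φ → MemH1 θ u →
      schrodingerForm θ (fun x => V x + σ) φ u = schrodingerForm θ V φ u + σ * inner ℂ φ u :=
    fun φ hφ hu => by
      have h1 : (σ : ℂ) * inner ℂ φ u = ∫ x, (σ : ℂ) * (conj (φ x) * u x) ∂torusMeasure := by
        rw [integral_const_mul, L2.inner_def]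
        congr 2
        ext x
        rw [RCLike.inner_apply, mul_comm]
      have h2 : Integrable (fun x => (σ : ℂ) * (conj (φ x) * u x)) torusMeasure := by
        refine Integrable.const_mul ((L2.integrable_inner (𝕜 := ℂ) φ u).congr ?_) _
        exact Eventually.of_forall fun x => by
          change inner ℂ (φ x) (u x) = _
          rw [RCLike.inner_apply, mul_comm]
      unfold schrodingerForm
      rw [h1, add_assoc, ← integral_add (integrable_potential_mul hθ hV hφ hu) h2]
      congr 2
      ext x
      push_cast
      ring
  unfold SchrodingerMapsTo
  simp only [memFormDomain_iff hθ hm, memFormDomain_iff hθ hV.memLp]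
  refine and_congr_right fun hu => forall₂_congr fun φ hφ => ?_
  rw [hform φ hφ hu, inner_sub_right, inner_smul_right, eq_sub_iff_add_eq]

/-- The trace in terms of any eigensystem. -/
theorem IsEigensystem.trace_eq (hθ : ∀ j, 0 < θ j) {V : Torus3 → ℝ} (hV : IsPotential V)
    {u : ℕ → L2T} {a : ℕ → ℝ} (hu : IsEigensystem θ V u a) (σ : ℝ) (g : ℝ → ℝ) :
    schrodingerTrace θ (fun x => V x + σ) g = ∑' k, ENNReal.ofReal (g (a k + σ)) := by
  have hspace : ∀ m, schrodingerEigenspace θ (fun x => V x + σ) m =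
      Submodule.span ℂ (range fun k : {k // a k + σ = m} => u k) := fun m => by
    have h1 : schrodingerEigenspace θ (fun x => V x + σ) m =
        schrodingerEigenspace θ V (m - σ) := by
      unfold schrodingerEigenspace
      congr 1
      ext w
      simp only [mem_ofPred_eq]
      rw [mapsTo_add_const_iff hθ hV, ← sub_smul]
      norm_cast
    rw [h1, hu.eigenspace_eq hθ hV]
    congr 1
    ext w
    simp [eq_sub_iff_add_eq]
  have hrank : ∀ m, Cardinal.toENat (Module.rank ℂ
      (schrodingerEigenspace θ (fun x => V x + σ) m)) = ENat.card {k // a k + σ = m} := fun m => by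
    have hl : LinearIndependent ℂ fun k : {k // a k + σ = m} => u k :=
      (hu.1.1.comp _ Subtype.val_injective).linearIndependent
    rw [hspace m, rank_span hl, ENat.card, ← ENat.card, ← ENat.card]
    exact (ENat.card_congr (Equiv.ofInjective _ hl.injective)).symm
  unfold schrodingerTrace
  rw [← (Equiv.sigmaFiberEquiv fun k => a k + σ).tsum_eq, ENNReal.tsum_sigma']
  refine tsum_congr fun m => ?_
  rw [hrank, ← ENNReal.tsum_const]
  refine tsum_congr fun k => ?_
  simp [Equiv.sigmaFiberEquiv, k.2]

end Spectral

end NLSS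

end

noncomputable section

namespace NLSS

/-! ### The trace as a convex function of potential and shift. -/

variable {θ : Fin 3 → ℝ} {f : ℝ → ℝ}

/-- `Tr F(-Δ + V + σ)` as a real number. -/
def realTrace (θ : Fin 3 → ℝ) (f : ℝ → ℝ) (V : Torus3 → ℝ) (σ : ℝ) : ℝ :=
  (schrodingerTrace θ (fun x => V x + σ) (casimirPrimitive f)).toReal

lemma IsEigensystem.nonneg (hθ : ∀ j, 0 < θ j) {V : Torus3 → ℝ} (hV : IsPotential V)
    {u : ℕ → L2T} {a : ℕ → ℝ} (hu : IsEigensystem θ V u a) (k : ℕ) : 0 ≤ a k :=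
  eigenvalue_nonneg hθ hV (hu.2 k) (hu.1.1.1 k)

lemma IsEigensystem.energy_eq (hθ : ∀ j, 0 < θ j) {V : Torus3 → ℝ} (hV : IsPotential V)
    {u : ℕ → L2T} {a : ℕ → ℝ} (hu : IsEigensystem θ V u a) (k : ℕ) :
    energy θ V (u k) = a k := by
  rw [energy_eq_of_mapsTo hθ hV (hu.2 k), hu.1.1.1 k, one_pow, mul_one]

lemma IsEigensystem.h1NormSq_le (hθ : ∀ j, 0 < θ j) {V : Torus3 → ℝ} (hV : IsPotential V)
    {u : ℕ → L2T} {a : ℕ → ℝ} (hu : IsEigensystem θ V u a) (k : ℕ) :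
    h1NormSq θ (u k) ≤ 1 + a k := by
  have := h1NormSq_le_energy (θ := θ) hV (u k)
  rw [hu.energy_eq hθ hV, hu.1.1.1 k] at this
  linarith

lemma h1NormSq_nonneg (hθ : ∀ j, 0 < θ j) (u : L2T) : 0 ≤ h1NormSq θ u := tsum_nonneg fun n =>
  mul_nonneg (by linarith [laplaceSymbol_nonneg hθ n]) (by positivity)

/-- Uniform bounds for the occupation numbers. -/
lemma CasimirClass.exists_sum_bound (hf : CasimirClass f) (hθ : ∀ j, 0 < θ j) (S : ℝ) :
    ∃ B : ℝ, 0 < B ∧ ∀ (V : Torus3 → ℝ) (u : ℕ → L2T) (a : ℕ → ℝ) (σ : ℝ), IsPotential V →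
      IsEigensystem θ V u a → S ≤ σ →
      Summable (fun k => casimirPrimitive f (a k + σ)) ∧
      Summable (fun k => f (a k + σ) * (1 + a k)) ∧
      ∑' k, f (a k + σ) * (1 + a k) ≤ B := by
  obtain ⟨r, hr, hrS⟩ := hf.exists_decay
  obtain ⟨C, hC, hCS⟩ := hrS S
  set Z := ∑' n : Fin 3 → ℤ, (1 + laplaceSymbol θ n) ^ (-r) with hZ
  have hZ0 : 0 ≤ Z := tsum_nonneg fun n => by
    have := laplaceSymbol_nonneg hθ n
    positivity
  refine ⟨C * Z + 1, by positivity, fun V u a σ hV hu hσ => ?_⟩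
  have ha := hu.nonneg hθ hV
  obtain ⟨h1, h2⟩ := hu.tsum_rpow_le hθ hV hr
  have h3 : Summable fun k => f (a k + σ) * (1 + a k) :=
    Summable.of_nonneg_of_le (fun k => mul_nonneg (hf.pos _).le (by linarith [ha k]))
      (fun k => (hCS σ hσ (a k) (ha k)).1) (h1.mul_left C)
  refine ⟨Summable.of_nonneg_of_le (fun k => (hf.primitive_pos _).le)
    (fun k => (hCS σ hσ (a k) (ha k)).2) (h1.mul_left C), h3, ?_⟩
  have h4 := h3.tsum_le_tsum (fun k => (hCS σ hσ (a k) (ha k)).1) (h1.mul_left C)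
  rw [tsum_mul_left] at h4
  have := mul_le_mul_of_nonneg_left h2 hC.le
  linarith

section

variable {V : Torus3 → ℝ} {u : ℕ → L2T} {a : ℕ → ℝ}

lemma IsEigensystem.summable_primitive (hu : IsEigensystem θ V u a) (hf : CasimirClass f)
    (hθ : ∀ j, 0 < θ j) (hV : IsPotential V) (σ : ℝ) :
    Summable fun k => casimirPrimitive f (a k + σ) := by
  obtain ⟨B, -, hB⟩ := hf.exists_sum_bound hθ σ
  exact (hB V u a σ hV hu le_rfl).1

lemma IsEigensystem.summable_occupation_mul (hu : IsEigensystem θ V u a) (hf : CasimirClass f)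
    (hθ : ∀ j, 0 < θ j) (hV : IsPotential V) (σ : ℝ) :
    Summable fun k => f (a k + σ) * (1 + a k) := by
  obtain ⟨B, -, hB⟩ := hf.exists_sum_bound hθ σ
  exact (hB V u a σ hV hu le_rfl).2.1

lemma IsEigensystem.summable_occupation (hu : IsEigensystem θ V u a) (hf : CasimirClass f)
    (hθ : ∀ j, 0 < θ j) (hV : IsPotential V) (σ : ℝ) :
    Summable fun k => f (a k + σ) :=
  Summable.of_nonneg_of_le (fun k => (hf.pos _).le) (fun k => by
    have := hu.nonneg hθ hV k
    have := hf.pos (a k + σ)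
    nlinarith) (hu.summable_occupation_mul hf hθ hV σ)

lemma IsEigensystem.trace_eq_ofReal (hu : IsEigensystem θ V u a) (hf : CasimirClass f)
    (hθ : ∀ j, 0 < θ j) (hV : IsPotential V) (σ : ℝ) :
    schrodingerTrace θ (fun x => V x + σ) (casimirPrimitive f) =
      ENNReal.ofReal (∑' k, casimirPrimitive f (a k + σ)) := by
  rw [hu.trace_eq hθ hV, ENNReal.ofReal_tsum_of_nonneg (fun k => (hf.primitive_pos _).le)
    (hu.summable_primitive hf hθ hV σ)]

lemma IsEigensystem.realTrace_eq (hu : IsEigensystem θ V u a) (hf : CasimirClass f)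
    (hθ : ∀ j, 0 < θ j) (hV : IsPotential V) (σ : ℝ) :
    realTrace θ f V σ = ∑' k, casimirPrimitive f (a k + σ) := by
  rw [realTrace, hu.trace_eq_ofReal hf hθ hV,
    ENNReal.toReal_ofReal (tsum_nonneg fun k => (hf.primitive_pos _).le)]

lemma schrodingerTrace_ne_top (hf : CasimirClass f) (hθ : ∀ j, 0 < θ j) (hV : IsPotential V)
    (σ : ℝ) : schrodingerTrace θ (fun x => V x + σ) (casimirPrimitive f) ≠ ⊤ := by
  obtain ⟨u, a, hu⟩ := exists_eigensystem hθ hV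
  rw [hu.trace_eq_ofReal hf hθ hV]
  exact ENNReal.ofReal_ne_top

/-- The trace is bounded below by tangents along any orthonormal family in `H¹`. -/
lemma sum_tangent_le_realTrace (hf : CasimirClass f) (hθ : ∀ j, 0 < θ j) (hV : IsPotential V)
    (σ : ℝ) {κ : Type*} {φ : κ → L2T} (hφ : Orthonormal ℂ φ) (hφ1 : ∀ k, MemH1 θ (φ k))
    (m : κ → ℝ) (K : Finset κ) :
    ∑ k ∈ K, (casimirPrimitive f (m k) - f (m k) * (energy θ V (φ k) + σ - m k)) ≤
      realTrace θ f V σ := by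
  obtain ⟨u, a, hu⟩ := exists_eigensystem hθ hV
  have hb := fun k => hu.tsum_eigenvalue_mul_le hθ hV (hφ1 k)
  rw [hu.realTrace_eq hf hθ hV]
  have h := (hf.tangentPair σ).sum_tangent_le hu.1.basis (hu.nonneg hθ hV)
    (hu.summable_primitive hf hθ hV σ) hφ (q := fun k => energy θ V (φ k))
    (m := fun k => m k - σ) (fun k => (hf.pos _).le) (fun k s _ => by
      have := hf.primitive_tangent (s + σ) (m k)
      simp only [sub_add_cancel]
      convert this using 3
      ring) (by simpa using fun k => (hb k).1) (by simpa using fun k => (hb k).2) K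
  simp only [sub_add_cancel] at h
  refine le_of_eq_of_le (Finset.sum_congr rfl fun k _ => ?_) h
  ring

lemma peierls_realTrace (hf : CasimirClass f) (hθ : ∀ j, 0 < θ j) (hV : IsPotential V)
    (σ : ℝ) {φ : ℕ → L2T} (hφ : Orthonormal ℂ φ) (hφ1 : ∀ k, MemH1 θ (φ k)) :
    Summable (fun k => casimirPrimitive f (energy θ V (φ k) + σ)) ∧
      ∑' k, casimirPrimitive f (energy θ V (φ k) + σ) ≤ realTrace θ f V σ := by
  have h1 : ∀ K : Finset ℕ, ∑ k ∈ K, casimirPrimitive f (energy θ V (φ k) + σ) ≤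
      realTrace θ f V σ := fun K => by
    simpa using sum_tangent_le_realTrace hf hθ hV σ hφ hφ1 (fun k => energy θ V (φ k) + σ) K
  have h2 := summable_of_sum_le (fun k => (hf.primitive_pos _).le) h1
  exact ⟨h2, h2.tsum_le_of_sum_le h1⟩

lemma integrable_potential_sq (hθ : ∀ j, 0 < θ j) (hV : MemLp V (3 / 2) torusMeasure) {w : L2T}
    (hw : MemH1 θ w) : Integrable (fun x => V x * ‖w x‖ ^ 2) torusMeasure := by
  obtain ⟨C, -, hC⟩ := exists_integral_mul_norm_sq_le hθ
  exact (hC V hV w hw).1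

lemma energy_sub (hθ : ∀ j, 0 < θ j) {V' : Torus3 → ℝ} (hV : IsPotential V)
    (hV' : IsPotential V') {w : L2T} (hw : MemH1 θ w) :
    energy θ V' w - energy θ V w = ∫ x, (V' x - V x) * ‖w x‖ ^ 2 ∂torusMeasure := by
  unfold energy
  rw [add_sub_add_left_eq_sub, ← integral_sub (integrable_potential_sq hθ hV'.memLp hw)
    (integrable_potential_sq hθ hV.memLp hw)]
  simp only [sub_mul]

/-- The subgradient inequality for the trace. -/
theorem IsEigensystem.subgradient (hu : IsEigensystem θ V u a) (hf : CasimirClass f)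
    (hθ : ∀ j, 0 < θ j) (hV : IsPotential V) {V' : Torus3 → ℝ} (hV' : IsPotential V')
    (σ σ' : ℝ) :
    Summable (fun k => f (a k + σ) * ∫ x, (V' x - V x) * ‖u k x‖ ^ 2 ∂torusMeasure) ∧
    realTrace θ f V σ - ∑' k, f (a k + σ) * ∫ x, (V' x - V x) * ‖u k x‖ ^ 2 ∂torusMeasure -
      (σ' - σ) * ∑' k, f (a k + σ) ≤ realTrace θ f V' σ' := by
  obtain ⟨C, hC0, hC⟩ := exists_integral_mul_norm_sq_le hθ
  have hW : MemLp (fun x => V' x - V x) (3 / 2) torusMeasure := hV'.memLp.sub hV.memLp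
  have hH := fun k => (hu.2 k).1.1
  have hs : Summable (fun k => f (a k + σ) * ∫ x, (V' x - V x) * ‖u k x‖ ^ 2 ∂torusMeasure) := by
    refine Summable.of_norm_bounded ((hu.summable_occupation_mul hf hθ hV σ).mul_left
      (C * (eLpNorm (fun x => V' x - V x) (3 / 2) torusMeasure).toReal)) fun k => ?_
    rw [norm_mul, Real.norm_of_nonneg (hf.pos _).le]
    have h1 : ‖∫ x, (V' x - V x) * ‖u k x‖ ^ 2 ∂torusMeasure‖ ≤
        C * (eLpNorm (fun x => V' x - V x) (3 / 2) torusMeasure).toReal * (1 + a k) := by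
      refine (norm_integral_le_integral_norm _).trans ?_
      have h2 := (hC _ hW (u k) (hH k)).2
      have h3 := hu.h1NormSq_le hθ hV k
      simp only [norm_mul, Real.norm_eq_abs, abs_pow, abs_norm]
      exact h2.trans (mul_le_mul_of_nonneg_left h3 (by positivity))
    have := mul_le_mul_of_nonneg_left h1 (hf.pos (a k + σ)).le
    linarith
  refine ⟨hs, ?_⟩
  have hF := hu.summable_primitive hf hθ hV σ
  have hf1 := hu.summable_occupation hf hθ hV σ
  -- The tangents are taken at the eigenvalues for `(V, σ)` and evaluated at the energies of the
  -- same eigenfunctions under `(V', σ')`.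
  have hT : HasSum (fun k => casimirPrimitive f (a k + σ) -
      f (a k + σ) * (energy θ V' (u k) + σ' - (a k + σ)))
      (realTrace θ f V σ - ∑' k, f (a k + σ) * ∫ x, (V' x - V x) * ‖u k x‖ ^ 2 ∂torusMeasure -
      (σ' - σ) * ∑' k, f (a k + σ)) := by
    rw [hu.realTrace_eq hf hθ hV]
    refine HasSum.congr_fun ((hF.hasSum.sub hs.hasSum).sub (hf1.hasSum.mul_left (σ' - σ)))
      fun k => ?_
    rw [← energy_sub hθ hV hV' (hH k), hu.energy_eq hθ hV]
    ring
  rw [← hT.tsum_eq]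
  exact hT.summable.tsum_le_of_sum_le fun K =>
    sum_tangent_le_realTrace hf hθ hV' σ' hu.1.1 hH (fun k => a k + σ) K

end

/-- The trace is locally Lipschitz in the potential. -/
theorem exists_realTrace_lipschitz (hf : CasimirClass f) (hθ : ∀ j, 0 < θ j) (S : ℝ) :
    ∃ B : ℝ, 0 < B ∧ ∀ (V V' : Torus3 → ℝ) (σ σ' : ℝ), IsPotential V → IsPotential V' → S ≤ σ →
      realTrace θ f V σ - realTrace θ f V' σ' ≤
        B * ((eLpNorm (fun x => V' x - V x) (3 / 2) torusMeasure).toReal + |σ' - σ|) := by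
  obtain ⟨B, hB0, hB⟩ := hf.exists_sum_bound hθ S
  obtain ⟨C, hC0, hC⟩ := exists_integral_mul_norm_sq_le hθ
  refine ⟨B * (C + 1), by positivity, fun V V' σ σ' hV hV' hσ => ?_⟩
  obtain ⟨u, a, hu⟩ := exists_eigensystem hθ hV
  obtain ⟨hs, hsub⟩ := hu.subgradient hf hθ hV hV' σ σ'
  obtain ⟨-, hs2, hle⟩ := hB V u a σ hV hu hσ
  have hW : MemLp (fun x => V' x - V x) (3 / 2) torusMeasure := hV'.memLp.sub hV.memLp
  set N := (eLpNorm (fun x => V' x - V x) (3 / 2) torusMeasure).toReal with hN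
  have hN0 : 0 ≤ N := ENNReal.toReal_nonneg
  have h1 : ∑' k, f (a k + σ) * ∫ x, (V' x - V x) * ‖u k x‖ ^ 2 ∂torusMeasure ≤ C * N * B := by
    calc _ ≤ ∑' k, C * N * (f (a k + σ) * (1 + a k)) := by
          refine hs.tsum_le_tsum (fun k => ?_) (hs2.mul_left _)
          have h2 := (hC _ hW (u k) (hu.2 k).1.1).2
          have h3 := hu.h1NormSq_le hθ hV k
          have h4 : ∫ x, (V' x - V x) * ‖u k x‖ ^ 2 ∂torusMeasure ≤ C * N * (1 + a k) := by
            refine (Real.le_norm_self _).trans ((norm_integral_le_integral_norm _).trans ?_)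
            simp only [norm_mul, Real.norm_eq_abs, abs_pow, abs_norm]
            exact h2.trans (mul_le_mul_of_nonneg_left h3 (by positivity))
          have := mul_le_mul_of_nonneg_left h4 (hf.pos (a k + σ)).le
          linarith
      _ ≤ _ := by
          rw [tsum_mul_left]
          gcongr
  have hocc := hu.summable_occupation hf hθ hV σ
  have h5 : 0 ≤ ∑' k, f (a k + σ) := tsum_nonneg fun k => (hf.pos _).le
  have h6 : ∑' k, f (a k + σ) ≤ B := by
    refine le_trans (hocc.tsum_le_tsum (fun k => ?_) hs2) hle
    have := hu.nonneg hθ hV k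
    have := hf.pos (a k + σ)
    nlinarith
  have h7 : (σ' - σ) * ∑' k, f (a k + σ) ≤ |σ' - σ| * B := by
    have := le_abs_self (σ' - σ)
    have := abs_nonneg (σ' - σ)
    nlinarith
  have h8 : 0 ≤ C * B * |σ' - σ| := by positivity
  have h9 : 0 ≤ B * N := by positivity
  nlinarith

/-- The lower bound of the trace by the constant trial function. -/
lemma tangent_le_realTrace (hf : CasimirClass f) (hθ : ∀ j, 0 < θ j) {V : Torus3 → ℝ}
    (hV : IsPotential V) (σ m : ℝ) :
    casimirPrimitive f m - f m * (∫ x, V x ∂torusMeasure + σ - m) ≤ realTrace θ f V σ := by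
  classical
  set e : L2T := fourierBasis 0 with he
  have hee : ∀ n, inner ℂ (fourierBasis n) e = if n = 0 then 1 else 0 := fun n =>
    orthonormal_iff_ite.1 fourierBasis.orthonormal n 0
  have hH : MemH1 θ e := by
    refine summable_of_ne_finset_zero (s := {0}) fun n hn => ?_
    rw [mFourierCoeff_eq_inner, hee, if_neg (by simpa using hn)]
    simp
  have h0 : h1NormSq θ e - ‖e‖ ^ 2 = 0 := by
    rw [← (hasSum_laplaceSymbol_mul hH).tsum_eq]
    refine (tsum_congr fun n => ?_).trans tsum_zero
    rw [hee]
    split_ifs with hn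
    · simp [hn, laplaceSymbol]
    · simp
  have hE : energy θ V e = ∫ x, V x ∂torusMeasure := by
    rw [energy, h0, zero_add]
    refine integral_congr_ae ?_
    filter_upwards [ae_norm_fourierBasis 0] with x hx
    rw [he, hx, one_pow, mul_one]
  have h := sum_tangent_le_realTrace hf hθ hV σ (φ := fun _ : Unit => e)
    ⟨fun _ => fourierBasis.orthonormal.1 0, fun i j hij => (hij (Subsingleton.elim i j)).elim⟩
    (fun _ => hH) (fun _ => m) Finset.univ
  simpa [hE] using h

lemma energy_convexCombo (hθ : ∀ j, 0 < θ j) {V V' W : Torus3 → ℝ} (hV : IsPotential V)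
    (hV' : IsPotential V') {x y : ℝ} (hxy : x + y = 1)
    (hW : ∀ᵐ t ∂torusMeasure, W t = x * V t + y * V' t) {w : L2T} (hw : MemH1 θ w) :
    energy θ W w = x * energy θ V w + y * energy θ V' w := by
  have h1 : ∫ t, W t * ‖w t‖ ^ 2 ∂torusMeasure =
      x * ∫ t, V t * ‖w t‖ ^ 2 ∂torusMeasure + y * ∫ t, V' t * ‖w t‖ ^ 2 ∂torusMeasure := by
    rw [← integral_const_mul, ← integral_const_mul,
      ← integral_add ((integrable_potential_sq hθ hV.memLp hw).const_mul x)
        ((integrable_potential_sq hθ hV'.memLp hw).const_mul y)]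
    refine integral_congr_ae ?_
    filter_upwards [hW] with t ht
    rw [ht]
    ring
  unfold energy
  rw [h1]
  linear_combination (-(h1NormSq θ w - ‖w‖ ^ 2)) * hxy

lemma CasimirClass.primitive_convex (hf : CasimirClass f) {x y : ℝ} (hx : 0 ≤ x) (hy : 0 ≤ y)
    (hxy : x + y = 1) (s t : ℝ) : casimirPrimitive f (x * s + y * t) ≤
      x * casimirPrimitive f s + y * casimirPrimitive f t := by
  have h1 := mul_le_mul_of_nonneg_left (hf.primitive_tangent s (x * s + y * t)) hx
  have h2 := mul_le_mul_of_nonneg_left (hf.primitive_tangent t (x * s + y * t)) hy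
  have h3 : casimirPrimitive f (x * s + y * t) =
      x * (casimirPrimitive f (x * s + y * t) - f (x * s + y * t) * (s - (x * s + y * t))) +
      y * (casimirPrimitive f (x * s + y * t) - f (x * s + y * t) * (t - (x * s + y * t))) := by
    linear_combination (-casimirPrimitive f (x * s + y * t) -
      f (x * s + y * t) * (x * s + y * t)) * hxy
  linarith

lemma CasimirClass.primitive_strictConvex (hf : CasimirClass f) {x y : ℝ} (hx : 0 < x)
    (hy : 0 < y) (hxy : x + y = 1) {s t : ℝ} (hst : s ≠ t) :
    casimirPrimitive f (x * s + y * t) <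
      x * casimirPrimitive f s + y * casimirPrimitive f t := by
  have hne : s ≠ x * s + y * t := fun h => hst (by
    have : y * (s - t) = 0 := by linear_combination h + s * hxy
    have := (mul_eq_zero.1 this).resolve_left hy.ne'
    linarith)
  have h1 := mul_lt_mul_of_pos_left (hf.primitive_tangent_lt hne) hx
  have h2 := mul_le_mul_of_nonneg_left (hf.primitive_tangent t (x * s + y * t)) hy.le
  have h3 : casimirPrimitive f (x * s + y * t) =
      x * (casimirPrimitive f (x * s + y * t) - f (x * s + y * t) * (s - (x * s + y * t))) +
      y * (casimirPrimitive f (x * s + y * t) - f (x * s + y * t) * (t - (x * s + y * t))) := by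
    linear_combination (-casimirPrimitive f (x * s + y * t) -
      f (x * s + y * t) * (x * s + y * t)) * hxy
  linarith

/-- Convexity of the trace in the potential. -/
theorem realTrace_convex (hf : CasimirClass f) (hθ : ∀ j, 0 < θ j) {V V' W : Torus3 → ℝ}
    (hV : IsPotential V) (hV' : IsPotential V') (hWp : IsPotential W) {x y : ℝ} (hx : 0 ≤ x)
    (hy : 0 ≤ y) (hxy : x + y = 1) (hW : ∀ᵐ t ∂torusMeasure, W t = x * V t + y * V' t)
    (σ σ' : ℝ) :
    realTrace θ f W (x * σ + y * σ') ≤ x * realTrace θ f V σ + y * realTrace θ f V' σ' := by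
  obtain ⟨u, a, hu⟩ := exists_eigensystem hθ hWp
  have hH := fun k => (hu.2 k).1.1
  -- The eigenfunctions of the combination serve as the trial family for both endpoints. Energies
  -- are affine in the potential, so only the scalar convexity of `F` remains.
  obtain ⟨h1, h2⟩ := peierls_realTrace hf hθ hV σ hu.1.1 hH
  obtain ⟨h3, h4⟩ := peierls_realTrace hf hθ hV' σ' hu.1.1 hH
  rw [hu.realTrace_eq hf hθ hWp]
  have h5 := (h1.hasSum.mul_left x).add (h3.hasSum.mul_left y)
  refine ((hu.summable_primitive hf hθ hWp _).tsum_le_tsum (fun k => ?_) h5.summable).trans ?_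
  · have h6 : a k + (x * σ + y * σ') =
        x * (energy θ V (u k) + σ) + y * (energy θ V' (u k) + σ') := by
      rw [← hu.energy_eq hθ hWp, energy_convexCombo hθ hV hV' hxy hW (hH k)]
      ring
    rw [h6]
    exact hf.primitive_convex hx hy hxy _ _
  · rw [h5.tsum_eq]
    gcongr

/-- Strict convexity of the trace in the shift. -/
theorem realTrace_strictConvex (hf : CasimirClass f) (hθ : ∀ j, 0 < θ j) {V : Torus3 → ℝ}
    (hV : IsPotential V) {x y : ℝ} (hx : 0 < x) (hy : 0 < y) (hxy : x + y = 1) {σ σ' : ℝ}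
    (hσ : σ ≠ σ') :
    realTrace θ f V (x * σ + y * σ') < x * realTrace θ f V σ + y * realTrace θ f V σ' := by
  obtain ⟨u, a, hu⟩ := exists_eigensystem hθ hV
  have hs := hu.summable_primitive hf hθ hV
  rw [hu.realTrace_eq hf hθ hV, hu.realTrace_eq hf hθ hV, hu.realTrace_eq hf hθ hV]
  have h5 := ((hs σ).hasSum.mul_left x).add ((hs σ').hasSum.mul_left y)
  rw [← h5.tsum_eq]
  have h6 : ∀ k, a k + (x * σ + y * σ') = x * (a k + σ) + y * (a k + σ') := fun k => by
    linear_combination (-a k) * hxy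
  refine Summable.tsum_lt_tsum (i := 0) (fun k => ?_) ?_ (hs _) h5.summable
  · simp only [h6]
    exact hf.primitive_convex hx.le hy.le hxy _ _
  · simp only [h6]
    exact hf.primitive_strictConvex hx hy hxy (by simpa using hσ)

end NLSS

end

noncomputable section

namespace NLSS

/-! ### Uniform convexity of a real power. -/

section UniformConvexity

lemma midpoint_gap_pos {q : ℝ} (hq : 1 < q) {s t : ℝ} (hs : 0 ≤ s) (ht : 0 ≤ t) (h : s ≠ t) :
    0 < (s ^ q + t ^ q) / 2 - ((s + t) / 2) ^ q := by
  have h1 := (strictConvexOn_rpow hq).2 (mem_Ici.2 hs) (mem_Ici.2 ht) h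
    (by norm_num : (0 : ℝ) < 1 / 2) (by norm_num : (0 : ℝ) < 1 / 2) (by norm_num)
  simp only [smul_eq_mul] at h1
  rw [show 1 / 2 * s + 1 / 2 * t = (s + t) / 2 by ring] at h1
  linarith

lemma midpoint_gap_nonneg {q : ℝ} (hq : 1 < q) {s t : ℝ} (hs : 0 ≤ s) (ht : 0 ≤ t) :
    0 ≤ (s ^ q + t ^ q) / 2 - ((s + t) / 2) ^ q := by
  rcases eq_or_ne s t with rfl | h
  · simp
  · exact (midpoint_gap_pos hq hs ht h).le

/-- Uniform convexity of `t ↦ t ^ q`, in homogeneous form. -/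
lemma exists_sub_rpow_le_gap {q : ℝ} (hq : 1 < q) {ε : ℝ} (hε : 0 < ε) :
    ∃ C : ℝ, 0 < C ∧ ∀ a b : ℝ, 0 ≤ a → 0 ≤ b → |a - b| ^ q ≤
      ε * (a ^ q + b ^ q) + C * ((a ^ q + b ^ q) / 2 - ((a + b) / 2) ^ q) := by
  have hq0 : 0 < q := by linarith
  -- By homogeneity it is enough to compare with `b = 1`; `g` is the midpoint gap in the ratio `s =
  -- a / b`.
  set g : ℝ → ℝ := fun s => (s ^ q + 1) / 2 - ((s + 1) / 2) ^ q with hg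
  have hgc : Continuous g :=
    (((Real.continuous_rpow_const hq0.le).add continuous_const).div_const 2).sub
      ((Real.continuous_rpow_const hq0.le).comp ((continuous_id.add continuous_const).div_const 2))
  -- The ratios with `(1 - s)^q ≥ ε` form a compact set that avoids `s = 1`, so the gap has a
  -- positive minimum on it. For the other ratios the term with `ε` is already sufficient.
  have hδ : ∃ δ : ℝ, 0 < δ ∧ ∀ s ∈ Icc (0 : ℝ) 1, ε ≤ (1 - s) ^ q → δ ≤ g s := by
    set K : Set ℝ := Icc 0 1 ∩ {s | ε ≤ (1 - s) ^ q} with hK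
    have hKc : IsCompact K := isCompact_Icc.inter_right (isClosed_le continuous_const
      ((Real.continuous_rpow_const hq0.le).comp (continuous_const.sub continuous_id)))
    rcases K.eq_empty_or_nonempty with hem | hne
    · refine ⟨1, one_pos, fun s hs h => ?_⟩
      have : s ∈ K := ⟨hs, h⟩
      simp [hem] at this
    · obtain ⟨s₀, hs₀, hmin⟩ := hKc.exists_isMinOn hne hgc.continuousOn
      refine ⟨g s₀, ?_, fun s hs h => hmin ⟨hs, h⟩⟩
      have h1 : s₀ ≠ 1 := by
        rintro rfl
        have := hs₀.2
        simp only [mem_ofPred_eq, sub_self, Real.zero_rpow hq0.ne'] at this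
        linarith
      simpa [hg] using midpoint_gap_pos hq hs₀.1.1 zero_le_one h1
  obtain ⟨δ, hδ0, hδg⟩ := hδ
  have key : ∀ a b : ℝ, 0 ≤ a → a ≤ b → |a - b| ^ q ≤
      ε * (a ^ q + b ^ q) + δ⁻¹ * ((a ^ q + b ^ q) / 2 - ((a + b) / 2) ^ q) := fun a b ha hab => by
    have hb : 0 ≤ b := ha.trans hab
    have hgap := midpoint_gap_nonneg hq ha hb
    have haq : 0 ≤ a ^ q := Real.rpow_nonneg ha q
    have hbq : 0 ≤ b ^ q := Real.rpow_nonneg hb q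
    have hδi : 0 < δ⁻¹ := by positivity
    rcases hb.eq_or_lt with rfl | hb0
    · have : a = 0 := le_antisymm hab ha
      simp [this, Real.zero_rpow hq0.ne']
    set s := a / b with hs
    have hs01 : s ∈ Icc (0 : ℝ) 1 := ⟨by positivity, (div_le_one hb0).2 hab⟩
    have ha' : a = s * b := by rw [hs]; field_simp
    have e1 : |a - b| ^ q = (1 - s) ^ q * b ^ q := by
      rw [abs_sub_comm, abs_of_nonneg (by linarith), ← Real.mul_rpow (by linarith [hs01.2]) hb]
      congr 1
      rw [ha']; ring
    have e2 : (a ^ q + b ^ q) / 2 - ((a + b) / 2) ^ q = g s * b ^ q := by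
      have h1 : (a + b) / 2 = ((s + 1) / 2) * b := by rw [ha']; ring
      rw [h1, Real.mul_rpow (by linarith [hs01.1]) hb, ha', Real.mul_rpow hs01.1 hb]
      simp only [hg]
      ring
    rcases le_or_gt ε ((1 - s) ^ q) with h1 | h1
    · have h2 := hδg s hs01 h1
      have h3 : (1 - s) ^ q ≤ 1 :=
        Real.rpow_le_one (by linarith [hs01.2]) (by linarith [hs01.1]) hq0.le
      have h4 : 1 ≤ δ⁻¹ * g s := by
        rw [inv_mul_eq_div, one_le_div hδ0]; exact h2
      have h5 : 0 ≤ ε * (a ^ q + b ^ q) := by positivity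
      rw [e1, e2]
      nlinarith
    · have h5 : 0 ≤ δ⁻¹ * ((a ^ q + b ^ q) / 2 - ((a + b) / 2) ^ q) := by positivity
      rw [e1]
      nlinarith
  refine ⟨δ⁻¹, by positivity, fun a b ha hb => ?_⟩
  rcases le_total a b with hab | hab
  · exact key a b ha hab
  · have := key b a hb hab
    rwa [abs_sub_comm, add_comm (b ^ q), add_comm b] at this

end UniformConvexity

/-! ### The space `L^q` of potentials. -/

section PotentialSpace

variable {α : ℕ}

/-- The exponent `(α + 1) / α` as a real number. -/
def realExponent (α : ℕ) : ℝ := ((α : ℝ) + 1) / (α : ℝ)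

lemma potentialExponent_toReal (α : ℕ) : (potentialExponent α).toReal = realExponent α := by
  simp [potentialExponent, realExponent, ENNReal.toReal_div, ENNReal.toReal_add]

lemma potentialExponent_ne_zero (α : ℕ) : potentialExponent α ≠ 0 :=
  (zero_lt_one.trans_le Fact.out).ne'

lemma potentialExponent_ne_top (hα : α = 1 ∨ α = 2) : potentialExponent α ≠ ⊤ := by
  have : (α : ℝ≥0∞) ≠ 0 := by rcases hα with rfl | rfl <;> simp
  exact ENNReal.div_ne_top (by finiteness) this

lemma one_lt_realExponent (hα : α = 1 ∨ α = 2) : 1 < realExponent α := by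
  rcases hα with rfl | rfl <;> norm_num [realExponent]

lemma realExponent_sub_one (hα : α = 1 ∨ α = 2) : realExponent α - 1 = 1 / (α : ℝ) := by
  rcases hα with rfl | rfl <;> norm_num [realExponent]

/-- For `α = 2` this is an equality, and form boundedness is used at its endpoint exponent. -/
lemma three_halves_le_potentialExponent (hα : α = 1 ∨ α = 2) : 3 / 2 ≤ potentialExponent α := by
  rw [← ENNReal.toReal_le_toReal (by finiteness) (potentialExponent_ne_top hα),
    potentialExponent_toReal]
  rcases hα with rfl | rfl <;> norm_num [realExponent]

lemma isPotential (hα : α = 1 ∨ α = 2) {V : Potential α} (hV : 0 ≤ V) : IsPotential V :=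
  ⟨(Lp.memLp V).mono_exponent (three_halves_le_potentialExponent hα), (Lp.coeFn_nonneg V).2 hV⟩

lemma eLpNorm_sub_le (hα : α = 1 ∨ α = 2) (V V' : Potential α) :
    (eLpNorm (fun x => V' x - V x) (3 / 2) torusMeasure).toReal ≤ ‖V' - V‖ := by
  have h1 : eLpNorm (fun x => V' x - V x) (3 / 2) torusMeasure =
      eLpNorm (V' - V : Potential α) (3 / 2) torusMeasure :=
    eLpNorm_congr_ae (Lp.coeFn_sub V' V).symm
  rw [h1, Lp.norm_def]
  exact ENNReal.toReal_mono (Lp.eLpNorm_ne_top _)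
    (eLpNorm_le_eLpNorm_of_exponent_le (three_halves_le_potentialExponent hα)
      (Lp.aestronglyMeasurable _))

lemma integrable_abs_rpow (hα : α = 1 ∨ α = 2) (V : Potential α) :
    Integrable (fun x => |V x| ^ realExponent α) torusMeasure := by
  have := (Lp.memLp V).integrable_norm_rpow (potentialExponent_ne_zero α)
    (potentialExponent_ne_top hα)
  simpa only [potentialExponent_toReal, Real.norm_eq_abs] using this

lemma integral_abs_rpow (hα : α = 1 ∨ α = 2) (V : Potential α) :
    ∫ x, |V x| ^ realExponent α ∂torusMeasure = ‖V‖ ^ realExponent α := by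
  have h0 : 0 < realExponent α := zero_lt_one.trans (one_lt_realExponent hα)
  have h1 : 0 ≤ ∫ x, |V x| ^ realExponent α ∂torusMeasure :=
    integral_nonneg fun x => by positivity
  rw [Lp.norm_def, (Lp.memLp V).eLpNorm_eq_integral_rpow_norm (potentialExponent_ne_zero α)
    (potentialExponent_ne_top hα), potentialExponent_toReal]
  simp only [Real.norm_eq_abs]
  rw [ENNReal.toReal_ofReal (by positivity), ← Real.rpow_mul h1, inv_mul_cancel₀ h0.ne',
    Real.rpow_one]

lemma abs_rpow_ae_eq {V : Potential α} (hV : 0 ≤ V) (r : ℝ) :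
    (fun x => |V x| ^ r) =ᵐ[torusMeasure] fun x => V x ^ r := by
  filter_upwards [(Lp.coeFn_nonneg V).2 hV] with x hx
  rw [abs_of_nonneg hx]

lemma integrable_rpow (hα : α = 1 ∨ α = 2) {V : Potential α} (hV : 0 ≤ V) :
    Integrable (fun x => V x ^ realExponent α) torusMeasure :=
  (integrable_abs_rpow hα V).congr (abs_rpow_ae_eq hV _)

lemma integral_rpow (hα : α = 1 ∨ α = 2) {V : Potential α} (hV : 0 ≤ V) :
    ∫ x, V x ^ realExponent α ∂torusMeasure = ‖V‖ ^ realExponent α := by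
  rw [← integral_abs_rpow hα, integral_congr_ae (abs_rpow_ae_eq hV _)]

lemma coeFn_convexCombo (x y : ℝ) (V V' : Potential α) :
    ∀ᵐ t ∂torusMeasure, (x • V + y • V' : Potential α) t = x * V t + y * V' t := by
  filter_upwards [Lp.coeFn_add (x • V) (y • V'), Lp.coeFn_smul x V, Lp.coeFn_smul y V']
    with t h1 h2 h3
  rw [h1, Pi.add_apply, h2, h3]
  rfl

lemma convexCombo_nonneg {x y : ℝ} (hx : 0 ≤ x) (hy : 0 ≤ y) {V V' : Potential α} (hV : 0 ≤ V)
    (hV' : 0 ≤ V') : 0 ≤ x • V + y • V' := by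
  rw [← Lp.coeFn_nonneg]
  filter_upwards [coeFn_convexCombo x y V V', (Lp.coeFn_nonneg V).2 hV,
    (Lp.coeFn_nonneg V').2 hV'] with t h1 h2 h3
  rw [h1]
  exact add_nonneg (mul_nonneg hx h2) (mul_nonneg hy h3)

lemma integral_le_norm (V : Potential α) : ∫ x, V x ∂torusMeasure ≤ ‖V‖ := by
  refine (Real.le_norm_self _).trans ((norm_integral_le_lintegral_norm _).trans ?_)
  rw [Lp.norm_def]
  refine ENNReal.toReal_mono (Lp.eLpNorm_ne_top _) ?_
  have h1 : eLpNorm V 1 torusMeasure ≤ eLpNorm V (potentialExponent α) torusMeasure :=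
    eLpNorm_le_eLpNorm_of_exponent_le Fact.out (Lp.aestronglyMeasurable _)
  rw [eLpNorm_one_eq_lintegral_enorm] at h1
  simpa only [ofReal_norm] using h1

/-- The integral of `V ^ q` is convex, strictly unless the potentials agree. -/
lemma integral_rpow_convexCombo (hα : α = 1 ∨ α = 2) {V V' : Potential α} (hV : 0 ≤ V)
    (hV' : 0 ≤ V') {x y : ℝ} (hx : 0 < x) (hy : 0 < y) (hxy : x + y = 1) :
    ‖x • V + y • V'‖ ^ realExponent α ≤
      x * ‖V‖ ^ realExponent α + y * ‖V'‖ ^ realExponent α ∧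
    (V ≠ V' → ‖x • V + y • V'‖ ^ realExponent α <
      x * ‖V‖ ^ realExponent α + y * ‖V'‖ ^ realExponent α) := by
  have hc := strictConvexOn_rpow (one_lt_realExponent hα)
  have h0 := convexCombo_nonneg hx.le hy.le hV hV'
  have hi1 := ((integrable_rpow hα hV).const_mul x).add ((integrable_rpow hα hV').const_mul y)
  have hi2 := integrable_rpow hα h0
  have hle : ∀ᵐ t ∂torusMeasure, (x • V + y • V' : Potential α) t ^ realExponent α ≤
      x * V t ^ realExponent α + y * V' t ^ realExponent α := by
    filter_upwards [coeFn_convexCombo x y V V', (Lp.coeFn_nonneg V).2 hV,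
      (Lp.coeFn_nonneg V').2 hV'] with t h1 h2 h3
    rw [h1]
    exact hc.convexOn.2 (mem_Ici.2 h2) (mem_Ici.2 h3) hx.le hy.le hxy
  have hs : x * ‖V‖ ^ realExponent α + y * ‖V'‖ ^ realExponent α =
      ∫ t, (x * V t ^ realExponent α + y * V' t ^ realExponent α) ∂torusMeasure := by
    rw [← integral_rpow hα hV, ← integral_rpow hα hV', ← integral_const_mul, ← integral_const_mul,
      ← integral_add ((integrable_rpow hα hV).const_mul x) ((integrable_rpow hα hV').const_mul y)]
  rw [hs, ← integral_rpow hα h0]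
  refine ⟨integral_mono_ae hi2 hi1 hle, fun hne => ?_⟩
  refine lt_of_le_of_ne (integral_mono_ae hi2 hi1 hle) fun heq => hne ?_
  have h1 := (integral_eq_iff_of_ae_le hi2 hi1 hle).1 heq
  refine Lp.ext ?_
  filter_upwards [h1, coeFn_convexCombo x y V V', (Lp.coeFn_nonneg V).2 hV,
    (Lp.coeFn_nonneg V').2 hV'] with t e1 e2 h2 h3
  by_contra hne'
  have := hc.2 (mem_Ici.2 h2) (mem_Ici.2 h3) hne' hx hy hxy
  rw [e2] at e1
  simp only [Pi.add_apply, smul_eq_mul] at e1 this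
  exact this.ne e1

/-- Uniform convexity of `V ↦ ∫ V ^ q`. -/
lemma exists_norm_sub_rpow_le (hα : α = 1 ∨ α = 2) {ε : ℝ} (hε : 0 < ε) :
    ∃ C : ℝ, 0 < C ∧ ∀ V V' : Potential α, 0 ≤ V → 0 ≤ V' →
      ‖V - V'‖ ^ realExponent α ≤
        ε * (‖V‖ ^ realExponent α + ‖V'‖ ^ realExponent α) +
        C * ((‖V‖ ^ realExponent α + ‖V'‖ ^ realExponent α) / 2 -
          ‖(1 / 2 : ℝ) • V + (1 / 2 : ℝ) • V'‖ ^ realExponent α) := by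
  obtain ⟨C, hC, hCab⟩ := exists_sub_rpow_le_gap (one_lt_realExponent hα) hε
  refine ⟨C, hC, fun V V' hV hV' => ?_⟩
  have h0 := convexCombo_nonneg (x := 1 / 2) (y := 1 / 2) (by norm_num) (by norm_num) hV hV'
  have i1 := integrable_rpow hα hV
  have i2 := integrable_rpow hα hV'
  have i3 := integrable_rpow hα h0
  have i4 : Integrable (fun x => V x ^ realExponent α + V' x ^ realExponent α) torusMeasure :=
    i1.add i2
  have i5 : Integrable (fun x => (V x ^ realExponent α + V' x ^ realExponent α) / 2 -
      ((1 / 2 : ℝ) • V + (1 / 2 : ℝ) • V' : Potential α) x ^ realExponent α) torusMeasure :=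
    (i4.div_const 2).sub i3
  rw [← integral_abs_rpow hα, ← integral_rpow hα hV, ← integral_rpow hα hV',
    ← integral_rpow hα h0, ← integral_add i1 i2, ← integral_div,
    ← integral_sub (i4.div_const 2) i3, ← integral_const_mul, ← integral_const_mul,
    ← integral_add (i4.const_mul ε) (i5.const_mul C)]
  refine integral_mono_ae (integrable_abs_rpow hα _) ((i4.const_mul ε).add (i5.const_mul C)) ?_
  filter_upwards [coeFn_convexCombo (1 / 2) (1 / 2) V V', Lp.coeFn_sub V V',
    (Lp.coeFn_nonneg V).2 hV, (Lp.coeFn_nonneg V').2 hV'] with t h1 h2 h3 h4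
  have := hCab (V t) (V' t) h3 h4
  rw [h2, h1, Pi.sub_apply, show 1 / 2 * V t + 1 / 2 * V' t = (V t + V' t) / 2 by ring]
  exact this

end PotentialSpace

end NLSS

end

noncomputable section

namespace NLSS

/-! ### Continuity, concavity, coercivity and the maximum of the dual functional. -/

section DualFunctional

variable {α : ℕ} {θ : Fin 3 → ℝ} {f : ℝ → ℝ} {Λ : ℝ}

lemma dualFunctional_eq (hα : α = 1 ∨ α = 2) {p : Potential α × ℝ} (hp : p ∈ dualDomain α) :
    dualFunctional α θ f Λ p = -((realExponent α)⁻¹ * ‖p.1‖ ^ realExponent α) -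
      realTrace θ f p.1 p.2 - p.2 * Λ := by
  have h1 : ((α : ℝ) / ((α : ℝ) + 1)) = (realExponent α)⁻¹ := by rw [realExponent, inv_div]
  rw [dualFunctional, ← integral_rpow hα hp, h1, neg_mul]
  rfl

lemma dualTrace_ne_top (hα : α = 1 ∨ α = 2) (hθ : ∀ j, 0 < θ j) (hf : CasimirClass f)
    {p : Potential α × ℝ} (hp : p ∈ dualDomain α) : dualTrace α θ f p ≠ ⊤ :=
  schrodingerTrace_ne_top hf hθ (isPotential hα hp) p.2

lemma isClosed_dualDomain : IsClosed (dualDomain α) :=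
  isClosed_nonneg.preimage continuous_fst

lemma convex_dualDomain : Convex ℝ (dualDomain α) := fun _ hp _ hp' _ _ hx hy _ =>
  convexCombo_nonneg hx hy hp hp'

/-- The one-sided Lipschitz constant depends only on a lower bound for the shift. The bound `p₀.2 -
1` is valid near `p₀` and allows both orders of the two points. -/
lemma continuousOn_realTrace (hα : α = 1 ∨ α = 2) (hθ : ∀ j, 0 < θ j) (hf : CasimirClass f) :
    ContinuousOn (fun p : Potential α × ℝ => realTrace θ f p.1 p.2) (dualDomain α) := by
  intro p₀ hp₀
  obtain ⟨B, hB0, hB⟩ := exists_realTrace_lipschitz hf hθ (p₀.2 - 1)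
  have hlim : Tendsto (fun p : Potential α × ℝ => B * (‖p.1 - p₀.1‖ + |p.2 - p₀.2|))
      (𝓝[dualDomain α] p₀) (𝓝 0) := by
    have : Continuous fun p : Potential α × ℝ => B * (‖p.1 - p₀.1‖ + |p.2 - p₀.2|) := by fun_prop
    have h := (this.tendsto p₀).mono_left (nhdsWithin_le_nhds (s := dualDomain α))
    simpa using h
  refine tendsto_iff_norm_sub_tendsto_zero.2 (squeeze_zero' (Eventually.of_forall fun _ =>
    norm_nonneg _) ?_ hlim)
  have hev : ∀ᶠ p in 𝓝[dualDomain α] p₀, p₀.2 - 1 < p.2 :=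
    nhdsWithin_le_nhds ((continuous_snd.tendsto p₀).eventually (lt_mem_nhds (sub_one_lt _)))
  filter_upwards [hev, self_mem_nhdsWithin] with p hp hpD
  have e1 := hB p.1 p₀.1 p.2 p₀.2 (isPotential hα hpD) (isPotential hα hp₀) hp.le
  have e2 := hB p₀.1 p.1 p₀.2 p.2 (isPotential hα hp₀) (isPotential hα hpD) (by linarith)
  have e3 := eLpNorm_sub_le hα p.1 p₀.1
  have e4 := eLpNorm_sub_le hα p₀.1 p.1
  rw [norm_sub_rev] at e3
  rw [abs_sub_comm] at e1
  rw [Real.norm_eq_abs, abs_le]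
  constructor <;> nlinarith

theorem continuousOn_dualFunctional (hα : α = 1 ∨ α = 2) (hθ : ∀ j, 0 < θ j)
    (hf : CasimirClass f) : ContinuousOn (dualFunctional α θ f Λ) (dualDomain α) := by
  have hq : 0 ≤ realExponent α := (zero_lt_one.trans (one_lt_realExponent hα)).le
  have h1 : Continuous fun p : Potential α × ℝ =>
      -((realExponent α)⁻¹ * ‖p.1‖ ^ realExponent α) :=
    (continuous_const.mul ((Real.continuous_rpow_const hq).comp continuous_fst.norm)).neg
  refine ((h1.continuousOn.sub (continuousOn_realTrace hα hθ hf)).sub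
    (continuous_snd.mul (continuous_const (y := Λ))).continuousOn).congr fun p hp => ?_
  exact dualFunctional_eq hα hp

theorem strictConcaveOn_dualFunctional (hα : α = 1 ∨ α = 2) (hθ : ∀ j, 0 < θ j)
    (hf : CasimirClass f) : StrictConcaveOn ℝ (dualDomain α) (dualFunctional α θ f Λ) := by
  refine ⟨convex_dualDomain, fun p hp p' hp' hne x y hx hy hxy => ?_⟩
  have hq : 0 < (realExponent α)⁻¹ := inv_pos.2 (zero_lt_one.trans (one_lt_realExponent hα))
  have hD := convex_dualDomain hp hp' hx.le hy.le hxy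
  rw [dualFunctional_eq hα hp, dualFunctional_eq hα hp', dualFunctional_eq hα hD]
  obtain ⟨h1, h2⟩ := integral_rpow_convexCombo hα hp hp' hx hy hxy
  have h3 := realTrace_convex hf hθ (isPotential hα hp) (isPotential hα hp') (isPotential hα hD)
    hx.le hy.le hxy (coeFn_convexCombo x y p.1 p'.1) p.2 p'.2
  simp only [Prod.fst_add, Prod.smul_fst, Prod.snd_add, Prod.smul_snd, smul_eq_mul] at h3 ⊢
  have h1' := mul_le_mul_of_nonneg_left h1 hq.le
  -- Strictness comes from the trace in the shift when the potentials agree, and from the power term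
  -- otherwise.
  by_cases hV : p.1 = p'.1
  · have hσ : p.2 ≠ p'.2 := fun h => hne (Prod.ext hV h)
    have h4 := realTrace_strictConvex hf hθ (isPotential hα hp) hx hy hxy hσ
    have h5 : x • p.1 + y • p'.1 = p.1 := by rw [← hV, ← add_smul, hxy, one_smul]
    rw [← hV] at h1' h5 ⊢
    rw [h5] at h1' ⊢
    linarith
  · have h2' := mul_lt_mul_of_pos_left (h2 hV) hq
    linarith

/-- The dual functional tends to `-∞` at least linearly. -/
theorem exists_le_neg_dualFunctional (hα : α = 1 ∨ α = 2) (hθ : ∀ j, 0 < θ j)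
    (hf : CasimirClass f) (hΛ : 0 < Λ) :
    ∃ C : ℝ, ∀ p ∈ dualDomain α, Λ * ‖p‖ - C ≤ -dualFunctional α θ f Λ p := by
  -- For `σ < 0` the tangent at `m` yields at least `2Λ|σ|`, which outweighs the term `σΛ` and
  -- leaves `Λ|σ|`. For `σ ≥ 0` the term `σΛ` and the positivity of the trace suffice.
  obtain ⟨m, hm⟩ := (hf.tendsto_atBot.eventually_ge_atTop (2 * Λ)).exists
  have hq := one_lt_realExponent hα
  have hc := Real.HolderConjugate.conjExponent hq
  set r := (realExponent α).conjExponent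
  set A := f m with hA
  have hA0 : 0 < A := hf.pos m
  refine ⟨(A + Λ) ^ r / r + A * |m|, fun p hp => ?_⟩
  -- Young's inequality extracts `(A + Λ)‖V‖` from the power term: `A‖V‖` pays for the tangent bound
  -- of the trace and `Λ‖V‖` is the growth to be proved.
  have hY := Real.young_inequality_of_nonneg (norm_nonneg p.1) (add_pos hA0 hΛ).le hc
  have hT := tangent_le_realTrace hf hθ (isPotential hα hp) p.2 m
  have hT0 : 0 ≤ realTrace θ f p.1 p.2 := ENNReal.toReal_nonneg
  have hi := mul_le_mul_of_nonneg_left (integral_le_norm p.1) hA0.le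
  have hF := hf.primitive_pos m
  have hm' := mul_le_mul_of_nonneg_left (neg_abs_le m) hA0.le
  have hm0 : 0 ≤ A * |m| := by positivity
  have hN : 0 ≤ ‖p.1‖ := norm_nonneg _
  have hAN : 0 ≤ A * ‖p.1‖ := by positivity
  have hp' : ‖p‖ ≤ ‖p.1‖ + |p.2| := by
    rw [Prod.norm_def, Real.norm_eq_abs]
    exact max_le_add_of_nonneg hN (abs_nonneg _)
  have hΛp := mul_le_mul_of_nonneg_left hp' hΛ.le
  rw [dualFunctional_eq hα hp, inv_mul_eq_div]
  rcases le_or_gt 0 p.2 with hs | hs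
  · rw [abs_of_nonneg hs] at hΛp
    nlinarith
  · rw [abs_of_neg hs] at hΛp
    nlinarith

theorem bddAbove_dualFunctional (hα : α = 1 ∨ α = 2) (hθ : ∀ j, 0 < θ j)
    (hf : CasimirClass f) (hΛ : 0 < Λ) :
    BddAbove (dualFunctional α θ f Λ '' dualDomain α) := by
  obtain ⟨C, hC⟩ := exists_le_neg_dualFunctional hα hθ hf hΛ
  refine ⟨C, ?_⟩
  rintro _ ⟨p, hp, rfl⟩
  have h1 := hC p hp
  have h2 : 0 ≤ Λ * ‖p‖ := by positivity
  linarith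

theorem tendsto_neg_dualFunctional (hα : α = 1 ∨ α = 2) (hθ : ∀ j, 0 < θ j)
    (hf : CasimirClass f) (hΛ : 0 < Λ) :
    Tendsto (fun p => -dualFunctional α θ f Λ p)
      (Bornology.cobounded (Potential α × ℝ) ⊓ 𝓟 (dualDomain α)) atTop := by
  obtain ⟨C, hC⟩ := exists_le_neg_dualFunctional hα hθ hf hΛ
  refine tendsto_atTop_mono' _ (f₁ := fun p => Λ * ‖p‖ - C) ?_ ?_
  · exact mem_inf_of_right (mem_principal.2 fun p hp => hC p hp)
  · exact (tendsto_atTop_add_const_right _ (-C)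
      (tendsto_norm_cobounded_atTop.const_mul_atTop hΛ)).mono_left inf_le_left

/-- The gap of the power is controlled by the defect of the dual functional. -/
lemma gap_le_of_dualFunctional_le (hα : α = 1 ∨ α = 2) (hθ : ∀ j, 0 < θ j)
    (hf : CasimirClass f) {M δ : ℝ} (hM : ∀ p ∈ dualDomain α, dualFunctional α θ f Λ p ≤ M)
    {p p' : Potential α × ℝ} (hp : p ∈ dualDomain α) (hp' : p' ∈ dualDomain α)
    (h : M - δ ≤ dualFunctional α θ f Λ p) (h' : M - δ ≤ dualFunctional α θ f Λ p') :
    (‖p.1‖ ^ realExponent α + ‖p'.1‖ ^ realExponent α) / 2 -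
      ‖(1 / 2 : ℝ) • p.1 + (1 / 2 : ℝ) • p'.1‖ ^ realExponent α ≤ realExponent α * δ := by
  have hq : 0 < realExponent α := zero_lt_one.trans (one_lt_realExponent hα)
  have hx : (0 : ℝ) ≤ 1 / 2 := by norm_num
  have hxy : (1 / 2 : ℝ) + 1 / 2 = 1 := by norm_num
  have hD := convex_dualDomain hp hp' hx hx hxy
  have h0 := hM _ hD
  have h3 := realTrace_convex hf hθ (isPotential hα hp) (isPotential hα hp') (isPotential hα hD)
    hx hx hxy (coeFn_convexCombo (1 / 2) (1 / 2) p.1 p'.1) p.2 p'.2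
  rw [dualFunctional_eq hα hp] at h
  rw [dualFunctional_eq hα hp'] at h'
  rw [dualFunctional_eq hα hD] at h0
  simp only [Prod.fst_add, Prod.smul_fst, Prod.snd_add, Prod.smul_snd, smul_eq_mul] at h0 h3
  have h4 : (realExponent α)⁻¹ * ((‖p.1‖ ^ realExponent α + ‖p'.1‖ ^ realExponent α) / 2 -
      ‖(1 / 2 : ℝ) • p.1 + (1 / 2 : ℝ) • p'.1‖ ^ realExponent α) ≤ δ := by linarith
  rwa [inv_mul_le_iff₀ hq] at h4

/-- The dual functional attains its maximum. -/
theorem exists_isMaxOn_dualFunctional (hα : α = 1 ∨ α = 2) (hθ : ∀ j, 0 < θ j)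
    (hf : CasimirClass f) (hΛ : 0 < Λ) :
    ∃ p ∈ dualDomain α, IsMaxOn (dualFunctional α θ f Λ) (dualDomain α) p := by
  have hq : 0 < realExponent α := zero_lt_one.trans (one_lt_realExponent hα)
  set Φ := dualFunctional α θ f Λ with hΦ
  have hbdd : BddAbove (Φ '' dualDomain α) := bddAbove_dualFunctional hα hθ hf hΛ
  have hne : (Φ '' dualDomain α).Nonempty := ⟨Φ 0, 0, le_refl (0 : Potential α), rfl⟩
  set M := sSup (Φ '' dualDomain α) with hM
  have hle : ∀ p ∈ dualDomain α, Φ p ≤ M := fun p hp => le_csSup hbdd ⟨p, hp, rfl⟩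
  obtain ⟨v, -, hv, hvm⟩ := exists_seq_tendsto_sSup hne hbdd
  choose p hp hpv using hvm
  have hlim : Tendsto (fun n => Φ (p n)) atTop (𝓝 M) := by simpa only [hpv] using hv
  obtain ⟨C, hC⟩ := exists_le_neg_dualFunctional hα hθ hf hΛ
  obtain ⟨m₀, hm₀⟩ := hlim.bddBelow_range
  set R := (C - m₀) / Λ with hR
  have hRn : ∀ n, ‖p n‖ ≤ R := fun n => by
    have h1 := hC (p n) (hp n)
    have h2 := hm₀ ⟨n, rfl⟩
    simp only at h2
    rw [hR, le_div_iff₀ hΛ]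
    linarith
  have hR1 : ∀ n, ‖(p n).1‖ ≤ R := fun n => (norm_fst_le _).trans (hRn n)
  have hR0 : 0 ≤ R := (norm_nonneg _).trans (hRn 0)
  have hcau : CauchySeq fun n => (p n).1 := by
    rw [Metric.cauchySeq_iff]
    intro η hη
    -- `ε` is small relative to the bound `R` and makes the first term of the uniform convexity
    -- estimate at most `η^q / 2`; `δ` makes the gap term at most `η^q / 4`. Together they stay
    -- strictly below `η^q`.
    set ε := η ^ realExponent α / 4 / (R ^ realExponent α + 1) with hε
    have hηq : 0 < η ^ realExponent α := Real.rpow_pos_of_pos hη _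
    have hRq : 0 ≤ R ^ realExponent α := Real.rpow_nonneg hR0 _
    obtain ⟨K, hK, hKV⟩ := exists_norm_sub_rpow_le hα (ε := ε) (by positivity)
    set δ := η ^ realExponent α / 4 / (K * realExponent α) with hδ
    have hδ0 : 0 < δ := by positivity
    obtain ⟨N, hN⟩ := eventually_atTop.1 (hlim.eventually (le_mem_nhds (sub_lt_self M hδ0)))
    refine ⟨N, fun n hn k hk => ?_⟩
    have h1 := gap_le_of_dualFunctional_le hα hθ hf hle (hp n) (hp k) (hN n hn) (hN k hk)
    have h2 := hKV (p n).1 (p k).1 (hp n) (hp k)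
    have h3 := Real.rpow_le_rpow (norm_nonneg _) (hR1 n) hq.le
    have h4 := Real.rpow_le_rpow (norm_nonneg _) (hR1 k) hq.le
    have h5 : ε * (‖(p n).1‖ ^ realExponent α + ‖(p k).1‖ ^ realExponent α) ≤
        η ^ realExponent α / 2 := by
      calc _ ≤ ε * (2 * (R ^ realExponent α + 1)) := by gcongr; linarith
        _ = _ := by rw [hε]; field_simp; ring
    have h6 : K * ((‖(p n).1‖ ^ realExponent α + ‖(p k).1‖ ^ realExponent α) / 2 -
        ‖(1 / 2 : ℝ) • (p n).1 + (1 / 2 : ℝ) • (p k).1‖ ^ realExponent α) ≤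
        η ^ realExponent α / 4 := by
      calc _ ≤ K * (realExponent α * δ) := by gcongr
        _ = _ := by rw [hδ]; field_simp
    rw [dist_eq_norm]
    refine lt_of_not_ge fun hge => ?_
    have h7 := Real.rpow_le_rpow hη.le hge hq.le
    linarith
  obtain ⟨V, hV⟩ := cauchySeq_tendsto_of_complete hcau
  -- The potentials already converge in norm, so only the shifts need a subsequence, and plain
  -- continuity of the functional identifies the limit value.
  obtain ⟨σ, -, φ, hφ, hσ⟩ := tendsto_subseq_of_bounded
    (Metric.isBounded_closedBall (x := (0 : ℝ)) (r := R)) (x := fun n => (p n).2) fun n => by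
      simpa using (norm_snd_le _).trans (hRn n)
  have hlim2 : Tendsto (fun n => p (φ n)) atTop (𝓝 (V, σ)) :=
    (hV.comp hφ.tendsto_atTop).prodMk_nhds hσ
  have hD : (V, σ) ∈ dualDomain α :=
    isClosed_dualDomain.mem_of_tendsto hlim2 (Eventually.of_forall fun n => hp _)
  refine ⟨(V, σ), hD, fun p' hp' => ?_⟩
  have h1 := (continuousOn_dualFunctional (Λ := Λ) hα hθ hf (V, σ) hD).tendsto.comp
    (tendsto_nhdsWithin_iff.2 ⟨hlim2, Eventually.of_forall fun n => hp _⟩)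
  have h2 := tendsto_nhds_unique h1 (hlim.comp hφ.tendsto_atTop)
  exact (hle p' hp').trans h2.ge

end DualFunctional

end NLSS

end

noncomputable section

namespace NLSS

/-! ### Integration against the density. -/

section Density

variable {θ : Fin 3 → ℝ}

lemma ae_summable_of_summable_integral_norm {F : ℕ → Torus3 → ℝ}
    (hF : ∀ k, Integrable (F k) torusMeasure)
    (hs : Summable fun k => ∫ x, ‖F k x‖ ∂torusMeasure) :
    (∀ᵐ x ∂torusMeasure, Summable fun k => F k x) ∧
      Integrable (fun x => ∑' k, F k x) torusMeasure := by
  have h0 : ∑' k, ∫⁻ x, ‖F k x‖ₑ ∂torusMeasure ≠ ⊤ := by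
    simp_rw [← fun k => ofReal_integral_norm_eq_lintegral_enorm (hF k)]
    rw [← ENNReal.ofReal_tsum_of_nonneg (fun k => integral_nonneg fun x => norm_nonneg _) hs]
    exact ENNReal.ofReal_ne_top
  have h1 : ∀ᵐ x ∂torusMeasure, Summable fun k => F k x := by
    filter_upwards [summable_norm_of_tsum_eLpNorm_ne_top le_rfl (fun k => (hF k).1)
      (by simpa only [eLpNorm_one_eq_lintegral_enorm] using h0)] with x hx
    exact hx.of_norm
  refine ⟨h1, ?_, ?_⟩
  · refine aestronglyMeasurable_of_tendsto_ae atTop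
      (f := fun n x => ∑ k ∈ Finset.range n, F k x) (fun n => ?_) ?_
    · exact Finset.aestronglyMeasurable_fun_sum _ fun k _ => (hF k).1
    · filter_upwards [h1] with x hx using hx.hasSum.tendsto_sum_nat
  · refine lt_of_le_of_lt (lintegral_mono fun x => enorm_tsum_le_tsum_enorm) ?_
    rw [lintegral_tsum fun k => (hF k).1.enorm]
    exact h0.lt_top

/-- Integration against the density of an occupied system in `H¹`. -/
theorem integral_mul_density (hθ : ∀ j, 0 < θ j) {u : ℕ → L2T} {lam : ℕ → ℝ}
    (hH : ∀ k, MemH1 θ (u k)) (hl : ∀ k, 0 ≤ lam k)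
    (hs : Summable fun k => lam k * h1NormSq θ (u k)) {W : Torus3 → ℝ}
    (hW : MemLp W (3 / 2) torusMeasure) :
    (∀ᵐ x ∂torusMeasure, Summable fun k => W x * (lam k * ‖u k x‖ ^ 2)) ∧
    Integrable (fun x => W x * ∑' k, lam k * ‖u k x‖ ^ 2) torusMeasure ∧
    HasSum (fun k => lam k * ∫ x, W x * ‖u k x‖ ^ 2 ∂torusMeasure)
      (∫ x, W x * ∑' k, lam k * ‖u k x‖ ^ 2 ∂torusMeasure) := by
  obtain ⟨C, -, hC⟩ := exists_integral_mul_norm_sq_le hθ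
  have e : ∀ k x, W x * (lam k * ‖u k x‖ ^ 2) = lam k * (W x * ‖u k x‖ ^ 2) := fun k x => by ring
  have hF : ∀ k, Integrable (fun x => W x * (lam k * ‖u k x‖ ^ 2)) torusMeasure := fun k => by
    simpa only [e] using (hC W hW (u k) (hH k)).1.const_mul (lam k)
  have hsum : Summable fun k => ∫ x, ‖W x * (lam k * ‖u k x‖ ^ 2)‖ ∂torusMeasure := by
    refine Summable.of_nonneg_of_le (fun k => integral_nonneg fun x => norm_nonneg _)
      (fun k => ?_) (hs.mul_left (C * (eLpNorm W (3 / 2) torusMeasure).toReal))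
    have h1 := mul_le_mul_of_nonneg_left (hC W hW (u k) (hH k)).2 (hl k)
    simp only [e, norm_mul, Real.norm_eq_abs, abs_pow, abs_norm, abs_of_nonneg (hl k)]
    rw [integral_const_mul]
    linarith
  obtain ⟨h1, h2⟩ := ae_summable_of_summable_integral_norm hF hsum
  refine ⟨h1, by simpa only [tsum_mul_left] using h2, ?_⟩
  have h3 := hasSum_integral_of_summable_integral_norm hF hsum
  simp only [tsum_mul_left] at h3
  refine HasSum.congr_fun h3 fun k => ?_
  rw [← integral_const_mul]
  exact integral_congr_ae (Eventually.of_forall fun x => (e k x).symm)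

end Density

/-! ### First order expansion of the trace. -/

section Expansion

variable {θ : Fin 3 → ℝ} {f : ℝ → ℝ} {V : Torus3 → ℝ} {u : ℕ → L2T} {a : ℕ → ℝ}

/-- Continuity of `f` and dominated convergence, with the sum at shift `σ - 1` as majorant for `δ <
1`. This sum multiplies the first order error in `tsum_perturbation_le`. -/
lemma IsEigensystem.exists_oscillation_le (hu : IsEigensystem θ V u a) (hf : CasimirClass f)
    (hθ : ∀ j, 0 < θ j) (hV : IsPotential V) (σ : ℝ) {ε : ℝ} (hε : 0 < ε) :
    ∃ δ : ℝ, 0 < δ ∧ ∑' k, (f (a k + σ - δ) - f (a k + σ + δ)) ≤ ε := by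
  have h1 : Tendsto (fun δ : ℝ => ∑' k, (f (a k + σ - δ) - f (a k + σ + δ))) (𝓝[>] 0)
      (𝓝 (∑' _ : ℕ, (0 : ℝ))) := by
    refine tendsto_tsum_of_dominated_convergence (bound := fun k => f (a k + (σ - 1)))
      (hu.summable_occupation hf hθ hV _) (fun k => ?_) ?_
    · have hc : Continuous fun δ : ℝ => f (a k + σ - δ) - f (a k + σ + δ) :=
        (hf.continuous.comp (continuous_const.sub continuous_id)).sub
          (hf.continuous.comp (continuous_const.add continuous_id))
      have := (hc.tendsto 0).mono_left (nhdsWithin_le_nhds (s := Ioi 0))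
      simpa using this
    · filter_upwards [Ioo_mem_nhdsGT (zero_lt_one' ℝ)] with δ hδ k
      have e1 := hf.strictAnti.antitone (show a k + σ - δ ≤ a k + σ + δ by linarith [hδ.1])
      have e2 := hf.strictAnti.antitone (show a k + (σ - 1) ≤ a k + σ - δ by linarith [hδ.2])
      have e3 := hf.pos (a k + σ + δ)
      rw [Real.norm_of_nonneg (by linarith)]
      linarith
  rw [tsum_zero] at h1
  obtain ⟨δ, h2, h3⟩ := ((h1.eventually (ge_mem_nhds hε)).and self_mem_nhdsWithin).exists
  exact ⟨δ, h3, h2⟩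

/-- First order expansion of the trace under bounded perturbations, as an upper bound. -/
theorem IsEigensystem.exists_realTrace_le (hu : IsEigensystem θ V u a) (hf : CasimirClass f)
    (hθ : ∀ j, 0 < θ j) (hV : IsPotential V) (σ : ℝ) {ε : ℝ} (hε : 0 < ε) :
    ∃ t₀ : ℝ, 0 < t₀ ∧ ∀ (V' : Torus3 → ℝ) (σ' t : ℝ), 0 < t → t ≤ t₀ → IsPotential V' →
      (∀ᵐ x ∂torusMeasure, |V' x - V x| ≤ t) → |σ' - σ| ≤ t →
      realTrace θ f V' σ' ≤ realTrace θ f V σ -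
        ∑' k, f (a k + σ) * (∫ x, (V' x - V x) * ‖u k x‖ ^ 2 ∂torusMeasure + (σ' - σ)) +
        ε * t := by
  obtain ⟨δ, hδ, hδs⟩ := hu.exists_oscillation_le hf hθ hV σ (ε := ε / 4) (by positivity)
  obtain ⟨B, hB0, hB⟩ := hf.exists_sum_bound hθ (σ - 1)
  have hBf : ∀ (V' : Torus3 → ℝ) (v : ℕ → L2T) (b : ℕ → ℝ) (s : ℝ), IsPotential V' →
      IsEigensystem θ V' v b → σ - 1 ≤ s → ∑' k, f (b k + s) ≤ B := fun V' v b s hV' hv hs => by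
    obtain ⟨-, h1, h2⟩ := hB V' v b s hV' hv hs
    refine ((hv.summable_occupation hf hθ hV' s).tsum_le_tsum (fun k => ?_) h1).trans h2
    nlinarith [hv.nonneg hθ hV' k, hf.pos (b k + s)]
  -- Potential and shift each change by at most `t`, so the perturbation has norm at most `2t`. The
  -- quadratic error is then at most `8Bt²/δ ≤ εt/2`, and the oscillation `ε/4` contributes `εt/2`.
  -- The bound `t ≤ 1` keeps both shifts above `σ - 1`, where `B` is valid.
  refine ⟨min 1 (ε * δ / (16 * B)), by positivity, fun V' σ' t ht htt hV' hVV hσσ => ?_⟩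
  obtain ⟨v, b, hv⟩ := exists_eigensystem hθ hV'
  obtain ⟨K, hK, hKx, hKuv⟩ := exists_perturbation_operator hθ hV hV' ht.le hVV
  set c : ℝ := σ' - σ with hc
  set K' : L2T →L[ℂ] L2T := K + (c : ℂ) • ContinuousLinearMap.id ℂ L2T with hK'
  have hK'n : ‖K'‖ ≤ 2 * t := by
    refine (norm_add_le _ _).trans ?_
    have h1 : ‖(c : ℂ) • ContinuousLinearMap.id ℂ L2T‖ ≤ t := by
      rw [norm_smul, Complex.norm_real, Real.norm_eq_abs]
      calc |c| * ‖ContinuousLinearMap.id ℂ L2T‖ ≤ |c| * 1 := by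
            gcongr
            exact ContinuousLinearMap.norm_id_le
        _ ≤ t := by rwa [mul_one]
    linarith
  have hKu : ∀ k, (inner ℂ (u k) (K' (u k))).re =
      ∫ x, (V' x - V x) * ‖u k x‖ ^ 2 ∂torusMeasure + c := fun k => by
    have h1 : inner ℂ (u k) (K (u k)) =
        ((∫ x, (V' x - V x) * ‖u k x‖ ^ 2 ∂torusMeasure : ℝ) : ℂ) := by
      rw [L2.inner_def, ← integral_complex_ofReal]
      refine integral_congr_ae ?_
      filter_upwards [hKx (u k)] with x hx
      rw [hx, RCLike.inner_apply, mul_assoc, RCLike.mul_conj]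
      push_cast
      rfl
    have h2 : inner ℂ (u k) (u k) = (1 : ℂ) := by
      rw [inner_self_eq_norm_sq_to_K, hu.1.1.1 k]
      simp
    rw [hK', add_apply, inner_add_right, h1, smul_apply,
      ContinuousLinearMap.id_apply, inner_smul_right, h2, mul_one, Complex.add_re,
      Complex.ofReal_re, Complex.ofReal_re]
  have hσ1 : σ - 1 ≤ σ' := by
    have := (abs_le.1 hσσ).1
    have := min_le_left 1 (ε * δ / (16 * B))
    linarith
  have hmain := tsum_perturbation_le (F := casimirPrimitive f) (f := f) hf.primitive_tangent
    (fun s => (hf.primitive_pos s).le) hf.strictAnti.antitone hf.pos hu.1.basis hv.1.basis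
    (a := fun k => a k + σ) (b := fun k => b k + σ') K' hδ (by positivity) hK'n
    (fun j k => by
      have h1 := hKuv (u j) (v k) (a j) (b k) (hu.2 j) (hv.2 k)
      simp only [IsCompleteOrthonormal.basis_apply]
      rw [hK', add_apply, inner_add_right, ← h1, smul_apply,
        ContinuousLinearMap.id_apply, inner_smul_right, hc]
      push_cast
      ring)
    (hu.summable_primitive hf hθ hV σ) (hv.summable_primitive hf hθ hV' σ')
    (hu.summable_occupation hf hθ hV σ) (hv.summable_occupation hf hθ hV' σ')
    (by simpa only [add_sub_assoc] using hu.summable_occupation hf hθ hV (σ - δ))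
  simp only [IsCompleteOrthonormal.basis_apply, hKu] at hmain
  rw [← hu.realTrace_eq hf hθ hV, ← hv.realTrace_eq hf hθ hV'] at hmain
  have h3 := hBf V u a σ hV hu (by linarith)
  have h4 := hBf V' v b σ' hV' hv hσ1
  have h5 : (2 * t) ^ 2 / δ * (∑' k, f (a k + σ) + ∑' k, f (b k + σ')) ≤ ε / 2 * t := by
    calc _ ≤ (2 * t) ^ 2 / δ * (B + B) := by gcongr
      _ = t * (8 * B / δ * t) := by ring
      _ ≤ t * (8 * B / δ * (ε * δ / (16 * B))) := by
          gcongr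
          exact htt.trans (min_le_right _ _)
      _ = ε / 2 * t := by field_simp; ring
  have h6 := mul_le_mul_of_nonneg_left hδs (show 0 ≤ 2 * t by positivity)
  linarith

end Expansion

end NLSS

end

noncomputable section

namespace NLSS

/-! ### Elementary inequalities for powers. -/

section PowerInequalities

/-- Young's inequality for `s` and `t^(q-1)`; unlike differentiation it treats `t = 0` on the same
footing. -/
lemma rpow_tangent_le {q : ℝ} (hq : 1 < q) {s t : ℝ} (hs : 0 ≤ s) (ht : 0 ≤ t) :
    t ^ q + q * t ^ (q - 1) * (s - t) ≤ s ^ q := by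
  have hq0 : 0 < q := by linarith
  have hc := Real.HolderConjugate.conjExponent hq
  have h1 := Real.young_inequality_of_nonneg hs (Real.rpow_nonneg ht (q - 1)) hc
  have h2 : (t ^ (q - 1)) ^ q.conjExponent = t ^ q := by
    rw [← Real.rpow_mul ht]
    congr 1
    rw [Real.conjExponent]
    field_simp [show q - 1 ≠ 0 by linarith]
  have h3 : q / q.conjExponent = q - 1 := by
    rw [Real.conjExponent]
    field_simp
  have h4 : t ^ (q - 1) * t = t ^ q := by
    rcases ht.eq_or_lt with rfl | ht0
    · rw [mul_zero, Real.zero_rpow hq0.ne']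
    · rw [← Real.rpow_add_one ht0.ne', sub_add_cancel]
  rw [h2] at h1
  have h5 := mul_le_mul_of_nonneg_left h1 hq0.le
  rw [mul_add, mul_div_cancel₀ _ hq0.ne', mul_div_left_comm, h3] at h5
  nlinarith

/-- Subadditivity of `x ↦ x^r` for exponents in `[0, 1]`. -/
lemma rpow_sub_rpow_le {r : ℝ} (hr : 0 ≤ r) (hr1 : r ≤ 1) {s t d : ℝ} (hs : 0 ≤ s) (ht : 0 ≤ t)
    (h : |s - t| ≤ d) : |s ^ r - t ^ r| ≤ d ^ r := by
  have key : ∀ s t : ℝ, 0 ≤ t → |s - t| ≤ d → 0 ≤ s → s ^ r - t ^ r ≤ d ^ r :=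
    fun s t ht h hs => by
      have h1 := Real.rpow_add_le_add_rpow ht ((abs_nonneg _).trans h) hr hr1
      have h2 : s ^ r ≤ (t + d) ^ r :=
        Real.rpow_le_rpow hs (by linarith [le_abs_self (s - t)]) hr
      linarith
  have h1 := key s t ht h hs
  have h2 := key t s hs (by rwa [abs_sub_comm]) ht
  exact abs_le.2 ⟨by linarith, h1⟩

end PowerInequalities

/-! ### The Euler–Lagrange equations. -/

section EulerLagrange

variable {α : ℕ} {θ : Fin 3 → ℝ} {f : ℝ → ℝ} {Λ : ℝ}

lemma integrable_rpow_inv (hα : α = 1 ∨ α = 2) {V : Potential α} (hV : 0 ≤ V) :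
    Integrable (fun x => V x ^ (1 / (α : ℝ))) torusMeasure := by
  have hα0 : (0 : ℝ) ≤ 1 / (α : ℝ) := by positivity
  have hα1 : 1 / (α : ℝ) ≤ realExponent α := by
    have := realExponent_sub_one hα
    linarith
  refine ((integrable_const (1 : ℝ)).add (integrable_rpow hα hV)).mono'
    ((Real.continuous_rpow_const hα0).comp_aestronglyMeasurable (Lp.aestronglyMeasurable V)) ?_
  filter_upwards [(Lp.coeFn_nonneg V).2 hV] with x hx
  have hx : 0 ≤ V x := hx
  rw [Real.norm_of_nonneg (Real.rpow_nonneg hx _), Pi.add_apply]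
  rcases le_total (V x) 1 with h | h
  · have h1 := Real.rpow_le_one hx h hα0
    have h2 := Real.rpow_nonneg hx (realExponent α)
    linarith
  · have h1 := Real.rpow_le_rpow_of_exponent_le h hα1
    linarith

/-- The first order condition for the potential. -/
lemma integral_mul_sub_nonpos (hα : α = 1 ∨ α = 2) (hθ : ∀ j, 0 < θ j) (hf : CasimirClass f)
    {V : Potential α} {σ : ℝ} (hV : 0 ≤ V)
    (hmax : IsMaxOn (dualFunctional α θ f Λ) (dualDomain α) (V, σ))
    {u : ℕ → L2T} {a : ℕ → ℝ} (hu : IsEigensystem θ V u a) {W : Torus3 → ℝ}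
    (hWm : AEStronglyMeasurable W torusMeasure) (hW1 : ∀ x, |W x| ≤ 1) {t₁ : ℝ} (ht₁ : 0 < t₁)
    (hWt : ∀ᵐ x ∂torusMeasure, ∀ t, 0 < t → t ≤ t₁ → 0 ≤ V x + t * W x) :
    ∫ x, W x * (∑' k, f (a k + σ) * ‖u k x‖ ^ 2) ∂torusMeasure ≤
      ∫ x, W x * V x ^ (1 / (α : ℝ)) ∂torusMeasure := by
  have hP := isPotential hα hV
  have hα0 : α ≠ 0 := by rcases hα with rfl | rfl <;> norm_num
  have hr0 : (0 : ℝ) ≤ 1 / (α : ℝ) := by positivity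
  have hr1 : 1 / (α : ℝ) ≤ 1 := by rcases hα with rfl | rfl <;> norm_num
  have hq := one_lt_realExponent hα
  have hq0 : 0 < realExponent α := by linarith
  have hWp : ∀ p, MemLp W p torusMeasure := fun p =>
    MemLp.of_bound hWm 1 (Eventually.of_forall hW1)
  have hs : Summable fun k => f (a k + σ) * h1NormSq θ (u k) :=
    Summable.of_nonneg_of_le (fun k => mul_nonneg (hf.pos _).le (h1NormSq_nonneg hθ _))
      (fun k => mul_le_mul_of_nonneg_left (hu.h1NormSq_le hθ hP k) (hf.pos _).le)
      (hu.summable_occupation_mul hf hθ hP σ)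
  obtain ⟨-, -, hsum⟩ := integral_mul_density hθ (fun k => (hu.2 k).1.1) (fun k => (hf.pos _).le)
    hs (hWp _)
  set I := ∫ x, W x * (∑' k, f (a k + σ) * ‖u k x‖ ^ 2) ∂torusMeasure with hI
  set J := ∫ x, W x * V x ^ (1 / (α : ℝ)) ∂torusMeasure with hJ
  by_contra! hIJ
  -- One error `ε t` comes from the trace and one from the power term, so maximality gives `t (I -
  -- J) ≤ 2 ε t`, half of the assumed gap. The condition `t ≤ ε^α` below controls the variation of
  -- `V^(1/α)`, which is Hölder continuous of order `1/α`.
  set ε := (I - J) / 4 with hε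
  have hε0 : 0 < ε := by rw [hε]; linarith
  obtain ⟨t₂, ht₂, hexp⟩ := hu.exists_realTrace_le hf hθ hP σ hε0
  set t := min (min t₁ t₂) (ε ^ α) with ht
  have ht0 : 0 < t := by positivity
  have htr : t ^ (1 / (α : ℝ)) ≤ ε := by
    calc t ^ (1 / (α : ℝ)) ≤ (ε ^ α) ^ (1 / (α : ℝ)) :=
          Real.rpow_le_rpow ht0.le (min_le_right _ _) hr0
      _ = ε := by rw [one_div, Real.pow_rpow_inv_natCast hε0.le hα0]
  set V' : Potential α := V + t • (hWp (potentialExponent α)).toLp W with hV'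
  have hV'x : ∀ᵐ x ∂torusMeasure, V' x = V x + t * W x := by
    filter_upwards [Lp.coeFn_add V (t • (hWp (potentialExponent α)).toLp W),
      Lp.coeFn_smul t ((hWp (potentialExponent α)).toLp W),
      (hWp (potentialExponent α)).coeFn_toLp] with x h1 h2 h3
    rw [hV', h1, Pi.add_apply, h2, Pi.smul_apply, h3, smul_eq_mul]
  have hV'0 : 0 ≤ V' := by
    rw [← Lp.coeFn_nonneg]
    filter_upwards [hV'x, hWt] with x h1 h2
    rw [h1]
    exact h2 t ht0 ((min_le_left _ _).trans (min_le_left _ _))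
  have hd : ∀ᵐ x ∂torusMeasure, |V' x - V x| ≤ t := by
    filter_upwards [hV'x] with x h1
    rw [h1, add_sub_cancel_left, abs_mul, abs_of_pos ht0]
    exact mul_le_of_le_one_right ht0.le (hW1 x)
  have hT := hexp V' σ t ht0 ((min_le_left _ _).trans (min_le_right _ _)) (isPotential hα hV'0) hd
    (by simpa using ht0.le)
  have hlin : ∑' k, f (a k + σ) * (∫ x, (V' x - V x) * ‖u k x‖ ^ 2 ∂torusMeasure + (σ - σ)) =
      t * I := by
    rw [← hsum.tsum_eq, ← tsum_mul_left]
    refine tsum_congr fun k => ?_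
    have h : ∫ x, (V' x - V x) * ‖u k x‖ ^ 2 ∂torusMeasure =
        t * ∫ x, W x * ‖u k x‖ ^ 2 ∂torusMeasure := by
      rw [← integral_const_mul]
      refine integral_congr_ae ?_
      filter_upwards [hV'x] with x h1
      rw [h1]
      ring
    rw [h]
    ring
  rw [hlin] at hT
  have hiJ : Integrable (fun x => W x * V x ^ (1 / (α : ℝ))) torusMeasure := by
    refine (integrable_rpow_inv hα hV).norm.mono'
      (hWm.mul (integrable_rpow_inv hα hV).aestronglyMeasurable) (Eventually.of_forall fun x => ?_)
    rw [norm_mul]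
    exact mul_le_of_le_one_left (norm_nonneg _) (hW1 x)
  have hint : ‖V'‖ ^ realExponent α ≤
      ‖V‖ ^ realExponent α + realExponent α * (t * J + t * ε) := by
    have hi1 := integrable_rpow hα hV
    have hi2 : Integrable (fun x => realExponent α * (t * (W x * V x ^ (1 / (α : ℝ))) + t * ε))
        torusMeasure := ((hiJ.const_mul t).add (integrable_const _)).const_mul _
    have e1 : realExponent α * (t * J + t * ε) =
        ∫ x, realExponent α * (t * (W x * V x ^ (1 / (α : ℝ))) + t * ε) ∂torusMeasure := by
      rw [integral_const_mul, integral_add (hiJ.const_mul t) (integrable_const _),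
        integral_const_mul, integral_const, probReal_univ, one_smul]
    rw [e1, ← integral_rpow hα hV'0, ← integral_rpow hα hV, ← integral_add hi1 hi2]
    refine integral_mono_ae (integrable_rpow hα hV'0) (hi1.add hi2) ?_
    filter_upwards [hV'x, hd, (Lp.coeFn_nonneg V).2 hV, (Lp.coeFn_nonneg V').2 hV'0]
      with x h1 h2 h3 h4
    -- The tangent is taken at the new potential `V'`, because an upper bound for its power is
    -- wanted.
    have h5 := rpow_tangent_le hq (s := V x) (t := V' x) h3 h4
    rw [realExponent_sub_one hα] at h5
    have h6 := (rpow_sub_rpow_le hr0 hr1 (s := V' x) (t := V x) h4 h3 h2).trans htr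
    have h7 : W x * (V' x ^ (1 / (α : ℝ)) - V x ^ (1 / (α : ℝ))) ≤ ε := by
      refine (le_abs_self _).trans ?_
      rw [abs_mul]
      exact (mul_le_of_le_one_left (abs_nonneg _) (hW1 x)).trans h6
    have h8 : V x - V' x = -(t * W x) := by rw [h1]; ring
    rw [h8] at h5
    have h9 := mul_le_mul_of_nonneg_left h7 (mul_pos hq0 ht0).le
    linarith
  have hle : dualFunctional α θ f Λ (V', σ) ≤ dualFunctional α θ f Λ (V, σ) := hmax hV'0
  rw [dualFunctional_eq hα (p := (V, σ)) hV, dualFunctional_eq hα (p := (V', σ)) hV'0] at hle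
  have hint' := mul_le_mul_of_nonneg_left hint (inv_pos.2 hq0).le
  rw [mul_add, inv_mul_cancel_left₀ hq0.ne'] at hint'
  simp only at hle
  have hfin : t * (I - J) ≤ t * (2 * ε) := by linarith
  have := le_of_mul_le_mul_left hfin ht0
  linarith

/-- The Euler–Lagrange equation for the potential. -/
theorem density_eq_of_isMaxOn (hα : α = 1 ∨ α = 2) (hθ : ∀ j, 0 < θ j) (hf : CasimirClass f)
    {V : Potential α} {σ : ℝ} (hV : 0 ≤ V)
    (hmax : IsMaxOn (dualFunctional α θ f Λ) (dualDomain α) (V, σ))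
    {u : ℕ → L2T} {a : ℕ → ℝ} (hu : IsEigensystem θ V u a) :
    (∀ᵐ x ∂torusMeasure, Summable fun k => f (a k + σ) * ‖u k x‖ ^ 2) ∧
    ∀ᵐ x ∂torusMeasure, ∑' k, f (a k + σ) * ‖u k x‖ ^ 2 = V x ^ (1 / (α : ℝ)) := by
  have hP := isPotential hα hV
  have hs : Summable fun k => f (a k + σ) * h1NormSq θ (u k) :=
    Summable.of_nonneg_of_le (fun k => mul_nonneg (hf.pos _).le (h1NormSq_nonneg hθ _))
      (fun k => mul_le_mul_of_nonneg_left (hu.h1NormSq_le hθ hP k) (hf.pos _).le)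
      (hu.summable_occupation_mul hf hθ hP σ)
  obtain ⟨hsm, hρi, -⟩ := integral_mul_density hθ (fun k => (hu.2 k).1.1)
    (fun k => (hf.pos _).le) hs (memLp_const (1 : ℝ))
  simp only [one_mul] at hsm hρi
  refine ⟨hsm, ?_⟩
  set ρ : Torus3 → ℝ := fun x => ∑' k, f (a k + σ) * ‖u k x‖ ^ 2 with hρ
  have hρ0 : ∀ x, 0 ≤ ρ x := fun x => tsum_nonneg fun k =>
    mul_nonneg (hf.pos _).le (by positivity)
  have hri := integrable_rpow_inv hα hV
  set r : Torus3 → ℝ := fun x => V x ^ (1 / (α : ℝ)) with hr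
  set D : Torus3 → ℝ := fun x => ρ x - r x with hD
  have hDi : Integrable D torusMeasure := hρi.sub hri
  -- An admissible direction `W` whose sign agrees with that of the defect `D = ρ - V^(1/α)`
  -- satisfies `∫ W D ≤ 0` with `W D ≥ 0`, so the product vanishes.
  have key : ∀ W : Torus3 → ℝ, AEStronglyMeasurable W torusMeasure → (∀ x, |W x| ≤ 1) →
      (∃ t₁ : ℝ, 0 < t₁ ∧ ∀ᵐ x ∂torusMeasure, ∀ t, 0 < t → t ≤ t₁ → 0 ≤ V x + t * W x) →
      (∀ᵐ x ∂torusMeasure, 0 ≤ W x * D x) → ∀ᵐ x ∂torusMeasure, W x * D x = 0 := by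
    rintro W hWm hW1 ⟨t₁, ht₁, hWt⟩ hWD
    have h1 := integral_mul_sub_nonpos hα hθ hf hV hmax hu hWm hW1 ht₁ hWt
    have hi : ∀ g : Torus3 → ℝ, Integrable g torusMeasure →
        Integrable (fun x => W x * g x) torusMeasure := fun g hg =>
      hg.norm.mono' (hWm.mul hg.aestronglyMeasurable) (Eventually.of_forall fun x => by
        rw [norm_mul]
        exact mul_le_of_le_one_left (norm_nonneg _) (hW1 x))
    have h2 : ∫ x, W x * D x ∂torusMeasure =
        ∫ x, W x * ρ x ∂torusMeasure - ∫ x, W x * r x ∂torusMeasure := by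
      rw [← integral_sub (hi ρ hρi) (hi r hri)]
      simp only [hD, mul_sub]
    have h3 : ∫ x, W x * D x ∂torusMeasure = 0 :=
      le_antisymm (by rw [h2]; linarith) (integral_nonneg_of_ae hWD)
    exact (integral_eq_zero_iff_of_nonneg_ae hWD (hi D hDi)).1 h3
  have hDm : AEMeasurable D torusMeasure := hDi.aestronglyMeasurable.aemeasurable
  have hVm : AEMeasurable V torusMeasure := (Lp.aestronglyMeasurable V).aemeasurable
  -- Direction: the indicator of `{D > 0}`. Increasing `V` is always admissible.
  have h1 : ∀ᵐ x ∂torusMeasure, D x ≤ 0 := by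
    have hm : AEStronglyMeasurable (fun x => (Ioi (0 : ℝ)).indicator (1 : ℝ → ℝ) (D x))
        torusMeasure :=
      ((measurable_one.indicator measurableSet_Ioi).comp_aemeasurable hDm).aestronglyMeasurable
    have := key _ hm (fun x => by by_cases h : D x ∈ Ioi (0 : ℝ) <;> simp [h])
      ⟨1, one_pos, by
        filter_upwards [(Lp.coeFn_nonneg V).2 hV] with x hx t ht _
        exact add_nonneg hx (mul_nonneg ht.le (indicator_nonneg (fun _ _ => zero_le_one) _))⟩
      (Eventually.of_forall fun x => by
        by_cases h : D x ∈ Ioi (0 : ℝ)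
        · simpa [h] using (mem_Ioi.1 h).le
        · simp [h])
    filter_upwards [this] with x hx
    by_contra! h
    rw [indicator_of_mem (mem_Ioi.2 h), Pi.one_apply, one_mul] at hx
    exact h.ne' hx
  -- Direction: minus the indicator of `{D < 0, V ≥ δ}`, admissible for `t ≤ δ`. The values `δ =
  -- 1/(n + 1)` exhaust `{V > 0}`.
  have h2 : ∀ᵐ x ∂torusMeasure, ∀ n : ℕ, 1 / ((n : ℝ) + 1) ≤ V x → 0 ≤ D x := by
    rw [ae_all_iff]
    intro n
    set δ : ℝ := 1 / ((n : ℝ) + 1) with hδ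
    have hδ0 : 0 < δ := by positivity
    have hm : AEStronglyMeasurable
        (fun x => (Iio (0 : ℝ) ×ˢ Ici δ).indicator (-1 : ℝ × ℝ → ℝ) (D x, V x)) torusMeasure :=
      ((measurable_one.neg.indicator (measurableSet_Iio.prod measurableSet_Ici)).comp_aemeasurable
        (hDm.prodMk hVm)).aestronglyMeasurable
    have := key _ hm (fun x => by
        by_cases h : (D x, V x) ∈ Iio (0 : ℝ) ×ˢ Ici δ
        · rw [indicator_of_mem h]; simp
        · rw [indicator_of_notMem h]; simp)
      ⟨δ, hδ0, by
        filter_upwards [(Lp.coeFn_nonneg V).2 hV] with x hx t ht htδ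
        by_cases h : (D x, V x) ∈ Iio (0 : ℝ) ×ˢ Ici δ
        · rw [indicator_of_mem h]
          have : δ ≤ V x := h.2
          simp only [Pi.neg_apply, Pi.one_apply]
          linarith
        · rw [indicator_of_notMem h]
          simpa using hx⟩
      (Eventually.of_forall fun x => by
        by_cases h : (D x, V x) ∈ Iio (0 : ℝ) ×ˢ Ici δ
        · rw [indicator_of_mem h]
          have : D x < 0 := h.1
          simp only [Pi.neg_apply, Pi.one_apply]
          linarith
        · rw [indicator_of_notMem h, zero_mul])
    filter_upwards [this] with x hx hδx
    by_contra! h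
    rw [indicator_of_mem (show (D x, V x) ∈ Iio (0 : ℝ) ×ˢ Ici δ from ⟨h, hδx⟩)] at hx
    simp only [Pi.neg_apply, Pi.one_apply] at hx
    linarith
  filter_upwards [h1, h2, (Lp.coeFn_nonneg V).2 hV] with x e1 e2 e3
  have e3 : 0 ≤ V x := e3
  rcases e3.eq_or_lt with h0 | h0
  · have hr0 : r x = 0 := by
      simp only [hr]
      rw [← h0, Real.zero_rpow]
      rcases hα with rfl | rfl <;> norm_num
    have : ρ x - r x ≤ 0 := e1
    exact le_antisymm (by linarith) (hr0.trans_le (hρ0 x))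
  · obtain ⟨n, hn⟩ := exists_nat_one_div_lt h0
    have e4 : ρ x - r x ≤ 0 := e1
    have e5 : 0 ≤ ρ x - r x := e2 n hn.le
    exact le_antisymm (by linarith) (by linarith)

/-- The Euler–Lagrange equation for the multiplier. -/
theorem hasSum_occupation_of_isMaxOn (hα : α = 1 ∨ α = 2) (hθ : ∀ j, 0 < θ j)
    (hf : CasimirClass f) {V : Potential α} {σ : ℝ} (hV : 0 ≤ V)
    (hmax : IsMaxOn (dualFunctional α θ f Λ) (dualDomain α) (V, σ))
    {u : ℕ → L2T} {a : ℕ → ℝ} (hu : IsEigensystem θ V u a) :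
    HasSum (fun k => f (a k + σ)) Λ := by
  have hP := isPotential hα hV
  have hs := hu.summable_occupation hf hθ hP σ
  convert hs.hasSum using 1
  set L := ∑' k, f (a k + σ) with hL
  have key : ∀ ε : ℝ, 0 < ε → |L - Λ| ≤ ε := fun ε hε => by
    obtain ⟨t, ht, hexp⟩ := hu.exists_realTrace_le hf hθ hP σ hε
    -- The shift is unconstrained, so both signs of `s` are available and the inequality becomes an
    -- equation in the limit.
    have h1 : ∀ s : ℝ, |s| = t → s * (L - Λ) ≤ ε * t := fun s hs => by
      have h2 := hexp V (σ + s) t ht le_rfl hP (by simpa using ht.le)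
        (by rw [add_sub_cancel_left, hs])
      simp only [sub_self, zero_mul, integral_zero, zero_add, add_sub_cancel_left] at h2
      rw [tsum_mul_right] at h2
      have h3 : dualFunctional α θ f Λ (V, σ + s) ≤ dualFunctional α θ f Λ (V, σ) := hmax hV
      rw [dualFunctional_eq hα (p := (V, σ)) hV, dualFunctional_eq hα (p := (V, σ + s)) hV] at h3
      simp only at h3
      linarith
    have h2 := h1 t (abs_of_pos ht)
    have h3 := h1 (-t) (by rw [abs_neg, abs_of_pos ht])
    rw [mul_comm] at h2
    exact abs_le.2 ⟨by nlinarith, le_of_mul_le_mul_right h2 ht⟩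
  have := le_of_forall_pos_le_add (a := |L - Λ|) (b := 0) fun ε hε => by simpa using key ε hε
  exact (sub_eq_zero.1 (abs_eq_zero.1 (le_antisymm this (abs_nonneg _)))).symm

end EulerLagrange

end NLSS

end

noncomputable section

namespace NLSS

/-! ### Dependence of eigensystems on the potential. -/

section Eigensystems

variable {θ : Fin 3 → ℝ}

lemma memFormDomain_congr {V V' : Torus3 → ℝ} (h : V =ᵐ[torusMeasure] V') (u : L2T) :
    MemFormDomain θ V u ↔ MemFormDomain θ V' u := by
  refine and_congr_right fun _ => integrable_congr ?_
  filter_upwards [h] with x hx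
  rw [hx]

lemma mapsTo_congr {V V' : Torus3 → ℝ} (h : V =ᵐ[torusMeasure] V') (u w : L2T) :
    SchrodingerMapsTo θ V u w ↔ SchrodingerMapsTo θ V' u w := by
  have h1 : ∀ φ, schrodingerForm θ V φ u = schrodingerForm θ V' φ u := fun φ => by
    unfold schrodingerForm
    congr 1
    refine integral_congr_ae ?_
    filter_upwards [h] with x hx
    rw [hx]
  simp only [SchrodingerMapsTo, memFormDomain_congr h, h1]

lemma IsEigensystem.card_eq_finrank (hθ : ∀ j, 0 < θ j) {V : Torus3 → ℝ} (hV : IsPotential V)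
    {u : ℕ → L2T} {a : ℕ → ℝ} (hu : IsEigensystem θ V u a) (m : ℝ) :
    Finite {k // a k = m} ∧
      Nat.card {k // a k = m} = Module.finrank ℂ (schrodingerEigenspace θ V m) := by
  have hfin : Finite {k // a k = m} := (hu.finite_multiplicity hθ hV m).to_subtype
  refine ⟨hfin, ?_⟩
  have := Fintype.ofFinite {k // a k = m}
  have hli : LinearIndependent ℂ fun k : {k // a k = m} => u k :=
    (hu.1.1.comp _ Subtype.val_injective).linearIndependent
  rw [hu.eigenspace_eq hθ hV, Set.image_eq_range, Nat.card_eq_fintype_card]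
  exact (finrank_span_eq_card hli).symm

/-- The eigenvalues are unique up to renumbering. -/
theorem IsEigensystem.exists_perm (hθ : ∀ j, 0 < θ j) {V : Torus3 → ℝ} (hV : IsPotential V)
    {u u' : ℕ → L2T} {a a' : ℕ → ℝ} (hu : IsEigensystem θ V u a)
    (hu' : IsEigensystem θ V u' a') : ∃ e : Equiv.Perm ℕ, ∀ k, a k = a' (e k) := by
  have h : ∀ m, Nonempty ({k // a k = m} ≃ {k // a' k = m}) := fun m => by
    obtain ⟨h1, h2⟩ := hu.card_eq_finrank hθ hV m
    obtain ⟨h3, h4⟩ := hu'.card_eq_finrank hθ hV m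
    exact Finite.card_eq.1 (h2.trans h4.symm)
  exact ⟨Equiv.ofFiberEquiv fun m => (h m).some, fun k => (Equiv.ofFiberEquiv_map _ k).symm⟩

end Eigensystems

/-! ### Stationary states and maximizers. -/

section Stationary

variable {α : ℕ} {θ : Fin 3 → ℝ} {f : ℝ → ℝ} {Λ : ℝ}

/-- A maximizer of the dual functional gives a stationary state. -/
theorem isStationaryState_of_isMaxOn (hα : α = 1 ∨ α = 2) (hθ : ∀ j, 0 < θ j)
    (hf : CasimirClass f) {V : Potential α} {σ : ℝ} (hV : 0 ≤ V)
    (hmax : IsMaxOn (dualFunctional α θ f Λ) (dualDomain α) (V, σ))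
    {u : ℕ → L2T} {a lam : ℕ → ℝ} {ρ : Torus3 → ℝ} (hu : IsEigensystem θ V u a)
    (hlam : ∀ k, lam k = f (a k + σ)) (hρ : ∀ x, ρ x = ∑' k, lam k * ‖u k x‖ ^ 2) :
    HasSum lam Λ ∧ (∀ᵐ x ∂torusMeasure, V x = ρ x ^ α) ∧
      IsStationaryState α θ (fun s => f (s + σ)) u lam a ρ := by
  obtain rfl : lam = fun k => f (a k + σ) := funext hlam
  obtain rfl : ρ = fun x => ∑' k, f (a k + σ) * ‖u k x‖ ^ 2 := funext hρ
  have hα0 : α ≠ 0 := by rcases hα with rfl | rfl <;> norm_num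
  have hP := isPotential hα hV
  have hsum := hasSum_occupation_of_isMaxOn hα hθ hf hV hmax hu
  obtain ⟨hsm, hd⟩ := density_eq_of_isMaxOn hα hθ hf hV hmax hu
  have hVρ : ∀ᵐ x ∂torusMeasure, V x = (∑' k, f (a k + σ) * ‖u k x‖ ^ 2) ^ α := by
    filter_upwards [hd, (Lp.coeFn_nonneg V).2 hV] with x h1 h2
    rw [h1, one_div, Real.rpow_inv_natCast_pow h2 hα0]
  refine ⟨hsum, hVρ, hf.shift σ, ⟨hu.1, fun k => (hu.2 k).1.1, fun k => (hf.pos _).le,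
    hsum.summable, ?_⟩, ?_, fun k => (mapsTo_congr hVρ _ _).1 (hu.2 k), ?_, fun k => rfl⟩
  · exact Summable.of_nonneg_of_le (fun k => mul_nonneg (hf.pos _).le (h1NormSq_nonneg hθ _))
      (fun k => mul_le_mul_of_nonneg_left (hu.h1NormSq_le hθ hP k) (hf.pos _).le)
      (hu.summable_occupation_mul hf hθ hP σ)
  · have hm : AEStronglyMeasurable (fun x => ∑' k, f (a k + σ) * ‖u k x‖ ^ 2) torusMeasure :=
      ((integrable_rpow_inv hα hV).aestronglyMeasurable).congr (hd.mono fun _ h => h.symm)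
    rw [← integrable_norm_rpow_iff hm (by simp) (by finiteness)]
    -- Since `ρ = V^(1/α)`, the power `ρ^(α+1)` is `V^q`.
    refine (integrable_rpow hα hV).congr ?_
    filter_upwards [hd, (Lp.coeFn_nonneg V).2 hV] with x h1 h2
    have h2 : 0 ≤ V x := h2
    rw [h1, Real.norm_of_nonneg (Real.rpow_nonneg h2 _), ← Real.rpow_mul h2,
      ENNReal.toReal_add (by simp) (by simp), realExponent]
    congr 1
    simp only [ENNReal.toReal_natCast, ENNReal.toReal_one]
    ring
  · filter_upwards [hsm] with x hx using hx.hasSum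

/-- A stationary state gives a maximizer of the dual functional. -/
theorem IsStationaryState.exists_isMaxOn (hα : α = 1 ∨ α = 2) (hθ : ∀ j, 0 < θ j)
    (hf : CasimirClass f) {σ : ℝ} {u : ℕ → L2T} {lam μ : ℕ → ℝ} {ρ : Torus3 → ℝ}
    (h : IsStationaryState α θ (fun s => f (s + σ)) u lam μ ρ) (hsum : HasSum lam Λ) :
    ∃ V : Potential α, 0 ≤ V ∧ (∀ᵐ x ∂torusMeasure, V x = ρ x ^ α) ∧
      IsEigensystem θ V u μ ∧ IsMaxOn (dualFunctional α θ f Λ) (dualDomain α) (V, σ) := by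
  have hα0 : α ≠ 0 := by rcases hα with rfl | rfl <;> norm_num
  have hαR : (α : ℝ) ≠ 0 := Nat.cast_ne_zero.2 hα0
  have hq := one_lt_realExponent hα
  have hq0 : 0 < realExponent α := by linarith
  have hρ0 : ∀ᵐ x ∂torusMeasure, 0 ≤ ρ x := by
    filter_upwards [h.density] with x hx
    exact hx.nonneg fun k => mul_nonneg (h.memStateSpace.nonneg k) (by positivity)
  have hVL : MemLp (fun x => ρ x ^ α) (potentialExponent α) torusMeasure := by
    have hm : AEStronglyMeasurable (fun x => ρ x ^ α) torusMeasure := h.memLp.1.pow α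
    rw [← integrable_norm_rpow_iff hm (potentialExponent_ne_zero α)
      (potentialExponent_ne_top hα)]
    refine (h.memLp.integrable_norm_rpow (by simp) (by finiteness)).congr ?_
    refine Eventually.of_forall fun x => ?_
    simp only
    rw [potentialExponent_toReal, norm_pow, ← Real.rpow_natCast, ← Real.rpow_mul (norm_nonneg _),
      ENNReal.toReal_add (by simp) (by simp), realExponent, mul_div_cancel₀ _ hαR]
    simp
  set V : Potential α := hVL.toLp with hVdef
  have hVx : ∀ᵐ x ∂torusMeasure, V x = ρ x ^ α := hVL.coeFn_toLp
  have hV : 0 ≤ V := by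
    rw [← Lp.coeFn_nonneg]
    filter_upwards [hVx, hρ0] with x h1 h2
    rw [h1]
    exact pow_nonneg h2 α
  have hu : IsEigensystem θ V u μ :=
    ⟨h.memStateSpace.complete, fun k => (mapsTo_congr hVx _ _).2 (h.eigen k)⟩
  refine ⟨V, hV, hVx, hu, fun p hp => ?_⟩
  obtain rfl : lam = fun k => f (μ k + σ) := funext h.occupation
  have hP := isPotential hα hV
  have hP' := isPotential hα hp
  -- In the comparison with `p`, the linear term `∫ (p.1 - V) ρ` cancels against the tangent of `V^q
  -- / q`, because `ρ = V^(q-1)`; the term in the shift cancels because the occupation numbers sum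
  -- to `Λ`.
  obtain ⟨-, hsub⟩ := hu.subgradient hf hθ hP hP' σ p.2
  obtain ⟨-, hi, hden⟩ := integral_mul_density hθ h.memStateSpace.memH1 h.memStateSpace.nonneg
    h.memStateSpace.summable_h1 (W := fun x => p.1 x - V x) (hP'.memLp.sub hP.memLp)
  rw [hden.tsum_eq, hsum.tsum_eq] at hsub
  have hρV : ∀ᵐ x ∂torusMeasure,
      ∑' k, f (μ k + σ) * ‖u k x‖ ^ 2 = V x ^ (realExponent α - 1) := by
    filter_upwards [h.density, hVx, hρ0] with x h1 h2 h3
    rw [h1.tsum_eq, h2, realExponent_sub_one hα, one_div, Real.pow_rpow_inv_natCast h3 hα0]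
  have hconv : ‖V‖ ^ realExponent α + realExponent α *
      ∫ x, (p.1 x - V x) * (∑' k, f (μ k + σ) * ‖u k x‖ ^ 2) ∂torusMeasure ≤
      ‖p.1‖ ^ realExponent α := by
    have hi1 := integrable_rpow hα hV
    have hi2 := hi.const_mul (realExponent α)
    rw [← integral_rpow hα hV, ← integral_rpow hα hp, ← integral_const_mul,
      ← integral_add hi1 hi2]
    refine integral_mono_ae (hi1.add hi2) (integrable_rpow hα hp) ?_
    filter_upwards [hρV, (Lp.coeFn_nonneg V).2 hV, (Lp.coeFn_nonneg p.1).2 hp] with x h1 h2 h3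
    have h4 := rpow_tangent_le hq (s := p.1 x) (t := V x) h3 h2
    rw [h1]
    linarith
  have hconv' := mul_le_mul_of_nonneg_left hconv (inv_pos.2 hq0).le
  rw [mul_add, inv_mul_cancel_left₀ hq0.ne'] at hconv'
  change dualFunctional α θ f Λ p ≤ dualFunctional α θ f Λ (V, σ)
  rw [dualFunctional_eq hα hp, dualFunctional_eq hα (p := (V, σ)) hV]
  linarith

end Stationary

end NLSS

end

theorem theorem4 (α : ℕ) (hα : α = 1 ∨ α = 2) (θ : Fin 3 → ℝ) (hθ : ∀ j, 0 < θ j)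
    (f : ℝ → ℝ) (hf : NLSS.CasimirClass f) (Λ : ℝ) (hΛ : 0 < Λ) :
    -- the trace is finite, so that the functional is well defined
    (∀ p ∈ NLSS.dualDomain α, NLSS.dualTrace α θ f p ≠ ⊤) ∧
    -- continuity, strict concavity, upper bound, coercivity
    ContinuousOn (NLSS.dualFunctional α θ f Λ) (NLSS.dualDomain α) ∧
    StrictConcaveOn ℝ (NLSS.dualDomain α) (NLSS.dualFunctional α θ f Λ) ∧
    BddAbove (NLSS.dualFunctional α θ f Λ '' NLSS.dualDomain α) ∧
    Tendsto (fun p => -NLSS.dualFunctional α θ f Λ p)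
      (Bornology.cobounded (NLSS.Potential α × ℝ) ⊓ 𝓟 (NLSS.dualDomain α)) atTop ∧
    -- the unique maximizer
    ∃ (V₀ : NLSS.Potential α) (σ₀ : ℝ),
      (V₀, σ₀) ∈ NLSS.dualDomain α ∧
      IsMaxOn (NLSS.dualFunctional α θ f Λ) (NLSS.dualDomain α) (V₀, σ₀) ∧
      (∀ p ∈ NLSS.dualDomain α,
        IsMaxOn (NLSS.dualFunctional α θ f Λ) (NLSS.dualDomain α) p → p = (V₀, σ₀)) ∧
      -- every complete orthonormal system of eigenfunctions of `-Δ + V₀` gives a stationary state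
      (∀ (u : ℕ → NLSS.L2T) (μ lam : ℕ → ℝ) (ρ : NLSS.Torus3 → ℝ),
        NLSS.IsEigensystem θ V₀ u μ →
        (∀ k, lam k = f (μ k + σ₀)) →
        (∀ x, ρ x = ∑' k, lam k * ‖u k x‖ ^ 2) →
          HasSum lam Λ ∧
          (∀ᵐ x ∂NLSS.torusMeasure, V₀ x = ρ x ^ α) ∧
          NLSS.IsStationaryState α θ (fun s => f (s + σ₀)) u lam μ ρ) ∧
      -- there is such a system, and the stationary state is unique, up to the numbering of the
      -- eigenvalues and the choice of orthonormal bases of the eigenspaces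
      ∃ (u₀ : ℕ → NLSS.L2T) (lam₀ μ₀ : ℕ → ℝ) (ρ₀ : NLSS.Torus3 → ℝ),
        NLSS.IsEigensystem θ V₀ u₀ μ₀ ∧
        (∀ k, lam₀ k = f (μ₀ k + σ₀)) ∧
        (∀ x, ρ₀ x = ∑' k, lam₀ k * ‖u₀ k x‖ ^ 2) ∧
        ∀ (σ : ℝ) (u : ℕ → NLSS.L2T) (lam μ : ℕ → ℝ) (ρ : NLSS.Torus3 → ℝ),
          NLSS.IsStationaryState α θ (fun s => f (s + σ)) u lam μ ρ →
          HasSum lam Λ →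
            σ = σ₀ ∧
            (∀ᵐ x ∂NLSS.torusMeasure, ρ x = ρ₀ x) ∧
            (∃ e : Equiv.Perm ℕ, ∀ k, μ k = μ₀ (e k) ∧ lam k = lam₀ (e k)) ∧
            ∀ m : ℝ, Submodule.span ℂ (u '' {k | μ k = m}) =
              Submodule.span ℂ (u₀ '' {k | μ₀ k = m}) := by
  have hconc := NLSS.strictConcaveOn_dualFunctional (Λ := Λ) hα hθ hf
  obtain ⟨⟨V₀, σ₀⟩, hD, hmax⟩ := NLSS.exists_isMaxOn_dualFunctional hα hθ hf hΛ
  have hV₀ : 0 ≤ V₀ := hD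
  have hP := NLSS.isPotential hα hV₀
  have huniq : ∀ p ∈ NLSS.dualDomain α,
      IsMaxOn (NLSS.dualFunctional α θ f Λ) (NLSS.dualDomain α) p → p = (V₀, σ₀) :=
    fun p hp hpm => hconc.eq_of_isMaxOn hpm hmax hp hD
  refine ⟨fun p hp => NLSS.dualTrace_ne_top hα hθ hf hp,
    NLSS.continuousOn_dualFunctional hα hθ hf, hconc, NLSS.bddAbove_dualFunctional hα hθ hf hΛ,
    NLSS.tendsto_neg_dualFunctional hα hθ hf hΛ, V₀, σ₀, hD, hmax, huniq,
    fun u μ lam ρ hu hlam hρ => NLSS.isStationaryState_of_isMaxOn hα hθ hf hV₀ hmax hu hlam hρ, ?_⟩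
  obtain ⟨u₀, μ₀, hu₀⟩ := NLSS.exists_eigensystem hθ hP
  refine ⟨u₀, fun k => f (μ₀ k + σ₀), μ₀, fun x => ∑' k, f (μ₀ k + σ₀) * ‖u₀ k x‖ ^ 2, hu₀,
    fun _ => rfl, fun _ => rfl, fun σ u lam μ ρ hst hsum => ?_⟩
  obtain ⟨V, hV, hVρ, hu, hVmax⟩ := hst.exists_isMaxOn hα hθ hf hsum
  -- The given state yields a maximizer, which must be the one already found. From here on both
  -- eigensystems belong to the same potential, and both densities equal its power `1/α`.
  obtain ⟨rfl, rfl⟩ := Prod.mk.inj (huniq (V, σ) hV hVmax)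
  obtain ⟨e, he⟩ := hu.exists_perm hθ hP hu₀
  have hα0 : α ≠ 0 := by rcases hα with rfl | rfl <;> norm_num
  refine ⟨rfl, ?_, ⟨e, fun k => ⟨he k, by rw [hst.occupation k, he k]⟩⟩, fun m => ?_⟩
  · filter_upwards [hVρ, hst.density,
      (NLSS.density_eq_of_isMaxOn hα hθ hf hV hmax hu₀).2] with x h1 h2 h3
    rw [h3, h1, one_div, Real.pow_rpow_inv_natCast (h2.nonneg fun k =>
      mul_nonneg (hst.memStateSpace.nonneg k) (by positivity)) hα0]
  · rw [← hu.eigenspace_eq hθ hP, ← hu₀.eigenspace_eq hθ hP]
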